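/- For $n\ge 2$ and $k=1,\dots,n$ let $B_k(q)=B_k(\|q-q_k\|)$ be a rotationally symmetric magnetic field on $\mathbb{R}^2$, with locally Lipschitz profile $B_k:[0,\infty)\to\mathbb{R}$ and support in the disc $D_k=\{\|q-q_k\|\le R_k\}$, $R_k>0$, and let the discs $D_k$ be pairwise disjoint. Put $B=\sum_k B_k$, let $J=\begin{pmatrix}0&1\\-1&0\end{pmatrix}$, let $\Phi$ be the flow of $\ddot q=B(q)J\dot q$ on the phase space of pairs $(q,p)$, $p=\dot q$, and let $\Sigma_E=\{(q,p): \tfrac12\|p\|^2=E\}$. Let $$E^\circ=\min_k\max_{r\ge0}\tfrac12\,(B_k(r)r)^2 .$$ For $E\in(0,E^\circ]$ let $R_k^+$ be the largest $r>0$ with $|B_k(r)|/\sqrt{2E}=1/r$ (the radius of the outermost circular orbit of $B_k$), let $\sigma_k\in\{1,-1\}$ be the sign of $B_k(R_k^+)$, and let $$I_k^+=-\sigma_kR_k^+\sqrt{2E}-\int_{R_k^+}^{R_k}B_k(r)\,r\,dr,\qquad \alpha_k^+=\arcsin\frac{I_k^+}{R_k\sqrt{2E}} .$$ An oriented line meeting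 $D_k$ has angle $\alpha\in[-\pi/2,\pi/2]$ with respect to $D_k$ if its counterclockwise angular momentum about $q_k$ at unit speed is $R_k\sin\alpha$; the angle $-\pi/2$ (resp. $\pi/2$) means that it is tangent to $D_k$ and has $D_k$ on its right (resp. left). Let $[\alpha_k^{\min},\alpha_k^{\max}]$ be $[-\pi/2,\alpha_k^+]$ if $\sigma_k=1$ and $[\alpha_k^+,\pi/2]$ if $\sigma_k=-1$. For $k\ne l$ consider the two oriented lines running from $D_k$ to $D_l$ whose angles with respect to $D_k$ and $D_l$ are $(\alpha_k^{\min},\alpha_l^{\min})$ and $(\alpha_k^{\max},\alpha_l^{\max})$, respectively. Let $A_{k,l}\subset\partial D_k$ be the closed arc between the two points where these lines leave $D_k$, and $B_{l,k}\subset\partial D_l$ the closed arc between the two points where they enter $D_l$ (in both cases the arc swept by the corresponding points of the lines lying between these two). The field $B$ is *in general position with respect to* $E$ if 1. $\operatorname{conv}(A_{k,l}\cup B_{l,k})\cap\operatorname{supp}B_m=\emptyset$ for all distinct $k,l,m$, and 2. $\partial D_k\setminus\bigl(\bigcup_{l\ne k}A_{k,l}\cup\bigcup_{l\ne k}B_{k,l}\bigr)\ne\emptyset$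 for all $k$. **Statement.** There is a constant $c>0$ such that, for every $E\in(0,E^\circ]$ with respect to which $B$ is in general position, the topological entropy (in the sense of Bowen) of the flow $\Phi_E=\Phi|_{\mathbb{R}\times\Sigma_E}$ satisfies $$h_{top}(\Phi_E)\ \ge\ c\sqrt{E} .$$ In particular, if $B$ is in general position with respect to every $E\in(0,E^\circ]$, this bound holds for all $E\in(0,E^\circ]$. -/

import Mathlib

open scoped Real

noncomputable section

namespace MagneticBumps

/-- The configuration plane with its Euclidean norm. -/
abbrev Plane : Type := EuclideanSpace ℝ (Fin 2)

/-- Phase space: pairs `(q, p)` of a position `q` and a velocity (momentum) `p`. -/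
abbrev Phase : Type := Plane × Plane

/-- The symplectic matrix `J = (0 1; -1 0)`, i.e. the clockwise rotation by a right angle. -/
def J (p : Plane) : Plane := !₂[p 1, -p 0]

/-! ### The magnetic flow -/

/-- The vector field of `q'' = B(q) J q'`, written as `q' = p`, `p' = B(q) J p`. -/
def magneticVectorField (B : Plane → ℝ) (x : Phase) : Phase := (x.2, B x.1 • J x.2)

/-- A complete trajectory of a particle in the magnetic field `B`. -/
def IsTrajectory (B : Plane → ℝ) (γ : ℝ → Phase) : Prop :=
  ∀ t, HasDerivAt γ (magneticVectorField B (γ t)) t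

open Classical in
/-- The magnetic flow: `magneticFlow B t x` is the position at time `t` of the trajectory that is
at `x` at time `0`. For a locally Lipschitz field with compact support there is exactly one such
trajectory, defined for all times, so that the second branch does not occur. -/
def magneticFlow (B : Plane → ℝ) (t : ℝ) (x : Phase) : Phase :=
  if h : ∃ γ : ℝ → Phase, IsTrajectory B γ ∧ γ 0 = x then h.choose t else x

/-- The energy surface `Σ_E = H⁻¹(E)`, where `H(q, p) = ‖p‖² / 2`. -/
def energySurface (E : ℝ) : Set Phase := {x | ‖x.2‖ ^ 2 / 2 = E}

/-- Bowen's topological entropy of a map `T` on an invariant, not necessarily compact, set `F`: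
the supremum over all compact `K ⊆ F` of the exponential growth rate (natural logarithm) of the
cardinalities of `(n, ε)`-spanning sets of `K`, as `n → ∞` and then `ε → 0`. -/
def bowenEntropy {X : Type*} [UniformSpace X] (T : X → X) (F : Set X) : EReal :=
  ⨆ (K : Set X) (_ : IsCompact K) (_ : K ⊆ F), Dynamics.coverEntropy T K

/-- The topological entropy of a flow `Φ` restricted to an invariant set `F`: the entropy of its
time-one map. -/
def flowEntropy {X : Type*} [UniformSpace X] (Φ : ℝ → X → X) (F : Set X) : EReal :=
  bowenEntropy (Φ 1) F

/-! ### Bumps -/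

/-- A rotationally symmetric magnetic field `q ↦ profile ‖q - center‖`, locally Lipschitz, with
support in the closed disc of radius `radius` about `center`. -/
structure Bump where
  center : Plane
  radius : ℝ
  profile : ℝ → ℝ
  radius_pos : 0 < radius
  locallyLipschitz : LocallyLipschitzOn (Set.Ici 0) profile
  profile_eq_zero : ∀ r, radius < r → profile r = 0

namespace Bump

/-- The magnetic field of the bump. -/
def field (b : Bump) (q : Plane) : ℝ := b.profile ‖q - b.center‖

/-- The supporting disc `D`. -/
def disc (b : Bump) : Set Plane := Metric.closedBall b.center b.radius

/-- The boundary circle `∂D`. -/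
def circle (b : Bump) : Set Plane := Metric.sphere b.center b.radius

/-- `E°(B) = max_{r ≥ 0} (B(r) r)² / 2`. -/
def maxEnergy (b : Bump) : ℝ := sSup ((fun r : ℝ => (b.profile r * r) ^ 2 / 2) '' Set.Ici 0)

/-- `R⁺(E)`: the largest radius of a circular orbit of energy `E`; a circle of radius `r` about the
center is an orbit if and only if `|B(r)| / √(2E) = 1 / r`. -/
def outerRadius (b : Bump) (E : ℝ) : ℝ :=
  sSup {r : ℝ | 0 < r ∧ |b.profile r| / √(2 * E) = 1 / r}

/-- The field is positive along the outermost circular orbit of energy `E`, which is then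
run through clockwise. (Otherwise the field is negative there.) -/
def IsPositive (b : Bump) (E : ℝ) : Prop := 0 < b.profile (b.outerRadius E)

open Classical in
/-- The critical magnetic momentum `I⁺(E)`: the value on the outermost circular orbit of the
integral of motion `I = r² θ' - ∫_r^R B(s) s ds`. -/
def criticalMomentum (b : Bump) (E : ℝ) : ℝ :=
  (if b.IsPositive E then -(b.outerRadius E * √(2 * E)) else b.outerRadius E * √(2 * E))
    - ∫ r in b.outerRadius E..b.radius, b.profile r * r

/-- The critical angle `α⁺(E) ∈ [-π/2, π/2]`. An oriented line that crosses `∂D` has the angle `α`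
if a particle on it with speed `√(2E)` has magnetic momentum (counterclockwise angular momentum
about the center) `I = R √(2E) sin α`. The tangents that have `D` on their right-hand side
(left-hand side) have the angle `-π/2` (`π/2`). -/
def criticalAngle (b : Bump) (E : ℝ) : ℝ :=
  Real.arcsin (b.criticalMomentum E / (b.radius * √(2 * E)))

open Classical in
/-- The lower of the two angles `tangent angle`, `α⁺`. The tangent in question is the left one
(angle `-π/2`) for a positive bump and the right one (angle `π/2`) for a negative bump. -/
def lowAngle (b : Bump) (E : ℝ) : ℝ := if b.IsPositive E then -(π / 2) else b.criticalAngle E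

open Classical in
/-- The higher of the two angles `tangent angle`, `α⁺`. -/
def highAngle (b : Bump) (E : ℝ) : ℝ := if b.IsPositive E then b.criticalAngle E else π / 2

/-! ### The transition corridors

Angular positions and directions are measured counterclockwise from the axis, the direction from
the center of `b` to the center of `b'`. -/

/-- The unit vector from the center of `b` to the center of `b'`. -/
def axis (b b' : Bump) : Plane := (dist b.center b'.center)⁻¹ • (b'.center - b.center)

/-- The unit vector obtained by turning the axis counterclockwise by `φ`. -/
def direction (b b' : Bump) (φ : ℝ) : Plane :=
  Real.cos φ • axis b b' - Real.sin φ • J (axis b b')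

/-- The direction, relative to the axis, of the line that runs from `b` to `b'` and has the angle
`α` with respect to `b` and the angle `α'` with respect to `b'`. -/
def lineAngle (b b' : Bump) (α α' : ℝ) : ℝ :=
  Real.arcsin ((b.radius * Real.sin α - b'.radius * Real.sin α') / dist b.center b'.center)

/-- The angular position (about the center of `b`) of the point where that line leaves the disc
of `b`. -/
def exitAngle (b b' : Bump) (α α' : ℝ) : ℝ := lineAngle b b' α α' - α

/-- The angular position (about the center of `b'`) of the point where that line enters the disc
of `b'`. -/
def entryAngle (b b' : Bump) (α α' : ℝ) : ℝ := lineAngle b b' α α' + α' - π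

/-- The set `A_{k,l}`, for `b` the `k`-th and `b'` the `l`-th bump: the arc of the boundary circle
of `b` between the points where the leftmost and the rightmost of the two bounding lines of the
transition corridor from `b` to `b'` leave the disc of `b`. If both bumps are positive, the left
line is the common left tangent and the right line has both critical angles; if both are negative,
the right line is the common right tangent and the left line has both critical angles; if `b` is
positive and `b'` negative, the left line is a left tangent of `b` and has the critical angle with
respect to `b'`, and the right line has the critical angle with respect to `b` and is a right
tangent of `b'`; similarly if `b` is negative and `b'` positive. -/
def exitArc (b b' : Bump) (E : ℝ) : Set Plane :=
  (fun φ : ℝ => b.center + b.radius • direction b b' φ) ''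
    Set.Icc (exitAngle b b' (b.highAngle E) (b'.highAngle E))
      (exitAngle b b' (b.lowAngle E) (b'.lowAngle E))

/-- The set `B_{l,k}`, for `b` the `k`-th and `b'` the `l`-th bump: the arc of the boundary circle
of `b'` between the points where the two bounding lines of the transition corridor from `b` to `b'`
enter the disc of `b'`. -/
def entryArc (b' b : Bump) (E : ℝ) : Set Plane :=
  (fun φ : ℝ => b'.center + b'.radius • direction b b' φ) ''
    Set.Icc (entryAngle b b' (b.lowAngle E) (b'.lowAngle E))
      (entryAngle b b' (b.highAngle E) (b'.highAngle E))

end Bump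

/-- The magnetic field `B = ∑ B_k`. -/
def totalField {n : ℕ} (b : Fin n → Bump) (q : Plane) : ℝ := ∑ k, (b k).field q

/-- `E° = min_k E°(B_k)`. -/
def maxEnergy {n : ℕ} (b : Fin n → Bump) : ℝ := ⨅ k, (b k).maxEnergy

/-- The field `B = ∑ B_k` is in general position with respect to the energy `E`. -/
structure InGeneralPosition {n : ℕ} (b : Fin n → Bump) (E : ℝ) : Prop where
  corridor : ∀ k l m, k ≠ l → k ≠ m → l ≠ m →
    convexHull ℝ ((b k).exitArc (b l) E ∪ (b l).entryArc (b k) E) ∩ tsupport (b m).field = ∅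
  section_exists : ∀ k,
    ((b k).circle \ ((⋃ (l) (_ : l ≠ k), (b k).exitArc (b l) E) ∪
      ⋃ (l) (_ : l ≠ k), (b k).entryArc (b l) E)).Nonempty

end MagneticBumps

end

/-!
Already the motions that commute between two of the bumps carry the entropy. At unit speed the
field becomes `B / √(2E)`, so it suffices to find, in a time `N * P` with `P` independent of `E`,
two to the power `N` motions that are distinguished by a fixed precision; the factor `√E` in the
bound is the speed.

*One bump.* In the co-moving frame the motion in a rotationally symmetric field is a planar
autonomous system with the magnetic momentum as an integral. A particle whose momentum lies
between that of a tangent and the critical one passes through the disc outside the outermost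
circular orbit. The turning angle of its velocity is `0` for the tangent and unbounded near the
critical momentum, at which the particle spirals towards the circular orbit for ever. So there is
an interval of momenta on which it runs continuously from `0` to two full turns
(`CriticalProfile.exists_scattering`). A long stay forces a large turning angle
(`ReducedSolution.angle_le`), by a bound that involves only the radius of the disc and a lower
bound for the radius of the circular orbit. The latter does not depend on the energy
(`Bump.exists_le_outerRadius`), which makes `P` independent of `E`.

*Two bumps.* A path of incoming lines that runs through this interval of momenta is turned into a
path of outgoing lines whose direction sweeps over the other disc for a turn by about `π` and for
one by about `3 * π`, and each time a subpath meets that disc with all momenta of its own interval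
(`exists_stretched_subpath`). By induction every word of length `N` in these two letters is
realised by a sequence of lines (`exists_itinerary`). General position enters in
`exists_transition`: such lines stay within the transition corridors, which the other bumps do not
meet, so that the lines are traversed by the particle (`exists_codedMotion`).

*Separation.* Two motions that stay close visit the discs in step, hence are at some time on the
way from one disc to the other simultaneously (`Commutes.abs_direction_sub_lt`). Directions of
velocity that start equal and stay close differ little also as real numbers, turns included
(`abs_sub_lt_pi`), while after the first letter that two words do not share the directions differ
by about a full turn. Thus close motions have the same word (`CodedMotion.word_eq`), and the
number of words bounds the entropy from below (`le_bowenEntropy_of_separated`).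
-/

open Set Metric
open scoped NNReal Topology

/-! ### Flows of bounded Lipschitz vector fields -/

section ODE

variable {E : Type*} [NormedAddCommGroup E] [NormedSpace ℝ E]

/-- Two forward solutions of an autonomous Lipschitz equation that agree at time `0` coincide. -/
lemma eqOn_Icc_of_hasDerivAt {F : E → E} {K : ℝ≥0} (hF : LipschitzWith K F)
    {γ η : ℝ → E} {T : ℝ} (hγ : ∀ t, HasDerivAt γ (F (γ t)) t)
    (hη : ∀ t ∈ Icc 0 T, HasDerivAt η (F (η t)) t) (h0 : γ 0 = η 0) :
    EqOn γ η (Icc 0 T) := by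
  refine ODE_solution_unique (v := fun _ => F) (fun _ => hF)
    (fun t _ => (hγ t).continuousAt.continuousWithinAt) (fun t _ => (hγ t).hasDerivWithinAt)
    (fun t ht => (hη t ht).continuousAt.continuousWithinAt)
    (fun t ht => (hη t (Ico_subset_Icc_self ht)).hasDerivWithinAt) h0

/-- Picard–Lindelöf on bounded intervals: as the field is bounded, the ball on which the
Picard iteration takes place may be chosen as large as the length of the interval requires. -/
lemma exists_global_solution [CompleteSpace E] {F : E → E} {K L : ℝ≥0} (hF : LipschitzWith K F)
    (hL : ∀ x, ‖F x‖ ≤ L) (x : E) :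
    ∃ γ : ℝ → E, γ 0 = x ∧ ∀ t, HasDerivAt γ (F (γ t)) t := by
  have hloc : ∀ n : ℕ, ∃ γ : ℝ → E, γ 0 = x ∧
      ∀ t ∈ Ioo (-((n : ℝ) + 1)) (n + 1), HasDerivAt γ (F (γ t)) t := by
    intro n
    have h0 : (0 : ℝ) ∈ Icc (-((n : ℝ) + 1)) (n + 1) := ⟨by linarith [n.cast_nonneg (α := ℝ)],
      by positivity⟩
    have hpl : IsPicardLindelof (fun _ : ℝ => F) (⟨0, h0⟩ : Icc (-((n : ℝ) + 1)) (n + 1)) x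
        (L * (n + 1)) 0 L K := by
      refine IsPicardLindelof.of_time_independent (fun y _ => hL y) hF.lipschitzOnWith ?_
      simp
    obtain ⟨γ, h1, h2⟩ := hpl.exists_eq_forall_mem_Icc_hasDerivWithinAt₀
    exact ⟨γ, h1, fun t ht => (h2 t (Ioo_subset_Icc_self ht)).hasDerivAt (Icc_mem_nhds ht.1 ht.2)⟩
  choose γ h0 hγ using hloc
  have key : ∀ m n : ℕ, m ≤ n → EqOn (γ m) (γ n) (Ioo (-((m : ℝ) + 1)) (m + 1)) := by
    intro m n hmn
    have hmn' : (m : ℝ) ≤ n := by exact_mod_cast hmn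
    refine ODE_solution_unique_of_mem_Ioo (v := fun _ => F) (s := fun _ => univ) (K := K)
      (t₀ := 0) (fun _ _ => hF.lipschitzOnWith)
      ⟨by linarith [m.cast_nonneg (α := ℝ)], by positivity⟩
      (fun t ht => ⟨hγ m t ht, trivial⟩)
      (fun t ht => ⟨hγ n t ⟨by linarith [ht.1], by linarith [ht.2]⟩, trivial⟩) ?_
    rw [h0, h0]
  refine ⟨fun t => γ ⌈|t|⌉₊ t, by simp [h0], fun t => ?_⟩
  set N := ⌈|t|⌉₊ + 1 with hN
  have hmem : ∀ s : ℝ, s ∈ Ioo (-((⌈|s|⌉₊ : ℝ) + 1)) (⌈|s|⌉₊ + 1) := fun s => by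
    rw [mem_Ioo, ← abs_lt]
    linarith [Nat.le_ceil |s|]
  have ht : t ∈ Ioo (-((N : ℝ) + 1)) (N + 1) := by
    have := hmem t
    rw [hN]; push_cast
    exact ⟨by linarith [this.1], by linarith [this.2]⟩
  have heq : (fun s => γ ⌈|s|⌉₊ s) =ᶠ[𝓝 t] γ N := by
    have hopen : ∀ᶠ s in 𝓝 t, |s| < (N : ℝ) := by
      refine (continuous_abs.tendsto t).eventually (gt_mem_nhds ?_)
      rw [hN]; push_cast
      linarith [Nat.le_ceil |t|]
    filter_upwards [hopen] with s hs
    exact key _ _ (Nat.ceil_le.2 hs.le) (hmem s)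
  have := (hγ N t ht).congr_of_eventuallyEq heq
  rwa [← heq.eq_of_nhds] at this

end ODE

/-! ### Radially symmetric profiles -/

section Profile

/-- `g` is the profile of a rotationally symmetric field, normalised to unit speed and to be
positive on the outermost circular orbit: it is supported in `[0, R]`, the circle of radius `ρ` is
an orbit, and no circle of larger radius is one. -/
structure CriticalProfile (g : ℝ → ℝ) (R ρ : ℝ) (K : ℝ≥0) : Prop where
  lipschitz : LipschitzWith K g
  eq_zero : ∀ r, R ≤ r → g r = 0
  rho_pos : 0 < ρ
  critical : g ρ * ρ = 1
  lt_one : ∀ r, ρ < r → |g r| * r < 1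

/-- The integral `∫_r^R g(s) s ds`; for a trajectory of angular momentum `m` at distance `r` from
the center, `m - momentumGain g R r` is the angular momentum with which it crosses the circle of
radius `R`. -/
noncomputable def momentumGain (g : ℝ → ℝ) (R r : ℝ) : ℝ := ∫ s in r..R, g s * s

lemma momentumGain_self (g : ℝ → ℝ) (R : ℝ) : momentumGain g R R = 0 := by
  simp [momentumGain]

lemma hasDerivAt_momentumGain {g : ℝ → ℝ} (hg : Continuous g) (R r : ℝ) :
    HasDerivAt (momentumGain g R) (-(g r * r)) r := by
  have hc : Continuous fun s => g s * s := hg.mul continuous_id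
  exact intervalIntegral.integral_hasDerivAt_left (hc.intervalIntegrable _ _)
    (hc.stronglyMeasurableAtFilter _ _) hc.continuousAt

/-- As a function of the squared radius the momentum gain is differentiable at `0` as well. -/
lemma momentumGain_eq_integral_sqrt {g : ℝ → ℝ} (hg : Continuous g) {R r : ℝ} (hR : 0 ≤ R)
    (hr : 0 ≤ r) :
    momentumGain g R r = ∫ y in (r ^ 2)..(R ^ 2), g (√y) / 2 := by
  have h := intervalIntegral.integral_comp_mul_deriv (a := r) (b := R) (f := fun s : ℝ => s ^ 2)
    (f' := fun s => 2 * s) (g := fun y => g (√y) / 2)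
    (fun x _ => by simpa using hasDerivAt_pow 2 x) (by fun_prop) (by fun_prop)
  rw [← h, momentumGain]
  refine intervalIntegral.integral_congr fun s hs => ?_
  have hs0 : 0 ≤ s := (le_min hr hR).trans hs.1
  simp only [Function.comp, Real.sqrt_sq hs0]
  ring

/-- The angular momentum at infinity of the trajectories that spiral towards the outermost
circular orbit. -/
noncomputable def criticalValue (g : ℝ → ℝ) (R ρ : ℝ) : ℝ := -ρ - momentumGain g R ρ

namespace CriticalProfile

variable {g : ℝ → ℝ} {R ρ : ℝ} {K : ℝ≥0}

lemma rho_lt (h : CriticalProfile g R ρ K) : ρ < R := by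
  by_contra hc
  have := h.critical
  rw [h.eq_zero ρ (not_lt.1 hc)] at this
  simp at this

lemma radius_pos (h : CriticalProfile g R ρ K) : 0 < R := h.rho_pos.trans h.rho_lt

lemma continuous (h : CriticalProfile g R ρ K) : Continuous g := h.lipschitz.continuous

lemma strictMonoOn_add_gain (h : CriticalProfile g R ρ K) :
    StrictMonoOn (fun r => r + momentumGain g R r) (Ici ρ) := by
  have hd : ∀ r, HasDerivAt (fun r => r + momentumGain g R r) (1 + -(g r * r)) r := fun r =>
    (hasDerivAt_id' r).add (hasDerivAt_momentumGain h.continuous R r)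
  refine strictMonoOn_of_deriv_pos (convex_Ici ρ)
    (fun r _ => (hd r).continuousAt.continuousWithinAt) fun r hr => ?_
  rw [interior_Ici, mem_Ioi] at hr
  rw [(hd r).deriv]
  have h1 := h.lt_one r hr
  have h2 : g r * r ≤ |g r| * r :=
    mul_le_mul_of_nonneg_right (le_abs_self _) (h.rho_pos.trans hr).le
  linarith

lemma strictMonoOn_sub_gain (h : CriticalProfile g R ρ K) :
    StrictMonoOn (fun r => r - momentumGain g R r) (Ici ρ) := by
  have hd : ∀ r, HasDerivAt (fun r => r - momentumGain g R r) (1 - -(g r * r)) r := fun r =>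
    (hasDerivAt_id' r).sub (hasDerivAt_momentumGain h.continuous R r)
  refine strictMonoOn_of_deriv_pos (convex_Ici ρ)
    (fun r _ => (hd r).continuousAt.continuousWithinAt) fun r hr => ?_
  rw [interior_Ici, mem_Ioi] at hr
  rw [(hd r).deriv]
  have h1 := h.lt_one r hr
  have h2 : -(g r) * r ≤ |g r| * r :=
    mul_le_mul_of_nonneg_right (neg_le_abs _) (h.rho_pos.trans hr).le
  linarith

lemma neg_radius_lt_criticalValue (h : CriticalProfile g R ρ K) : -R < criticalValue g R ρ := by
  have := h.strictMonoOn_add_gain self_mem_Ici h.rho_lt.le h.rho_lt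
  simp only [momentumGain_self] at this
  rw [criticalValue]
  linarith

lemma criticalValue_lt_radius (h : CriticalProfile g R ρ K) : criticalValue g R ρ < R := by
  have := h.strictMonoOn_sub_gain self_mem_Ici h.rho_lt.le h.rho_lt
  simp only [momentumGain_self] at this
  rw [criticalValue]
  linarith [h.rho_pos]

/-- Away from the outermost circular orbit the field is uniformly weaker than needed for a
circular orbit. -/
lemma exists_gap (h : CriticalProfile g R ρ K) {r₁ : ℝ} (h₁ : ρ < r₁) :
    ∃ κ > 0, ∀ r, r₁ ≤ r → |g r| * r ≤ 1 - κ := by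
  have hc : Continuous fun r => |g r| * r := (continuous_abs.comp h.continuous).mul continuous_id
  obtain ⟨x, hx, hmax⟩ := isCompact_Icc.exists_isMaxOn
    (nonempty_Icc.2 (le_max_left r₁ R)) hc.continuousOn
  refine ⟨1 - |g x| * x, sub_pos.2 (h.lt_one x (h₁.trans_le hx.1)), fun r hr => ?_⟩
  rw [sub_sub_cancel]
  by_cases hrR : r ≤ max r₁ R
  · exact hmax ⟨hr, hrR⟩
  · rw [h.eq_zero r ((le_max_right _ _).trans (not_le.1 hrR).le), abs_zero, zero_mul]
    exact mul_nonneg (abs_nonneg _) ((h.rho_pos.trans h₁).le.trans hx.1)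

lemma abs_profile_le (h : CriticalProfile g R ρ K) {r : ℝ} (hr : 0 ≤ r) : |g r| ≤ K * R := by
  rcases le_total r R with hrR | hrR
  · have := h.lipschitz.dist_le_mul r R
    rw [Real.dist_eq, Real.dist_eq, h.eq_zero R le_rfl, sub_zero, abs_sub_comm,
      abs_of_nonneg (sub_nonneg.2 hrR)] at this
    refine this.trans (mul_le_mul_of_nonneg_left (by linarith) K.coe_nonneg)
  · rw [h.eq_zero r hrR, abs_zero]
    exact mul_nonneg K.coe_nonneg h.radius_pos.le

end CriticalProfile

/-! ### Motion in the reduced phase space -/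

open Complex in
/-- The equation of motion in the co-moving frame: the real and the imaginary part of the first
component are the components of the position (relative to the center) along the velocity and the
angular momentum, the second component is the turning angle of the velocity. -/
noncomputable def reducedField (g : ℝ → ℝ) (w : ℂ × ℝ) : ℂ × ℝ :=
  (1 - I * (g ‖w.1‖ * w.1), -g ‖w.1‖)

variable {g : ℝ → ℝ} {R ρ : ℝ} {K : ℝ≥0}

lemma CriticalProfile.lipschitz_smul (h : CriticalProfile g R ρ K) (x y : ℂ) :
    ‖(g ‖x‖ * x - g ‖y‖ * y : ℂ)‖ ≤ 2 * (K * R) * ‖x - y‖ := by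
  wlog hxy : ‖y‖ ≤ ‖x‖ generalizing x y
  · rw [norm_sub_rev, norm_sub_rev x y]
    exact this y x (not_le.1 hxy).le
  by_cases hy : ‖y‖ ≤ R
  · have h1 : (g ‖x‖ * x - g ‖y‖ * y : ℂ) = g ‖x‖ * (x - y) + ((g ‖x‖ - g ‖y‖ : ℝ) : ℂ) * y := by
      push_cast; ring
    have h2 : |g ‖x‖ - g ‖y‖| ≤ K * ‖x - y‖ := by
      have := h.lipschitz.dist_le_mul ‖x‖ ‖y‖
      rw [Real.dist_eq, Real.dist_eq] at this
      exact this.trans (mul_le_mul_of_nonneg_left (abs_norm_sub_norm_le x y) K.coe_nonneg)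
    rw [h1]
    refine (norm_add_le _ _).trans ?_
    rw [norm_mul, norm_mul, Complex.norm_real, Complex.norm_real, Real.norm_eq_abs,
      Real.norm_eq_abs]
    have h3 := mul_le_mul_of_nonneg_right (h.abs_profile_le (norm_nonneg x)) (norm_nonneg (x - y))
    have h4 := mul_le_mul h2 hy (norm_nonneg y)
      (mul_nonneg K.coe_nonneg (norm_nonneg (x - y)))
    linarith
  · rw [h.eq_zero _ (not_le.1 hy).le, h.eq_zero _ ((not_le.1 hy).le.trans hxy)]
    simp only [Complex.ofReal_zero, zero_mul, sub_zero, norm_zero]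
    have := h.radius_pos
    positivity

lemma CriticalProfile.norm_smul_le (h : CriticalProfile g R ρ K) (x : ℂ) :
    ‖(g ‖x‖ * x : ℂ)‖ ≤ K * R * R := by
  rw [norm_mul, Complex.norm_real, Real.norm_eq_abs]
  have hR := h.radius_pos
  by_cases hx : ‖x‖ ≤ R
  · exact mul_le_mul (h.abs_profile_le (norm_nonneg x)) hx (norm_nonneg x) (by positivity)
  · rw [h.eq_zero _ (not_le.1 hx).le, abs_zero, zero_mul]
    positivity

lemma CriticalProfile.exists_lipschitzWith (h : CriticalProfile g R ρ K) :
    ∃ K', LipschitzWith K' (reducedField g) := by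
  have hR := h.radius_pos
  refine ⟨⟨2 * (K * R) + K, by positivity⟩, LipschitzWith.of_dist_le_mul fun x y => ?_⟩
  rw [dist_eq_norm, dist_eq_norm]
  change _ ≤ (2 * (K * R) + K) * ‖x - y‖
  have h1 : ‖x.1 - y.1‖ ≤ ‖x - y‖ := norm_fst_le (x - y)
  have hK := K.coe_nonneg
  refine max_le ?_ ?_
  · have : ((reducedField g x - reducedField g y).1 : ℂ)
        = -(Complex.I * (g ‖x.1‖ * x.1 - g ‖y.1‖ * y.1)) := by
      simp only [reducedField, Prod.fst_sub]; ring
    rw [this, norm_neg, norm_mul, Complex.norm_I, one_mul]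
    refine (h.lipschitz_smul x.1 y.1).trans ?_
    refine mul_le_mul ?_ h1 (norm_nonneg _) (by positivity)
    linarith
  · have : ((reducedField g x - reducedField g y).2 : ℝ) = -(g ‖x.1‖ - g ‖y.1‖) := by
      simp only [reducedField, Prod.snd_sub]; ring
    rw [this, norm_neg, ← dist_eq_norm]
    refine (h.lipschitz.dist_le_mul _ _).trans ?_
    refine mul_le_mul ?_ ?_ dist_nonneg (by positivity)
    · have : 0 ≤ 2 * (K * R) := by positivity
      linarith
    · rw [Real.dist_eq]
      exact (abs_norm_sub_norm_le _ _).trans h1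

/-- A solution of the reduced equation, defined for all times. -/
structure ReducedSolution (g : ℝ → ℝ) (z : ℝ → ℂ) (Δ : ℝ → ℝ) : Prop where
  hasDerivAt_z : ∀ t, HasDerivAt z (1 - Complex.I * (g ‖z t‖ * z t)) t
  hasDerivAt_angle : ∀ t, HasDerivAt Δ (-g ‖z t‖) t

/-- The reduced flow, with turning angle `0` at time `0`. -/
lemma CriticalProfile.exists_flow (h : CriticalProfile g R ρ K) :
    ∃ (z : ℂ → ℝ → ℂ) (Δ : ℂ → ℝ → ℝ), (∀ x, z x 0 = x ∧ Δ x 0 = 0 ∧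
      ReducedSolution g (z x) (Δ x)) ∧
      ∀ t, 0 ≤ t → Continuous (fun x => z x t) ∧ Continuous fun x => Δ x t := by
  obtain ⟨K', hK'⟩ := h.exists_lipschitzWith
  have hR := h.radius_pos
  have hbd : ∀ w, ‖reducedField g w‖ ≤ (⟨1 + K * R * R + K * R, by positivity⟩ : ℝ≥0) := by
    intro w
    change _ ≤ 1 + K * R * R + K * R
    have h0 : 0 ≤ K * R := by positivity
    refine max_le ?_ ?_
    · refine (norm_sub_le _ _).trans ?_
      rw [norm_one, norm_mul, Complex.norm_I, one_mul]
      linarith [h.norm_smul_le w.1]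
    · rw [show (reducedField g w).2 = -g ‖w.1‖ from rfl, norm_neg, Real.norm_eq_abs]
      have : 0 ≤ K * R * R := by positivity
      linarith [h.abs_profile_le (norm_nonneg w.1)]
  choose γ h0 hγ using fun x : ℂ => exists_global_solution hK' hbd (x, 0)
  refine ⟨fun x t => (γ x t).1, fun x t => (γ x t).2, fun x => ⟨by simp [h0], by simp [h0],
    fun t => (hγ x t).fst, fun t => (hγ x t).snd⟩, fun t ht => ?_⟩
  have hc : Continuous fun x => γ x t := by
    refine (LipschitzWith.of_dist_le_mul (K := (Real.exp (K' * t)).toNNReal)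
      fun x y => ?_).continuous
    have := dist_le_of_trajectories_ODE (v := fun _ => reducedField g) (a := 0) (b := t)
      (fun _ => hK') (fun s _ => (hγ x s).continuousAt.continuousWithinAt)
      (fun s _ => (hγ x s).hasDerivWithinAt) (fun s _ => (hγ y s).continuousAt.continuousWithinAt)
      (fun s _ => (hγ y s).hasDerivWithinAt) (le_refl (dist (γ x 0) (γ y 0))) t ⟨ht, le_rfl⟩
    rw [h0, h0, sub_zero] at this
    rw [Real.coe_toNNReal _ (Real.exp_pos _).le, mul_comm]
    simpa [Prod.dist_eq] using this
  exact ⟨continuous_fst.comp hc, continuous_snd.comp hc⟩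

namespace ReducedSolution

variable {z : ℝ → ℂ} {Δ : ℝ → ℝ}

lemma continuous (hs : ReducedSolution g z Δ) : Continuous z :=
  continuous_iff_continuousAt.2 fun t => (hs.hasDerivAt_z t).continuousAt

lemma hasDerivAt_re (hs : ReducedSolution g z Δ) (t : ℝ) :
    HasDerivAt (fun t => (z t).re) (1 + g ‖z t‖ * (z t).im) t := by
  have := Complex.reCLM.hasFDerivAt.comp_hasDerivAt t (hs.hasDerivAt_z t)
  simpa [Function.comp_def] using this

lemma hasDerivAt_im (hs : ReducedSolution g z Δ) (t : ℝ) :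
    HasDerivAt (fun t => (z t).im) (-(g ‖z t‖ * (z t).re)) t := by
  have := Complex.imCLM.hasFDerivAt.comp_hasDerivAt t (hs.hasDerivAt_z t)
  simpa [Function.comp_def] using this

lemma hasDerivAt_sq (hs : ReducedSolution g z Δ) (t : ℝ) :
    HasDerivAt (fun t => ‖z t‖ ^ 2) (2 * (z t).re) t := by
  have h := ((hs.hasDerivAt_re t).pow 2).add ((hs.hasDerivAt_im t).pow 2)
  have he : (fun t => ‖z t‖ ^ 2) = (fun t => (z t).re) ^ 2 + (fun t => (z t).im) ^ 2 := by
    funext s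
    simp only [Pi.add_apply, Pi.pow_apply]
    rw [Complex.sq_norm, Complex.normSq_apply]; ring
  rw [he]
  exact h.congr_deriv (by push_cast; ring)

/-- Conservation of the magnetic momentum. -/
lemma im_sub_gain (hs : ReducedSolution g z Δ) (hg : Continuous g) (hR : 0 ≤ R) (t : ℝ) :
    (z t).im - momentumGain g R ‖z t‖ = (z 0).im - momentumGain g R ‖z 0‖ := by
  have hc : Continuous fun y => g (√y) / 2 := by fun_prop
  have hd : ∀ t, HasDerivAt (fun t => (z t).im - ∫ y in (‖z t‖ ^ 2)..(R ^ 2), g (√y) / 2) 0 t := by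
    intro t
    have h1 := intervalIntegral.integral_hasDerivAt_left (hc.intervalIntegrable (‖z t‖ ^ 2) (R ^ 2))
      (hc.stronglyMeasurableAtFilter _ _) hc.continuousAt
    refine ((hs.hasDerivAt_im t).sub (h1.comp t (hs.hasDerivAt_sq t))).congr_deriv ?_
    rw [Real.sqrt_sq (norm_nonneg _)]
    ring
  have := is_const_of_deriv_eq_zero (fun t => (hd t).differentiableAt) (fun t => (hd t).deriv) t 0
  rwa [← momentumGain_eq_integral_sqrt hg hR (norm_nonneg _),
    ← momentumGain_eq_integral_sqrt hg hR (norm_nonneg _)] at this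

end ReducedSolution

end Profile

/-! ### Scattering by one bump -/

section Scattering

/-- The state, in the reduced phase space, in which a particle of angular momentum `i` enters the
disc of radius `R`. -/
noncomputable def entryState (R i : ℝ) : ℂ := ⟨-√(R ^ 2 - i ^ 2), i⟩

/-- The state in which it leaves the disc. -/
noncomputable def exitState (R i : ℝ) : ℂ := ⟨√(R ^ 2 - i ^ 2), i⟩

lemma continuous_entryState (R : ℝ) : Continuous (entryState R) := by
  have : entryState R = fun i => (((-√(R ^ 2 - i ^ 2) : ℝ) : ℂ) + (i : ℂ) * Complex.I) := by
    funext i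
    apply Complex.ext <;> simp [entryState]
  rw [this]
  fun_prop

lemma norm_entryState {R i : ℝ} (hi : |i| ≤ R) : ‖entryState R i‖ = R := by
  have hR : 0 ≤ R := (abs_nonneg i).trans hi
  have h1 : 0 ≤ R ^ 2 - i ^ 2 := by
    have := sq_le_sq' (by linarith [abs_nonneg i]) hi
    rw [sq_abs] at this
    linarith
  have h2 : ‖entryState R i‖ ^ 2 = R ^ 2 := by
    rw [Complex.sq_norm, Complex.normSq_apply]
    simp only [entryState]
    linarith [Real.mul_self_sqrt h1]
  exact (pow_left_inj₀ (norm_nonneg _) hR two_ne_zero).1 h2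

variable {g : ℝ → ℝ} {R ρ : ℝ} {K : ℝ≥0} {z : ℝ → ℂ} {Δ : ℝ → ℝ} {i : ℝ}

lemma CriticalProfile.abs_momentum_le (h : CriticalProfile g R ρ K) (hi : -R ≤ i)
    (hi' : i ≤ criticalValue g R ρ) : |i| ≤ R :=
  abs_le.2 ⟨hi, hi'.trans h.criticalValue_lt_radius.le⟩

namespace ReducedSolution

lemma im_eq (hs : ReducedSolution g z Δ) (h : CriticalProfile g R ρ K)
    (hz : z 0 = entryState R i) (hi : |i| ≤ R) (t : ℝ) :
    (z t).im = i + momentumGain g R ‖z t‖ := by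
  have := hs.im_sub_gain h.continuous h.radius_pos.le t
  rw [hz, norm_entryState hi, momentumGain_self] at this
  simp only [entryState] at this
  linarith

/-- Circles on which the particle would need an angular momentum of absolute value larger than
the distance from the center cannot be reached. -/
lemma lt_norm (hs : ReducedSolution g z Δ) (h : CriticalProfile g R ρ K)
    (hz : z 0 = entryState R i) (hi : |i| ≤ R) {r₁ : ℝ} (hr : ρ ≤ r₁)
    (hr₁ : i + (r₁ + momentumGain g R r₁) < 0) {t : ℝ} (ht : 0 ≤ t) : r₁ < ‖z t‖ := by
  by_contra hc
  have hR : r₁ < R := by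
    refine (h.strictMonoOn_add_gain.lt_iff_lt hr h.rho_lt.le).1 ?_
    simp only [momentumGain_self]
    linarith [(abs_le.1 hi).1]
  obtain ⟨s, -, hs'⟩ : r₁ ∈ (fun t => ‖z t‖) '' Icc 0 t := by
    refine intermediate_value_Icc' ht hs.continuous.norm.continuousOn ⟨not_lt.1 hc, ?_⟩
    rw [hz, norm_entryState hi]
    exact hR.le
  simp only at hs'
  have h1 := hs.im_eq h hz hi s
  have h2 := (abs_le.1 (Complex.abs_im_le_norm (z s))).1
  rw [hs'] at h1 h2
  linarith

lemma rho_lt_norm (hs : ReducedSolution g z Δ) (h : CriticalProfile g R ρ K)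
    (hz : z 0 = entryState R i) (hi : -R ≤ i) (hi' : i < criticalValue g R ρ) {t : ℝ}
    (ht : 0 ≤ t) : ρ < ‖z t‖ := by
  refine hs.lt_norm h hz (h.abs_momentum_le hi hi'.le) le_rfl ?_ ht
  rw [criticalValue] at hi'
  linarith

/-- The particle stays away from the states of counterclockwise purely tangential motion. -/
lemma two_mul_rho_le (hs : ReducedSolution g z Δ) (h : CriticalProfile g R ρ K)
    (hz : z 0 = entryState R i) (hi : -R ≤ i) (hi' : i ≤ criticalValue g R ρ) {t : ℝ}
    (ht : ρ ≤ ‖z t‖) : 2 * ρ ≤ ‖z t‖ - (z t).im := by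
  have h1 := hs.im_eq h hz (h.abs_momentum_le hi hi') t
  have h2 := h.strictMonoOn_sub_gain.monotoneOn self_mem_Ici ht ht
  rw [criticalValue] at hi'
  linarith

/-- Outside the outermost circular orbit the radial component `r r'` of the motion increases. -/
lemma strictMonoOn_re (hs : ReducedSolution g z Δ) (h : CriticalProfile g R ρ K)
    (hρ : ∀ t, 0 ≤ t → ρ < ‖z t‖) : StrictMonoOn (fun t => (z t).re) (Ici 0) := by
  refine strictMonoOn_of_deriv_pos (convex_Ici 0)
    (fun t _ => (hs.hasDerivAt_re t).continuousAt.continuousWithinAt) fun t ht => ?_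
  rw [interior_Ici, mem_Ioi] at ht
  rw [(hs.hasDerivAt_re t).deriv]
  have h1 := h.lt_one _ (hρ t ht.le)
  have h2 : |g ‖z t‖ * (z t).im| ≤ |g ‖z t‖| * ‖z t‖ := by
    rw [abs_mul]
    exact mul_le_mul_of_nonneg_left (Complex.abs_im_le_norm _) (abs_nonneg _)
  linarith [(abs_le.1 h2).1]

end ReducedSolution

/-- Away from the critical angular momentum, the time spent in the disc is bounded. -/
lemma CriticalProfile.exists_uniform_exit (h : CriticalProfile g R ρ K) {i' : ℝ}
    (hi' : i' < criticalValue g R ρ) :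
    ∃ T, 0 ≤ T ∧ ∀ (z : ℝ → ℂ) (Δ : ℝ → ℝ) (i : ℝ), ReducedSolution g z Δ →
      z 0 = entryState R i → -R ≤ i → i ≤ i' → R ≤ (z T).re := by
  have hc : ContinuousAt (fun r => i' + (r + momentumGain g R r)) ρ :=
    (continuousAt_const.add (continuousAt_id.add
      (hasDerivAt_momentumGain h.continuous R ρ).continuousAt))
  have hneg : ∀ᶠ r in 𝓝[>] ρ, i' + (r + momentumGain g R r) < 0 := by
    refine (hc.eventually (gt_mem_nhds ?_)).filter_mono nhdsWithin_le_nhds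
    rw [criticalValue] at hi'
    linarith
  obtain ⟨r₁, hr₁, hr₁' : ρ < r₁⟩ := (hneg.and self_mem_nhdsWithin).exists
  obtain ⟨κ, hκ, hgap⟩ := h.exists_gap hr₁'
  have hR := h.radius_pos
  refine ⟨2 * R / κ, by positivity, fun z Δ i hs hz hi hii' => ?_⟩
  have habs := h.abs_momentum_le hi (hii'.trans hi'.le)
  have hr : ∀ t, 0 ≤ t → r₁ < ‖z t‖ := fun t ht =>
    hs.lt_norm h hz habs hr₁'.le (by linarith) ht
  have hmono : MonotoneOn (fun t => (z t).re - κ * t) (Ici 0) := by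
    have hd : ∀ t, HasDerivAt (fun t => (z t).re - κ * t)
        ((1 + g ‖z t‖ * (z t).im) - κ * 1) t := fun t =>
      (hs.hasDerivAt_re t).sub ((hasDerivAt_id' t).const_mul κ)
    refine monotoneOn_of_deriv_nonneg (convex_Ici 0)
      (fun t _ => (hd t).continuousAt.continuousWithinAt)
      (fun t _ => (hd t).differentiableAt.differentiableWithinAt) fun t ht => ?_
    rw [interior_Ici, mem_Ioi] at ht
    rw [(hd t).deriv]
    have h1 := hgap _ (hr t ht.le).le
    have h2 : |g ‖z t‖ * (z t).im| ≤ |g ‖z t‖| * ‖z t‖ := by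
      rw [abs_mul]
      exact mul_le_mul_of_nonneg_left (Complex.abs_im_le_norm _) (abs_nonneg _)
    linarith [(abs_le.1 h2).1]
  have hT : 0 ≤ 2 * R / κ := by positivity
  have h1 := hmono self_mem_Ici hT hT
  have h2 := (abs_le.1 (Complex.abs_re_le_norm (z 0))).1
  have h3 : ‖z 0‖ = R := by rw [hz, norm_entryState habs]
  have h4 : κ * (2 * R / κ) = 2 * R := mul_div_cancel₀ _ hκ.ne'
  simp only [mul_zero, sub_zero, h4] at h1
  linarith

/-- A particle that is eventually on the way out has left the disc with its initial angular
momentum, and from then on the direction of its velocity is constant. -/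
lemma ReducedSolution.exists_exit (hs : ReducedSolution g z Δ) (h : CriticalProfile g R ρ K)
    (hz : z 0 = entryState R i) (hi : -R ≤ i) (hi' : i < criticalValue g R ρ) {T₀ : ℝ}
    (hT₀ : 0 ≤ T₀) (hre : R ≤ (z T₀).re) :
    ∃ T ∈ Icc 0 T₀, (∀ t ∈ Icc 0 T, ‖z t‖ ≤ R) ∧ z T = exitState R i ∧ Δ T₀ = Δ T := by
  have hR := h.radius_pos
  have habs := h.abs_momentum_le hi hi'.le
  have hz0 : ‖z 0‖ = R := by rw [hz, norm_entryState habs]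
  have hmono := hs.strictMonoOn_re h fun t ht => hs.rho_lt_norm h hz hi hi' ht
  obtain ⟨t₀, ht₀, hre₀⟩ : (0 : ℝ) ∈ (fun t => (z t).re) '' Icc 0 T₀ := by
    refine intermediate_value_Icc hT₀
      (fun t _ => (hs.hasDerivAt_re t).continuousAt.continuousWithinAt) ⟨?_, hR.le.trans hre⟩
    rw [hz]
    simp [entryState]
  simp only at hre₀
  have hanti : AntitoneOn (fun t => ‖z t‖ ^ 2) (Icc 0 t₀) := by
    refine antitoneOn_of_deriv_nonpos (convex_Icc 0 t₀)
      (fun t _ => (hs.hasDerivAt_sq t).continuousAt.continuousWithinAt)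
      (fun t _ => (hs.hasDerivAt_sq t).differentiableAt.differentiableWithinAt) fun t ht => ?_
    rw [interior_Icc] at ht
    rw [(hs.hasDerivAt_sq t).deriv]
    have := hmono.monotoneOn ht.1.le ht₀.1 ht.2.le
    simp only [hre₀] at this
    linarith
  have hnn : ∀ t, t₀ ≤ t → 0 ≤ (z t).re := fun t ht => by
    have := hmono.monotoneOn ht₀.1 (ht₀.1.trans ht) ht
    simpa only [hre₀] using this
  have hmono2 : MonotoneOn (fun t => ‖z t‖ ^ 2) (Ici t₀) := by
    refine monotoneOn_of_deriv_nonneg (convex_Ici t₀)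
      (fun t _ => (hs.hasDerivAt_sq t).continuousAt.continuousWithinAt)
      (fun t _ => (hs.hasDerivAt_sq t).differentiableAt.differentiableWithinAt) fun t ht => ?_
    rw [interior_Ici, mem_Ioi] at ht
    rw [(hs.hasDerivAt_sq t).deriv]
    linarith [hnn t ht.le]
  obtain ⟨T, hT, hTR⟩ : R ^ 2 ∈ (fun t => ‖z t‖ ^ 2) '' Icc t₀ T₀ := by
    refine intermediate_value_Icc ht₀.2
      (fun t _ => (hs.hasDerivAt_sq t).continuousAt.continuousWithinAt) ⟨?_, ?_⟩
    · have := hanti (left_mem_Icc.2 ht₀.1) (right_mem_Icc.2 ht₀.1) ht₀.1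
      simpa only [hz0] using this
    · refine pow_le_pow_left₀ hR.le (hre.trans ?_) 2
      exact (le_abs_self _).trans (Complex.abs_re_le_norm _)
  simp only at hTR
  have hTR' : ‖z T‖ = R := (pow_left_inj₀ (norm_nonneg _) hR.le two_ne_zero).1 hTR
  have him : (z T).im = i := by
    have := hs.im_eq h hz habs T
    rwa [hTR', momentumGain_self, add_zero] at this
  refine ⟨T, ⟨ht₀.1.trans hT.1, hT.2⟩, fun t ht => ?_, ?_, ?_⟩
  · refine (pow_le_pow_iff_left₀ (norm_nonneg _) hR.le two_ne_zero).1 ?_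
    rcases le_total t t₀ with htt | htt
    · have := hanti (left_mem_Icc.2 ht₀.1) ⟨ht.1, htt⟩ ht.1
      simpa only [hz0] using this
    · rw [← hTR]
      exact hmono2 htt hT.1 ht.2
  · refine Complex.ext ?_ him
    simp only [exitState]
    have hsq : R ^ 2 - i ^ 2 = (z T).re ^ 2 := by
      rw [← hTR, ← him, Complex.sq_norm, Complex.normSq_apply]; ring
    rw [hsq, Real.sqrt_sq (hnn T hT.1)]
  · have hconst : ∀ t ∈ Icc T T₀, g ‖z t‖ = 0 := fun t ht => by
      refine h.eq_zero _ ?_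
      refine (pow_le_pow_iff_left₀ hR.le (norm_nonneg _) two_ne_zero).1 ?_
      rw [← hTR]
      exact hmono2 hT.1 (hT.1.trans ht.1) ht.1
    refine constant_of_has_deriv_right_zero (a := T) (b := T₀)
      (fun t _ => (hs.hasDerivAt_angle t).continuousAt.continuousWithinAt) (fun t ht => ?_) T₀
      ⟨hT.2, le_rfl⟩
    have := (hs.hasDerivAt_angle t).hasDerivWithinAt (s := Ici t)
    rwa [hconst t ⟨ht.1, ht.2.le⟩, neg_zero] at this

/-- A long stay in the disc forces a large turning angle. The polar angle decreases at the rate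
`-m / r²`, which is close to `1 / r` except while the radial velocity is large; the excess is
controlled by the increase of `r³ r'`. -/
lemma ReducedSolution.angle_le (hs : ReducedSolution g z Δ) (h : CriticalProfile g R ρ K)
    (hz : z 0 = entryState R i) (hi : -R ≤ i) (hi' : i < criticalValue g R ρ) (hΔ : Δ 0 = 0)
    {T : ℝ} (hT : 0 ≤ T) (hle : ∀ t ∈ Icc 0 T, ‖z t‖ ≤ R) :
    Δ T ≤ 2 * π + R ^ 3 / (2 * ρ ^ 3) - T / R := by
  have hR := h.radius_pos
  have hρ := h.rho_pos
  have hlt : ∀ t, 0 ≤ t → ρ < ‖z t‖ := fun t ht => hs.rho_lt_norm h hz hi hi' ht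
  have hrm : ∀ t, 0 ≤ t → 2 * ρ ≤ ‖z t‖ - (z t).im := fun t ht =>
    hs.two_mul_rho_le h hz hi hi'.le (hlt t ht).le
  have hsq : ∀ t, ‖z t‖ ^ 2 = (z t).re ^ 2 + (z t).im ^ 2 := fun t => by
    rw [Complex.sq_norm, Complex.normSq_apply]; ring
  have hslit : ∀ t, 0 ≤ t → Complex.I * z t ∈ Complex.slitPlane := fun t ht => by
    rw [Complex.mem_slitPlane_iff]
    by_contra hc
    rw [not_or, not_lt, not_not] at hc
    simp only [Complex.mul_re, Complex.I_re, Complex.I_im, Complex.mul_im, zero_mul, one_mul,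
      zero_sub, zero_add] at hc
    have h1 := hsq t
    rw [hc.2, zero_pow two_ne_zero, zero_add] at h1
    have h2 := (pow_left_inj₀ (norm_nonneg _) (by linarith [hc.1]) two_ne_zero).1 h1
    linarith [hrm t ht]
  set P : ℝ → ℝ := fun t => Δ t - (Complex.log (Complex.I * z t)).im
    - (z t).re * ‖z t‖ ^ 2 / (4 * ρ ^ 3) + t / R with hP
  have hd : ∀ t, 0 ≤ t → HasDerivAt P (-g ‖z t‖ - (-((z t).im) / ‖z t‖ ^ 2 - g ‖z t‖)
      - ((1 + g ‖z t‖ * (z t).im) * ‖z t‖ ^ 2 + (z t).re * (2 * (z t).re)) / (4 * ρ ^ 3)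
      + 1 / R) t := by
    intro t ht
    have hz0 : z t ≠ 0 := norm_pos_iff.1 (hρ.trans (hlt t ht))
    have h1 : HasDerivAt (fun t => (Complex.log (Complex.I * z t)).im)
        (-((z t).im) / ‖z t‖ ^ 2 - g ‖z t‖) t := by
      have h2 := ((hs.hasDerivAt_z t).const_mul Complex.I).clog_real (hslit t ht)
      refine (Complex.imCLM.hasFDerivAt.comp_hasDerivAt t h2).congr_deriv ?_
      have h3 : Complex.I * (1 - Complex.I * (g ‖z t‖ * z t)) / (Complex.I * z t)
          = (z t)⁻¹ - Complex.I * g ‖z t‖ := by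
        have := Complex.I_ne_zero
        field_simp
      rw [h3, Complex.imCLM_apply, Complex.sub_im, Complex.inv_im, Complex.sq_norm]
      simp
    exact (((hs.hasDerivAt_angle t).sub h1).sub
      (((hs.hasDerivAt_re t).mul (hs.hasDerivAt_sq t)).div_const _)).add
      ((hasDerivAt_id' t).div_const R)
  have hanti : AntitoneOn P (Icc 0 T) := by
    refine antitoneOn_of_deriv_nonpos (convex_Icc 0 T)
      (fun t ht => (hd t ht.1).continuousAt.continuousWithinAt)
      (fun t ht => (hd t (interior_subset ht).1).differentiableAt.differentiableWithinAt)
      fun t ht => ?_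
    have ht' := interior_subset ht
    rw [(hd t ht'.1).deriv]
    have hr := hlt t ht'.1
    have hr0 := hρ.trans hr
    have hg := h.lt_one _ hr
    have h2 : |g ‖z t‖ * (z t).im| ≤ |g ‖z t‖| * ‖z t‖ := by
      rw [abs_mul]
      exact mul_le_mul_of_nonneg_left (Complex.abs_im_le_norm _) (abs_nonneg _)
    have h3 : 0 ≤ 1 + g ‖z t‖ * (z t).im := by linarith [(abs_le.1 h2).1]
    -- `r + m = u² / (r - m)` is small when the radial velocity is.
    have h4 : ‖z t‖ + (z t).im ≤ (z t).re ^ 2 / (2 * ρ) := by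
      rw [le_div_iff₀ (by positivity)]
      have h5 : (z t).re ^ 2 = (‖z t‖ + (z t).im) * (‖z t‖ - (z t).im) := by
        linarith [hsq t]
      rw [h5]
      refine mul_le_mul_of_nonneg_left (hrm t ht'.1) ?_
      linarith [(abs_le.1 (Complex.abs_im_le_norm (z t))).1]
    have h6 : (z t).im / ‖z t‖ ^ 2 ≤ (z t).re ^ 2 / (2 * ρ ^ 3) - 1 / R := by
      have h7 : (z t).im ≤ (z t).re ^ 2 / (2 * ρ) - ‖z t‖ := by linarith
      have h8 : (z t).im / ‖z t‖ ^ 2 ≤ ((z t).re ^ 2 / (2 * ρ) - ‖z t‖) / ‖z t‖ ^ 2 :=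
        div_le_div_of_nonneg_right h7 (by positivity)
      have h9 : ((z t).re ^ 2 / (2 * ρ) - ‖z t‖) / ‖z t‖ ^ 2
          = (z t).re ^ 2 / (2 * ρ * ‖z t‖ ^ 2) - 1 / ‖z t‖ := by
        field_simp
      have h10 : (z t).re ^ 2 / (2 * ρ * ‖z t‖ ^ 2) ≤ (z t).re ^ 2 / (2 * ρ ^ 3) := by
        have : ρ ^ 2 ≤ ‖z t‖ ^ 2 := pow_le_pow_left₀ hρ.le hr.le 2
        refine div_le_div_of_nonneg_left (sq_nonneg _) (by positivity) ?_
        nlinarith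
      have h11 : 1 / R ≤ 1 / ‖z t‖ := one_div_le_one_div_of_le hr0 (hle t ht')
      linarith
    have h12 : (z t).re ^ 2 / (2 * ρ ^ 3) ≤ ((1 + g ‖z t‖ * (z t).im) * ‖z t‖ ^ 2
        + (z t).re * (2 * (z t).re)) / (4 * ρ ^ 3) := by
      rw [div_le_div_iff₀ (by positivity) (by positivity)]
      have : 0 ≤ (1 + g ‖z t‖ * (z t).im) * ‖z t‖ ^ 2 * ρ ^ 3 := by positivity
      linarith
    have h13 : -((z t).im) / ‖z t‖ ^ 2 = -((z t).im / ‖z t‖ ^ 2) := neg_div _ _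
    rw [h13]
    linarith
  have hfin := hanti (left_mem_Icc.2 hT) (right_mem_Icc.2 hT) hT
  have hW : ∀ t ∈ Icc 0 T, |(z t).re * ‖z t‖ ^ 2 / (4 * ρ ^ 3)| ≤ R ^ 3 / (4 * ρ ^ 3) := by
    intro t ht
    have h1 := hle t ht
    rw [abs_div, abs_mul, abs_of_pos (by positivity : 0 < 4 * ρ ^ 3),
      abs_of_nonneg (sq_nonneg ‖z t‖)]
    refine div_le_div_of_nonneg_right ?_ (by positivity)
    calc |(z t).re| * ‖z t‖ ^ 2 ≤ R * R ^ 2 := by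
          refine mul_le_mul ((Complex.abs_re_le_norm _).trans h1)
            (pow_le_pow_left₀ (norm_nonneg _) h1 2) (sq_nonneg _) hR.le
      _ = R ^ 3 := by ring
  have hW0 := abs_le.1 (hW 0 (left_mem_Icc.2 hT))
  have hW1 := abs_le.1 (hW T (right_mem_Icc.2 hT))
  have hA0 := abs_le.1 (Complex.abs_arg_le_pi (Complex.I * z 0))
  have hA1 := abs_le.1 (Complex.abs_arg_le_pi (Complex.I * z T))
  simp only [hP, hΔ, Complex.log_im, zero_div] at hfin
  have : R ^ 3 / (2 * ρ ^ 3) = R ^ 3 / (4 * ρ ^ 3) + R ^ 3 / (4 * ρ ^ 3) := by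
    field_simp; norm_num
  linarith [hW0.1, hW1.2, hA0.1, hA1.2]

/-- At the critical angular momentum the particle approaches the circular orbit for ever. -/
lemma ReducedSolution.re_neg_of_critical (hs : ReducedSolution g z Δ)
    (h : CriticalProfile g R ρ K) (hz : z 0 = entryState R (criticalValue g R ρ)) {t : ℝ}
    (ht : 0 ≤ t) : (z t).re < 0 := by
  have hR := h.radius_pos
  have hρ := h.rho_pos
  have hi := h.neg_radius_lt_criticalValue
  have habs := h.abs_momentum_le hi.le le_rfl
  have hz0 : ‖z 0‖ = R := by rw [hz, norm_entryState habs]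
  have hne : ∀ t, ‖z t‖ ≠ ρ := by
    intro t htρ
    have him := hs.im_eq h hz habs t
    rw [htρ, criticalValue] at him
    have him' : (z t).im = -ρ := by linarith
    have hre : (z t).re = 0 := by
      have h1 : ‖z t‖ ^ 2 = (z t).re ^ 2 + (z t).im ^ 2 := by
        rw [Complex.sq_norm, Complex.normSq_apply]; ring
      rw [htρ, him'] at h1
      exact pow_eq_zero_iff two_ne_zero |>.1 (by linarith : (z t).re ^ 2 = 0)
    set z₀ : ℂ := -(ρ * Complex.I) with hz₀
    have hzt : z t = z₀ := by
      apply Complex.ext <;> simp [hz₀, hre, him']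
    have hnorm : ‖z₀‖ = ρ := by rw [← hzt, htρ]
    -- The circular orbit is an equilibrium of the reduced equation.
    have hL : LipschitzWith ⟨2 * (K * R), by positivity⟩
        (fun z : ℂ => 1 - Complex.I * (g ‖z‖ * z)) := by
      refine LipschitzWith.of_dist_le_mul fun x y => ?_
      rw [dist_eq_norm, dist_eq_norm, sub_sub_sub_cancel_left, ← mul_sub, norm_mul, Complex.norm_I,
        one_mul, norm_sub_rev]
      exact h.lipschitz_smul x y
    have hconst := ODE_solution_unique_univ
      (v := fun _ (z : ℂ) => 1 - Complex.I * (g ‖z‖ * z)) (s := fun _ => univ)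
      (f := z) (g := fun _ => z₀) (t₀ := t) (fun _ => hL.lipschitzOnWith)
      (fun s => ⟨hs.hasDerivAt_z s, trivial⟩) (fun s => ⟨?_, trivial⟩) hzt
    · have := congrArg norm (congrFun hconst 0)
      rw [hz0, hnorm] at this
      exact h.rho_lt.ne' this
    · refine (hasDerivAt_const s z₀).congr_deriv ?_
      have hcrit : (g ρ : ℂ) * ρ = 1 := by exact_mod_cast h.critical
      rw [hnorm, hz₀]
      have : Complex.I * (g ρ * -(ρ * Complex.I)) = -((g ρ : ℂ) * ρ) * (Complex.I * Complex.I) := by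
        ring
      rw [this, hcrit, Complex.I_mul_I]
      ring
  have hlt : ∀ t, 0 ≤ t → ρ < ‖z t‖ := by
    intro t ht
    by_contra hc
    obtain ⟨s, -, hs'⟩ : ρ ∈ (fun t => ‖z t‖) '' Icc 0 t :=
      intermediate_value_Icc' ht hs.continuous.norm.continuousOn
        ⟨not_lt.1 hc, hz0 ▸ h.rho_lt.le⟩
    exact hne s hs'
  by_contra hc
  obtain ⟨s, hs0, hs'⟩ : (0 : ℝ) ∈ (fun t => (z t).re) '' Icc 0 t := by
    refine intermediate_value_Icc ht
      (fun t _ => (hs.hasDerivAt_re t).continuousAt.continuousWithinAt) ⟨?_, not_lt.1 hc⟩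
    rw [hz]
    simp [entryState]
  simp only at hs'
  have h1 : ‖z s‖ = |(z s).im| := by
    have : ‖z s‖ ^ 2 = |(z s).im| ^ 2 := by
      rw [Complex.sq_norm, Complex.normSq_apply, hs', sq_abs]; ring
    exact (pow_left_inj₀ (norm_nonneg _) (abs_nonneg _) two_ne_zero).1 this
  have h2 := hs.two_mul_rho_le h hz hi.le le_rfl (hlt s hs0.1).le
  have h3 := h.strictMonoOn_add_gain self_mem_Ici (hlt s hs0.1).le (hlt s hs0.1)
  have h4 := hs.im_eq h hz habs s
  simp only [criticalValue] at h3 h4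
  rcases abs_choice (z s).im with h5 | h5
  · rw [h5] at h1
    linarith
  · rw [h5] at h1
    linarith

end Scattering

/-! ### Crossings -/

section Crossing

lemma exists_crossing_of_le {f : ℝ → ℝ} {a b x y : ℝ} (hab : a ≤ b)
    (hf : ContinuousOn f (Icc a b)) (hx : f a ≤ x) (hxy : x ≤ y) (hy : y ≤ f b) :
    ∃ a' ∈ Icc a b, ∃ b' ∈ Icc a b, a' ≤ b' ∧ f a' = x ∧ f b' = y ∧
      ∀ s ∈ Icc a' b', f s ∈ Icc x y := by
  have hS : (Icc a b ∩ f ⁻¹' {x}).Nonempty := by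
    obtain ⟨s, hs, hs'⟩ := intermediate_value_Icc hab hf ⟨hx, hxy.trans hy⟩
    exact ⟨s, hs, hs'⟩
  have hSc : IsCompact (Icc a b ∩ f ⁻¹' {x}) :=
    isCompact_Icc.of_isClosed_subset (hf.preimage_isClosed_of_isClosed isClosed_Icc
      isClosed_singleton) inter_subset_left
  obtain ⟨a', ⟨ha', hfa'⟩, hamax⟩ := hSc.exists_isGreatest hS
  rw [mem_preimage, mem_singleton_iff] at hfa'
  have hf' : ContinuousOn f (Icc a' b) := hf.mono (Icc_subset_Icc_left ha'.1)
  have hS2 : (Icc a' b ∩ f ⁻¹' {y}).Nonempty := by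
    obtain ⟨s, hs, hs'⟩ := intermediate_value_Icc ha'.2 hf' ⟨hfa'.le.trans hxy, hy⟩
    exact ⟨s, hs, hs'⟩
  have hSc2 : IsCompact (Icc a' b ∩ f ⁻¹' {y}) :=
    isCompact_Icc.of_isClosed_subset (hf'.preimage_isClosed_of_isClosed isClosed_Icc
      isClosed_singleton) inter_subset_left
  obtain ⟨b', ⟨hb', hfb'⟩, hbmin⟩ := hSc2.exists_isLeast hS2
  rw [mem_preimage, mem_singleton_iff] at hfb'
  refine ⟨a', ha', b', ⟨ha'.1.trans hb'.1, hb'.2⟩, hb'.1, hfa', hfb', fun s hs => ⟨?_, ?_⟩⟩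
  · by_contra hc
    rw [not_le] at hc
    obtain ⟨s', hs', hfs'⟩ := intermediate_value_Icc (hs.2.trans hb'.2)
      (hf'.mono (Icc_subset_Icc_left hs.1)) ⟨hc.le, hxy.trans hy⟩
    have h1 := hamax ⟨⟨ha'.1.trans (hs.1.trans hs'.1), hs'.2⟩, hfs'⟩
    have h2 : s = a' := le_antisymm (hs'.1.trans h1) hs.1
    rw [h2, hfa'] at hc
    exact lt_irrefl _ hc
  · by_contra hc
    rw [not_le] at hc
    obtain ⟨s', hs', hfs'⟩ := intermediate_value_Icc hs.1
      (hf'.mono (Icc_subset_Icc_right (hs.2.trans hb'.2))) ⟨hfa'.le.trans hxy, hc.le⟩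
    have h1 := hbmin ⟨⟨hs'.1, hs'.2.trans (hs.2.trans hb'.2)⟩, hfs'⟩
    have h2 : s = b' := le_antisymm hs.2 (h1.trans hs'.2)
    rw [h2, hfb'] at hc
    exact lt_irrefl _ hc

/-- If a continuous function takes values on both sides of an interval, then it maps some
subinterval into that interval, end points to end points. -/
lemma exists_crossing {f : ℝ → ℝ} {a b x y : ℝ} (hf : ContinuousOn f (uIcc a b))
    (hx : x ∈ uIcc (f a) (f b)) (hy : y ∈ uIcc (f a) (f b)) :
    ∃ a' ∈ uIcc a b, ∃ b' ∈ uIcc a b, f a' = x ∧ f b' = y ∧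
      ∀ s ∈ uIcc a' b', f s ∈ uIcc x y := by
  wlog hab : a ≤ b generalizing a b
  · rw [uIcc_comm a b] at hf ⊢
    rw [uIcc_comm (f a)] at hx hy
    exact this hf hx hy (not_le.1 hab).le
  wlog hxy : x ≤ y generalizing x y
  · obtain ⟨a', ha', b', hb', h1, h2, h3⟩ := this hy hx (not_le.1 hxy).le
    refine ⟨b', hb', a', ha', h2, h1, fun s hs => ?_⟩
    rw [uIcc_comm] at hs ⊢
    exact h3 s hs
  rw [uIcc_of_le hab] at hf ⊢
  rcases le_total (f a) (f b) with h | h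
  · rw [uIcc_of_le h] at hx hy
    obtain ⟨a', ha', b', hb', hab', h1, h2, h3⟩ := exists_crossing_of_le hab hf hx.1 hxy hy.2
    refine ⟨a', ha', b', hb', h1, h2, fun s hs => ?_⟩
    rw [uIcc_of_le hab'] at hs
    rw [uIcc_of_le hxy]
    exact h3 s hs
  · rw [uIcc_of_ge h] at hx hy
    obtain ⟨a', ha', b', hb', hab', h1, h2, h3⟩ :=
      exists_crossing_of_le hab hf.neg (neg_le_neg hy.2) (neg_le_neg hxy) (neg_le_neg hx.1)
    refine ⟨b', hb', a', ha', neg_injective h2, neg_injective h1, fun s hs => ?_⟩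
    rw [uIcc_of_ge hab'] at hs
    rw [uIcc_of_le hxy]
    exact ⟨neg_le_neg_iff.1 (h3 s hs).2, neg_le_neg_iff.1 (h3 s hs).1⟩

end Crossing

/-! ### The turning angle as a function of the momentum -/

section

variable {g : ℝ → ℝ} {R ρ : ℝ} {K : ℝ≥0}

/-- The turning angle `S` of the velocity during a visit to the bump, as a function of the angular
momentum: there is an interval of angular momenta, between that of a tangent and the critical one,
on which it goes from `0` to `-A`, and on which the duration of the visits is bounded in terms of
`R`, `ρ` and `A`. -/
theorem CriticalProfile.exists_scattering (h : CriticalProfile g R ρ K) {A : ℝ} (hA : 0 ≤ A) :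
    ∃ (S : ℝ → ℝ) (x y : ℝ), x ∈ Ico (-R) (criticalValue g R ρ) ∧
      y ∈ Ico (-R) (criticalValue g R ρ) ∧ ContinuousOn S (uIcc x y) ∧ S x = 0 ∧ S y = -A ∧
      ∀ i ∈ uIcc x y, ∃ T ∈ Icc 0 (R * (2 * π + R ^ 3 / (2 * ρ ^ 3) + A)),
        ∃ (z : ℝ → ℂ) (Δ : ℝ → ℝ), ReducedSolution g z Δ ∧ z 0 = entryState R i ∧ Δ 0 = 0 ∧
          (∀ t ∈ Icc 0 T, ‖z t‖ ≤ R) ∧ z T = exitState R i ∧ Δ T = S i := by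
  have hR := h.radius_pos
  have hρ := h.rho_pos
  set T₀ := R * (2 * π + R ^ 3 / (2 * ρ ^ 3) + A) with hT₀def
  have hT₀ : 0 ≤ T₀ := by have := Real.pi_pos; positivity
  obtain ⟨z, Δ, hflow, hcont⟩ := h.exists_flow
  have hs : ∀ i, ReducedSolution g (z (entryState R i)) (Δ (entryState R i)) :=
    fun i => (hflow _).2.2
  have hz : ∀ i, z (entryState R i) 0 = entryState R i := fun i => (hflow _).1
  have hΔ : ∀ i, Δ (entryState R i) 0 = 0 := fun i => (hflow _).2.1
  -- Near the critical angular momentum the particle is still moving inwards at time `T₀`.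
  obtain ⟨i', hi'neg, hi'⟩ : ∃ i', (z (entryState R i') T₀).re < 0 ∧
      i' ∈ Ioo (-R) (criticalValue g R ρ) := by
    have hc : Continuous fun i => (z (entryState R i) T₀).re :=
      Complex.continuous_re.comp ((hcont T₀ hT₀).1.comp (continuous_entryState R))
    have h1 : ∀ᶠ i in 𝓝[<] criticalValue g R ρ, (z (entryState R i) T₀).re < 0 :=
      (hc.continuousAt.eventually (gt_mem_nhds
        ((hs _).re_neg_of_critical h (hz _) hT₀))).filter_mono nhdsWithin_le_nhds
    exact (h1.and (Ioo_mem_nhdsLT h.neg_radius_lt_criticalValue)).exists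
  obtain ⟨T₁, hT₁, hexit⟩ := h.exists_uniform_exit hi'.2
  have hSc : Continuous fun i => Δ (entryState R i) T₁ :=
    (hcont T₁ hT₁).2.comp (continuous_entryState R)
  have hvisit : ∀ i ∈ Icc (-R) i', ∃ T ∈ Icc 0 T₁, (∀ t ∈ Icc 0 T, ‖z (entryState R i) t‖ ≤ R) ∧
      z (entryState R i) T = exitState R i ∧ Δ (entryState R i) T₁ = Δ (entryState R i) T :=
    fun i hi => (hs i).exists_exit h (hz i) hi.1 (hi.2.trans_lt hi'.2) hT₁
      (hexit _ _ i (hs i) (hz i) hi.1 hi.2)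
  have hbound : ∀ i ∈ Icc (-R) i', ∀ T, 0 ≤ T → (∀ t ∈ Icc 0 T, ‖z (entryState R i) t‖ ≤ R) →
      Δ (entryState R i) T ≤ 2 * π + R ^ 3 / (2 * ρ ^ 3) - T / R :=
    fun i hi T hT hle => (hs i).angle_le h (hz i) hi.1 (hi.2.trans_lt hi'.2) (hΔ i) hT hle
  have hS₀ : Δ (entryState R (-R)) T₁ = 0 := by
    have hout : ∀ t, 0 ≤ t → R ≤ ‖z (entryState R (-R)) t‖ := by
      intro t ht
      by_contra hc
      set r₁ := max ρ ‖z (entryState R (-R)) t‖ with hr₁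
      have hr₁R : r₁ < R := max_lt h.rho_lt (not_le.1 hc)
      have := h.strictMonoOn_add_gain (le_max_left ρ _) h.rho_lt.le hr₁R
      simp only [momentumGain_self] at this
      exact absurd ((hs (-R)).lt_norm h (hz _) (by rw [abs_neg, abs_of_pos hR])
        (le_max_left ρ _) (by linarith) ht) (not_lt.2 (le_max_right _ _))
    rw [← hΔ (-R)]
    refine constant_of_has_deriv_right_zero (a := 0) (b := T₁)
      (fun t _ => ((hs (-R)).hasDerivAt_angle t).continuousAt.continuousWithinAt)
      (fun t ht => ?_) T₁ ⟨hT₁, le_rfl⟩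
    have := ((hs (-R)).hasDerivAt_angle t).hasDerivWithinAt (s := Ici t)
    rwa [h.eq_zero _ (hout t ht.1), neg_zero] at this
  have hS₁ : Δ (entryState R i') T₁ ≤ -A := by
    have hmem : i' ∈ Icc (-R) i' := ⟨hi'.1.le, le_rfl⟩
    obtain ⟨T, hT, hle, hzT, hΔT⟩ := hvisit i' hmem
    have hmono := (hs i').strictMonoOn_re h fun t ht =>
      (hs i').rho_lt_norm h (hz i') hi'.1.le hi'.2 ht
    have hlt : T₀ < T := by
      refine (hmono.lt_iff_lt hT₀ hT.1).1 (hi'neg.trans_le ?_)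
      rw [hzT]
      exact Real.sqrt_nonneg _
    have h1 := hbound i' hmem T hT.1 hle
    have h2 : 2 * π + R ^ 3 / (2 * ρ ^ 3) + A ≤ T / R := by
      rw [le_div_iff₀ hR, mul_comm]
      exact hlt.le
    rw [hΔT]
    linarith
  obtain ⟨x, hx, y, hy, hSx, hSy, hS⟩ := exists_crossing (f := fun i => Δ (entryState R i) T₁)
    (a := -R) (b := i') (x := 0) (y := -A) hSc.continuousOn
    (by rw [hS₀]; exact left_mem_uIcc)
    (by rw [hS₀, uIcc_of_ge (hS₁.trans (neg_nonpos.2 hA))]; exact ⟨hS₁, neg_nonpos.2 hA⟩)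
  rw [uIcc_of_le hi'.1.le] at hx hy
  refine ⟨fun i => Δ (entryState R i) T₁, x, y, ⟨hx.1, hx.2.trans_lt hi'.2⟩,
    ⟨hy.1, hy.2.trans_lt hi'.2⟩, hSc.continuousOn, hSx, hSy, fun i hi => ?_⟩
  have hmem : i ∈ Icc (-R) i' := (uIcc_subset_Icc hx hy) hi
  obtain ⟨T, hT, hle, hzT, hΔT⟩ := hvisit i hmem
  refine ⟨T, ⟨hT.1, ?_⟩, z (entryState R i), Δ (entryState R i), hs i, hz i, hΔ i, hle, hzT,
    hΔT.symm⟩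
  have h1 := hbound i hmem T hT.1 hle
  have h2 := (hS i hi)
  rw [uIcc_of_ge (neg_nonpos.2 hA), hΔT] at h2
  have h3 : T / R ≤ 2 * π + R ^ 3 / (2 * ρ ^ 3) + A := by linarith [h2.1]
  rw [div_le_iff₀ hR] at h3
  linarith [mul_comm R (2 * π + R ^ 3 / (2 * ρ ^ 3) + A)]

end

/-! ### The normalised profile of a bump -/

namespace MagneticBumps

namespace Bump

lemma profile_eq_zero_of_le (b : Bump) {r : ℝ} (hr : b.radius ≤ r) : b.profile r = 0 := by
  rcases hr.lt_or_eq with h | h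
  · exact b.profile_eq_zero r h
  · have hc : ContinuousWithinAt b.profile (Ioi b.radius) b.radius :=
      (b.locallyLipschitz.continuousOn b.radius b.radius_pos.le).mono
        (Ioi_subset_Ici b.radius_pos.le)
    have h0 : Filter.Tendsto b.profile (𝓝[>] b.radius) (𝓝 0) :=
      tendsto_const_nhds.congr' (by
        filter_upwards [self_mem_nhdsWithin] with s hs using (b.profile_eq_zero s hs).symm)
    rw [← h]
    exact tendsto_nhds_unique hc h0

lemma exists_lipschitzWith (b : Bump) : ∃ K : ℝ≥0, LipschitzWith K fun r => b.profile |r| := by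
  obtain ⟨K, hK⟩ := (b.locallyLipschitz.mono
    (Icc_subset_Ici_self : Icc 0 b.radius ⊆ Ici 0)).exists_lipschitzOnWith_of_compact isCompact_Icc
  refine ⟨K, LipschitzWith.of_dist_le_mul fun x y => ?_⟩
  have hmin : ∀ r : ℝ, b.profile |r| = b.profile (min |r| b.radius) := fun r => by
    rcases le_total |r| b.radius with h | h
    · rw [min_eq_left h]
    · rw [min_eq_right h, b.profile_eq_zero_of_le h, b.profile_eq_zero_of_le le_rfl]
  have hmem : ∀ r : ℝ, min |r| b.radius ∈ Icc 0 b.radius := fun r =>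
    ⟨le_min (abs_nonneg r) b.radius_pos.le, min_le_right _ _⟩
  rw [hmin x, hmin y]
  refine (hK.dist_le_mul _ (hmem x) _ (hmem y)).trans
    (mul_le_mul_of_nonneg_left ?_ K.coe_nonneg)
  rw [Real.dist_eq, Real.dist_eq]
  refine (abs_min_sub_min_le_max _ _ _ _).trans ?_
  rw [sub_self, abs_zero, max_eq_left (abs_nonneg _)]
  exact abs_abs_sub_abs_le_abs_sub x y

lemma continuousOn_profile (b : Bump) : ContinuousOn b.profile (Ici 0) :=
  b.locallyLipschitz.continuousOn

lemma continuousOn_abs_mul (b : Bump) : ContinuousOn (fun r => |b.profile r| * r) (Ici 0) :=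
  b.continuousOn_profile.abs.mul continuousOn_id

/-- The maximal energy of circular orbits is attained. -/
lemma exists_maxEnergy (b : Bump) :
    ∃ r ∈ Icc 0 b.radius, (b.profile r * r) ^ 2 / 2 = b.maxEnergy := by
  have hc : ContinuousOn (fun r => (b.profile r * r) ^ 2 / 2) (Icc 0 b.radius) :=
    ((b.continuousOn_profile.mono Icc_subset_Ici_self).mul continuousOn_id).pow 2 |>.div_const 2
  obtain ⟨r, hr, hmax⟩ := isCompact_Icc.exists_isMaxOn (nonempty_Icc.2 b.radius_pos.le) hc
  refine ⟨r, hr, ?_⟩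
  have hgr : IsGreatest ((fun r : ℝ => (b.profile r * r) ^ 2 / 2) '' Ici 0)
      ((b.profile r * r) ^ 2 / 2) := by
    refine ⟨⟨r, hr.1, rfl⟩, ?_⟩
    rintro _ ⟨s, hs, rfl⟩
    rcases le_total s b.radius with h | h
    · exact hmax ⟨hs, h⟩
    · simp only [b.profile_eq_zero_of_le h, zero_mul, zero_pow two_ne_zero, zero_div]
      positivity
  exact hgr.csSup_eq.symm

/-- The radii of the circular orbits of energy `E` beyond a point at which the field is too strong
have a largest element. -/
lemma isGreatest_outerRadius (b : Bump) {E : ℝ} (hE : 0 < E) {r₀ : ℝ} (h0 : 0 < r₀)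
    (hr₀ : √(2 * E) ≤ |b.profile r₀| * r₀) :
    IsGreatest {r : ℝ | 0 < r ∧ |b.profile r| * r = √(2 * E)} (b.outerRadius E) ∧
      r₀ ≤ b.outerRadius E := by
  have hv : 0 < √(2 * E) := Real.sqrt_pos.2 (by positivity)
  have hset : {r : ℝ | 0 < r ∧ |b.profile r| / √(2 * E) = 1 / r}
      = {r : ℝ | 0 < r ∧ |b.profile r| * r = √(2 * E)} := by
    ext r
    simp only [mem_ofPred_eq]
    refine and_congr_right fun hr => ?_
    rw [div_eq_div_iff hv.ne' hr.ne', one_mul]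
  have hle : ∀ r, 0 < r → |b.profile r| * r = √(2 * E) → r ≤ b.radius := by
    intro r hr h
    by_contra hc
    rw [b.profile_eq_zero_of_le (not_le.1 hc).le, abs_zero, zero_mul] at h
    exact hv.ne h
  have hr₀R : r₀ ≤ b.radius := by
    by_contra hc
    rw [b.profile_eq_zero_of_le (not_le.1 hc).le, abs_zero, zero_mul] at hr₀
    exact hr₀.not_gt hv
  have hc : ContinuousOn (fun r => |b.profile r| * r) (Icc r₀ b.radius) :=
    b.continuousOn_abs_mul.mono ((Icc_subset_Icc_left h0.le).trans Icc_subset_Ici_self)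
  have hne : (Icc r₀ b.radius ∩ (fun r => |b.profile r| * r) ⁻¹' {√(2 * E)}).Nonempty := by
    obtain ⟨s, hs, hs'⟩ := intermediate_value_Icc' hr₀R hc
      (show √(2 * E) ∈ Icc _ _ from ⟨by
        simp only [b.profile_eq_zero_of_le le_rfl, abs_zero, zero_mul]
        exact hv.le, hr₀⟩)
    exact ⟨s, hs, hs'⟩
  obtain ⟨ρ, ⟨hρ, hρ'⟩, hmax⟩ := (isCompact_Icc.of_isClosed_subset
    (hc.preimage_isClosed_of_isClosed isClosed_Icc isClosed_singleton)
    inter_subset_left).exists_isGreatest hne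
  have hgr : IsGreatest {r : ℝ | 0 < r ∧ |b.profile r| * r = √(2 * E)} ρ := by
    refine ⟨⟨h0.trans_le hρ.1, hρ'⟩, ?_⟩
    rintro s ⟨hs, hs'⟩
    rcases le_total r₀ s with h | h
    · exact hmax ⟨⟨h, hle s hs hs'⟩, hs'⟩
    · exact h.trans hρ.1
  have : b.outerRadius E = ρ := by
    rw [outerRadius, hset]
    exact hgr.csSup_eq
  rw [this]
  exact ⟨hgr, hρ.1⟩

/-- The radii of the outermost circular orbits are bounded away from `0`, uniformly in the
energy. -/
lemma exists_le_outerRadius (b : Bump) : ∃ r₀ > 0, ∀ E ∈ Ioc 0 b.maxEnergy,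
    r₀ ≤ b.outerRadius E ∧
      IsGreatest {r : ℝ | 0 < r ∧ |b.profile r| * r = √(2 * E)} (b.outerRadius E) := by
  by_cases hmax : 0 < b.maxEnergy
  · obtain ⟨r, hr, hrE⟩ := b.exists_maxEnergy
    have hr0 : 0 < r := by
      refine lt_of_le_of_ne hr.1 fun h => ?_
      rw [← h] at hrE
      norm_num at hrE
      exact hmax.ne hrE
    -- The field at `r` is too strong for circular orbits of any of these energies.
    refine ⟨r, hr0, fun E hE => ?_⟩
    have := b.isGreatest_outerRadius hE.1 hr0 ?_
    · exact ⟨this.2, this.1⟩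
    · rw [Real.sqrt_le_left (by positivity), mul_pow, sq_abs, ← mul_pow]
      linarith [hE.2]
  · exact ⟨1, one_pos, fun E hE => absurd (hE.1.trans_le hE.2) hmax⟩

open Classical in
/-- The sign of the field on the outermost circular orbit of energy `E`. -/
noncomputable def sign (b : Bump) (E : ℝ) : ℝ := if b.IsPositive E then 1 else -1

lemma sign_mul_self (b : Bump) (E : ℝ) : b.sign E * b.sign E = 1 := by
  rw [sign]; split_ifs <;> norm_num

/-- The profile for motion at unit speed, made positive on the outermost circular orbit, and
extended to an even function on the real line. -/
noncomputable def normalProfile (b : Bump) (E r : ℝ) : ℝ := b.sign E * b.profile |r| / √(2 * E)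

lemma exists_criticalProfile (b : Bump) {E : ℝ} (hE : 0 < E)
    (h : IsGreatest {r : ℝ | 0 < r ∧ |b.profile r| * r = √(2 * E)} (b.outerRadius E)) :
    ∃ K, CriticalProfile (b.normalProfile E) b.radius (b.outerRadius E) K := by
  have hv : 0 < √(2 * E) := Real.sqrt_pos.2 (by positivity)
  obtain ⟨K, hK⟩ := b.exists_lipschitzWith
  have habs : |b.sign E| = 1 := by
    rw [sign]; split_ifs <;> norm_num
  have habs2 : ∀ r, 0 ≤ r → |b.normalProfile E r| * r = |b.profile r| * r / √(2 * E) :=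
    fun r hr => by
      rw [normalProfile, abs_div, abs_mul, habs, abs_of_pos hv, abs_of_nonneg hr, one_mul]
      ring
  have hρ := h.1.1
  refine ⟨K / (√(2 * E)).toNNReal, ?_, ?_, h.1.1, ?_, ?_⟩
  · refine LipschitzWith.of_dist_le_mul fun x y => ?_
    have h1 : b.normalProfile E x - b.normalProfile E y
        = b.sign E * (b.profile |x| - b.profile |y|) / √(2 * E) := by
      rw [normalProfile, normalProfile]; ring
    rw [Real.dist_eq, h1, abs_div, abs_mul, habs, one_mul, abs_of_pos hv, div_le_iff₀ hv]
    have h2 := hK.dist_le_mul x y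
    rw [Real.dist_eq] at h2
    refine h2.trans (le_of_eq ?_)
    rw [NNReal.coe_div, Real.coe_toNNReal _ hv.le]
    field_simp
  · intro r hr
    rw [normalProfile, b.profile_eq_zero_of_le (hr.trans (le_abs_self r))]
    simp
  · have h1 : b.sign E * b.profile (b.outerRadius E) = |b.profile (b.outerRadius E)| := by
      rw [sign]
      split_ifs with hp
      · rw [abs_of_pos hp, one_mul]
      · rw [abs_of_nonpos (not_lt.1 hp), neg_one_mul]
    rw [normalProfile, abs_of_pos hρ, h1, div_mul_eq_mul_div, h.1.2, div_self hv.ne']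
  · intro r hr
    have hr0 : 0 < r := hρ.trans hr
    rw [habs2 r hr0.le, div_lt_one hv]
    by_contra hc
    rw [not_lt] at hc
    exact absurd (b.isGreatest_outerRadius hE hr0 hc).2 (not_le.2 hr)

/-- The critical momentum of the bump and the critical value of its normalised profile. -/
lemma criticalMomentum_eq (b : Bump) {E : ℝ} (hE : 0 < E) (hρ : 0 < b.outerRadius E)
    (hρR : b.outerRadius E < b.radius) :
    b.criticalMomentum E = √(2 * E) *
      (b.sign E * criticalValue (b.normalProfile E) b.radius (b.outerRadius E)) := by
  have hv : 0 < √(2 * E) := Real.sqrt_pos.2 (by positivity)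
  have hint : momentumGain (b.normalProfile E) b.radius (b.outerRadius E)
      = b.sign E / √(2 * E) * ∫ r in b.outerRadius E..b.radius, b.profile r * r := by
    rw [momentumGain, ← intervalIntegral.integral_const_mul]
    refine intervalIntegral.integral_congr fun s hs => ?_
    rw [uIcc_of_le hρR.le] at hs
    simp only [normalProfile, abs_of_pos (hρ.trans_le hs.1)]
    ring
  rw [criticalMomentum, criticalValue, hint]
  have h2 : √(2 * E) * (b.sign E * (-b.outerRadius E - b.sign E / √(2 * E) *
      ∫ r in b.outerRadius E..b.radius, b.profile r * r)) = -(b.sign E * b.outerRadius E * √(2 * E))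
      - (b.sign E * b.sign E) * ∫ r in b.outerRadius E..b.radius, b.profile r * r := by
    field_simp
  rw [h2, b.sign_mul_self, sign]
  split_ifs <;> ring

/-- The angle of an oriented line whose angular momentum about the center, normalised by the sign
of the bump, is `m`. -/
noncomputable def angle (b : Bump) (E m : ℝ) : ℝ := Real.arcsin (b.sign E * m / b.radius)

/-- Lines with a momentum between the one of a tangent and the critical one have angles in the
corridor of the bump. -/
lemma angle_mem (b : Bump) {E : ℝ} (hE : 0 < E) {K : ℝ≥0}
    (h : CriticalProfile (b.normalProfile E) b.radius (b.outerRadius E) K) {m : ℝ}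
    (hm : -b.radius ≤ m)
    (hm' : m ≤ criticalValue (b.normalProfile E) b.radius (b.outerRadius E)) :
    b.angle E m ∈ Icc (b.lowAngle E) (b.highAngle E) ∧
      b.radius * Real.sin (b.angle E m) = b.sign E * m := by
  have hR := b.radius_pos
  have hv : 0 < √(2 * E) := Real.sqrt_pos.2 (by positivity)
  have hcrit : b.criticalAngle E = Real.arcsin
      (b.sign E * criticalValue (b.normalProfile E) b.radius (b.outerRadius E) / b.radius) := by
    rw [criticalAngle, b.criticalMomentum_eq hE h.rho_pos h.rho_lt]
    congr 1
    field_simp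
  have habs : |b.sign E * m / b.radius| ≤ 1 := by
    have h1 : |b.sign E| = 1 := by
      rw [sign]; split_ifs <;> norm_num
    rw [abs_div, abs_mul, h1, one_mul, abs_of_pos hR, div_le_one hR]
    exact h.abs_momentum_le hm hm'
  refine ⟨?_, ?_⟩
  · rw [lowAngle, highAngle, hcrit, angle, sign]
    split_ifs
    · refine ⟨Real.neg_pi_div_two_le_arcsin _, Real.monotone_arcsin ?_⟩
      rw [one_mul, one_mul]
      exact div_le_div_of_nonneg_right hm' hR.le
    · refine ⟨Real.monotone_arcsin ?_, Real.arcsin_le_pi_div_two _⟩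
      exact div_le_div_of_nonneg_right (by linarith) hR.le
  · rw [angle, Real.sin_arcsin (abs_le.1 habs).1 (abs_le.1 habs).2, mul_div_cancel₀ _ hR.ne']

lemma neg_pi_div_two_le_lowAngle (b : Bump) (E : ℝ) : -(π / 2) ≤ b.lowAngle E := by
  rw [lowAngle]
  split_ifs
  · exact le_rfl
  · exact Real.neg_pi_div_two_le_arcsin _

lemma highAngle_le_pi_div_two (b : Bump) (E : ℝ) : b.highAngle E ≤ π / 2 := by
  rw [highAngle]
  split_ifs
  · exact Real.arcsin_le_pi_div_two _
  · exact le_rfl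

end Bump

end MagneticBumps

/-! ### Lines from one bump to another -/

namespace MagneticBumps

/-- The vector obtained from `A` by a counterclockwise rotation by `φ`. -/
noncomputable def rotated (A : Plane) (φ : ℝ) : Plane := Real.cos φ • A - Real.sin φ • J A

section Rotation

variable (A : Plane)

lemma rotated_apply_zero (φ : ℝ) : rotated A φ 0 = Real.cos φ * A 0 - Real.sin φ * A 1 := by
  simp [rotated, J]

lemma rotated_apply_one (φ : ℝ) : rotated A φ 1 = Real.cos φ * A 1 + Real.sin φ * A 0 := by
  simp [rotated, J]

lemma plane_ext {p q : Plane} (h0 : p 0 = q 0) (h1 : p 1 = q 1) : p = q := by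
  ext i
  fin_cases i
  · exact h0
  · exact h1

lemma norm_sq_plane (p : Plane) : ‖p‖ ^ 2 = p 0 ^ 2 + p 1 ^ 2 := by
  rw [EuclideanSpace.norm_sq_eq, Fin.sum_univ_two, Real.norm_eq_abs, Real.norm_eq_abs, sq_abs,
    sq_abs]

lemma rotated_add (φ ψ : ℝ) :
    rotated A (φ + ψ) = Real.cos ψ • rotated A φ + Real.sin ψ • rotated A (φ + π / 2) := by
  apply plane_ext <;>
  simp only [rotated_apply_zero, rotated_apply_one, PiLp.add_apply, PiLp.smul_apply, smul_eq_mul,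
    Real.cos_add, Real.sin_add, Real.cos_pi_div_two, Real.sin_pi_div_two] <;> ring

lemma rotated_rotated (φ ψ : ℝ) : rotated (rotated A φ) ψ = rotated A (φ + ψ) := by
  apply plane_ext <;>
  simp only [rotated_apply_zero, rotated_apply_one, Real.cos_add, Real.sin_add] <;> ring

lemma rotated_add_pi (φ : ℝ) : rotated A (φ + π) = -rotated A φ := by
  rw [rotated_add]; simp

lemma J_rotated (φ : ℝ) : J (rotated A φ) = -rotated A (φ + π / 2) := by
  apply plane_ext
  · simp [rotated_apply_zero, rotated_apply_one, J, Real.cos_add, Real.sin_add]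
  · simp [rotated_apply_zero, rotated_apply_one, J, Real.cos_add, Real.sin_add]
    ring

lemma hasDerivAt_rotated (φ : ℝ) : HasDerivAt (rotated A) (rotated A (φ + π / 2)) φ := by
  refine (((Real.hasDerivAt_cos φ).smul_const A).sub
    ((Real.hasDerivAt_sin φ).smul_const (J A))).congr_deriv ?_
  simp [rotated, Real.cos_add_pi_div_two, Real.sin_add_pi_div_two]

variable {A}

lemma norm_sq_frame (hA : ‖A‖ = 1) (φ a b : ℝ) :
    ‖a • rotated A φ - b • rotated A (φ + π / 2)‖ ^ 2 = a ^ 2 + b ^ 2 := by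
  have h1 : A 0 ^ 2 + A 1 ^ 2 = 1 := by rw [← norm_sq_plane, hA, one_pow]
  have h2 := Real.sin_sq_add_cos_sq φ
  rw [norm_sq_plane]
  simp only [rotated_apply_zero, rotated_apply_one, PiLp.sub_apply, PiLp.smul_apply, smul_eq_mul,
    Real.cos_add_pi_div_two, Real.sin_add_pi_div_two]
  linear_combination (a ^ 2 + b ^ 2) * (A 0 ^ 2 + A 1 ^ 2) * h2 + (a ^ 2 + b ^ 2) * h1

lemma norm_rotated (hA : ‖A‖ = 1) (φ : ℝ) : ‖rotated A φ‖ = 1 := by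
  have := norm_sq_frame hA φ 1 0
  simp only [one_smul, zero_smul, sub_zero] at this
  exact (pow_left_inj₀ (norm_nonneg _) zero_le_one two_ne_zero).1 (by rw [this]; norm_num)

lemma lipschitz_rotated (hA : ‖A‖ = 1) : LipschitzWith 1 (rotated A) := by
  refine lipschitzWith_of_nnnorm_deriv_le (fun φ => (hasDerivAt_rotated A φ).differentiableAt)
    fun φ => ?_
  rw [(hasDerivAt_rotated A φ).deriv, ← NNReal.coe_le_coe, coe_nnnorm, norm_rotated hA,
    NNReal.coe_one]

end Rotation

/-- The derivative of `x ↦ arcsin ((R sin x - k) / d)` is at most `1`: it is `R cos x` divided by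
the length of the projection of the segment between the centers to the line. -/
lemma antitone_arcsin_sub {R R' d k : ℝ} (hR : 0 ≤ R) (hd : R + R' < d) (hk : |k| ≤ R') :
    Antitone fun x : ℝ => Real.arcsin ((R * Real.sin x - k) / d) - x := by
  have hR' : 0 ≤ R' := (abs_nonneg k).trans hk
  have hd0 : 0 < d := by linarith
  have hlt : ∀ x, |(R * Real.sin x - k) / d| < 1 := fun x => by
    rw [abs_div, abs_of_pos hd0, div_lt_one hd0]
    refine (abs_sub _ _).trans_lt ?_
    rw [abs_mul, abs_of_nonneg hR]
    have := mul_le_mul_of_nonneg_left (Real.abs_sin_le_one x) hR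
    linarith
  have hder : ∀ x, HasDerivAt (fun x : ℝ => Real.arcsin ((R * Real.sin x - k) / d) - x)
      (1 / √(1 - ((R * Real.sin x - k) / d) ^ 2) * (R * Real.cos x / d) - 1) x := fun x => by
    have h1 := abs_lt.1 (hlt x)
    exact ((Real.hasDerivAt_arcsin h1.1.ne' h1.2.ne).comp x
      ((((Real.hasDerivAt_sin x).const_mul R).sub_const k).div_const d)).sub (hasDerivAt_id' x)
  refine antitone_of_deriv_nonpos (fun x => (hder x).differentiableAt) fun x => ?_
  rw [(hder x).deriv, sub_nonpos, one_div_mul_eq_div]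
  have h1 : 0 < 1 - ((R * Real.sin x - k) / d) ^ 2 := by
    rw [sub_pos, ← sq_abs]
    exact pow_lt_one₀ (abs_nonneg _) (hlt x) two_ne_zero
  rw [div_le_one (Real.sqrt_pos.2 h1)]
  refine Real.le_sqrt_of_sq_le ?_
  have h2 : (R * Real.cos x / d) ^ 2 + ((R * Real.sin x - k) / d) ^ 2
      = (R ^ 2 - 2 * (R * k * Real.sin x) + k ^ 2) / d ^ 2 := by
    have := Real.sin_sq_add_cos_sq x
    field_simp
    linear_combination R ^ 2 * this
  have h3 : (R ^ 2 - 2 * (R * k * Real.sin x) + k ^ 2) / d ^ 2 ≤ 1 := by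
    rw [div_le_one (by positivity)]
    have h4 : |R * k * Real.sin x| ≤ R * R' := by
      rw [abs_mul, abs_mul, abs_of_nonneg hR]
      calc R * |k| * |Real.sin x| ≤ R * R' * 1 := by
            refine mul_le_mul (mul_le_mul_of_nonneg_left hk hR) (Real.abs_sin_le_one x)
              (abs_nonneg _) (mul_nonneg hR hR')
        _ = R * R' := mul_one _
    have h5 : k ^ 2 ≤ R' ^ 2 := by
      rw [← sq_abs k]
      exact pow_le_pow_left₀ (abs_nonneg k) hk 2
    have h6 : (R + R') ^ 2 ≤ d ^ 2 := pow_le_pow_left₀ (by linarith) hd.le 2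
    linarith [(abs_le.1 h4).1]
  linarith

namespace Bump

lemma direction_eq (b b' : Bump) (φ : ℝ) : direction b b' φ = rotated (axis b b') φ := rfl

variable {b b' : Bump}

lemma abs_radius_mul_sin_le (b : Bump) (x : ℝ) : |b.radius * Real.sin x| ≤ b.radius := by
  rw [abs_mul, abs_of_pos b.radius_pos]
  exact mul_le_of_le_one_right b.radius_pos.le (Real.abs_sin_le_one x)

lemma lineAngle_mono_left {α₁ α₂ : ℝ} (h1 : -(π / 2) ≤ α₁) (h2 : α₂ ≤ π / 2) (h : α₁ ≤ α₂)
    (α' : ℝ) : lineAngle b b' α₁ α' ≤ lineAngle b b' α₂ α' := by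
  refine Real.monotone_arcsin (div_le_div_of_nonneg_right ?_ dist_nonneg)
  have := mul_le_mul_of_nonneg_left
    (Real.sin_le_sin_of_le_of_le_pi_div_two h1 h2 h) b.radius_pos.le
  linarith

lemma lineAngle_anti_right {α₁ α₂ : ℝ} (h1 : -(π / 2) ≤ α₁) (h2 : α₂ ≤ π / 2) (h : α₁ ≤ α₂)
    (α : ℝ) : lineAngle b b' α α₂ ≤ lineAngle b b' α α₁ := by
  refine Real.monotone_arcsin (div_le_div_of_nonneg_right ?_ dist_nonneg)
  have := mul_le_mul_of_nonneg_left
    (Real.sin_le_sin_of_le_of_le_pi_div_two h1 h2 h) b'.radius_pos.le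
  linarith

lemma exitAngle_anti (hd : b.radius + b'.radius < dist b.center b'.center) {α₁ α₂ α₁' α₂' : ℝ}
    (h : α₁ ≤ α₂) (h1 : -(π / 2) ≤ α₁') (h2 : α₂' ≤ π / 2) (h' : α₁' ≤ α₂') :
    exitAngle b b' α₂ α₂' ≤ exitAngle b b' α₁ α₁' := by
  have h3 := antitone_arcsin_sub b.radius_pos.le hd (b'.abs_radius_mul_sin_le α₁') h
  have h4 := lineAngle_anti_right (b := b) (b' := b') h1 h2 h' α₂
  simp only [exitAngle, lineAngle] at *
  linarith

lemma entryAngle_mono (hd : b.radius + b'.radius < dist b.center b'.center) {α₁ α₂ α₁' α₂' : ℝ}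
    (h' : α₁' ≤ α₂') (h1 : -(π / 2) ≤ α₁) (h2 : α₂ ≤ π / 2) (h : α₁ ≤ α₂) :
    entryAngle b b' α₁ α₁' ≤ entryAngle b b' α₂ α₂' := by
  have h3 := antitone_arcsin_sub b'.radius_pos.le ((add_comm _ _).trans_lt hd)
    (b.abs_radius_mul_sin_le α₂) h'
  have h4 := lineAngle_mono_left (b := b) (b' := b') h1 h2 h α₁'
  have h5 : ∀ x, (b'.radius * Real.sin x - b.radius * Real.sin α₂) / dist b.center b'.center
      = -((b.radius * Real.sin α₂ - b'.radius * Real.sin x) / dist b.center b'.center) :=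
    fun x => by ring
  simp only [h5, Real.arcsin_neg] at h3
  simp only [entryAngle, lineAngle] at *
  linarith

/-- The length of the segment between the two discs of a line that has the angles `α`, `α'` with
respect to them and the direction `lam` relative to the axis. -/
noncomputable def gapLength (b b' : Bump) (α α' lam : ℝ) : ℝ :=
  dist b.center b'.center * Real.cos lam - b.radius * Real.cos α - b'.radius * Real.cos α'

lemma gapLength_nonneg (hd : b.radius + b'.radius < dist b.center b'.center) {α α' lam : ℝ}
    (hlam : |lam| ≤ π / 2)
    (h : dist b.center b'.center * Real.sin lam
      = b.radius * Real.sin α - b'.radius * Real.sin α') : 0 ≤ gapLength b b' α α' lam := by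
  have hR := b.radius_pos
  have hR' := b'.radius_pos
  set d := dist b.center b'.center
  have hd0 : 0 < d := by linarith
  have hcos : 0 ≤ Real.cos lam := Real.cos_nonneg_of_mem_Icc (abs_le.1 hlam)
  have h1 : (b.radius * Real.cos α + b'.radius * Real.cos α') ^ 2 ≤ (d * Real.cos lam) ^ 2 := by
    have e1 := Real.sin_sq_add_cos_sq lam
    have e2 := Real.sin_sq_add_cos_sq α
    have e3 := Real.sin_sq_add_cos_sq α'
    have e4 : (d * Real.cos lam) ^ 2
        = d ^ 2 - (b.radius * Real.sin α - b'.radius * Real.sin α') ^ 2 := by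
      rw [← h]
      linear_combination d ^ 2 * e1
    have e5 : (b.radius * Real.cos α + b'.radius * Real.cos α') ^ 2
        + (b.radius * Real.sin α - b'.radius * Real.sin α') ^ 2
        = b.radius ^ 2 + b'.radius ^ 2 + 2 * (b.radius * b'.radius) * Real.cos (α + α') := by
      rw [Real.cos_add]
      linear_combination b.radius ^ 2 * e2 + b'.radius ^ 2 * e3
    have e6 : 2 * (b.radius * b'.radius) * Real.cos (α + α') ≤ 2 * (b.radius * b'.radius) :=
      mul_le_of_le_one_right (by positivity) (Real.cos_le_one _)
    have e7 : (b.radius + b'.radius) ^ 2 ≤ d ^ 2 := pow_le_pow_left₀ (by linarith) hd.le 2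
    linarith
  have := abs_le_of_sq_le_sq' h1 (mul_nonneg hd0.le hcos)
  rw [gapLength]
  linarith [this.2]

lemma gapLength_le {α α' lam : ℝ} (hα : 0 ≤ Real.cos α) (hα' : 0 ≤ Real.cos α') :
    gapLength b b' α α' lam ≤ dist b.center b'.center := by
  have h1 := mul_nonneg b.radius_pos.le hα
  have h2 := mul_nonneg b'.radius_pos.le hα'
  have h3 := mul_le_of_le_one_right (dist_nonneg (x := b.center) (y := b'.center))
    (Real.cos_le_one lam)
  rw [gapLength]
  linarith

/-- The end points of the segment between the discs lie on the arcs of the corridor. -/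
lemma corridor_points (hd : b.radius + b'.radius < dist b.center b'.center) {E α α' δ Ω : ℝ}
    {A : Plane} (hax : axis b b' = rotated A Ω) (hα : α ∈ Icc (b.lowAngle E) (b.highAngle E))
    (hα' : α' ∈ Icc (b'.lowAngle E) (b'.highAngle E)) (hlam : |δ - Ω| ≤ π / 2)
    (h : dist b.center b'.center * Real.sin (δ - Ω)
      = b.radius * Real.sin α - b'.radius * Real.sin α') :
    b.center + b.radius • rotated A (δ - α) ∈ exitArc b b' E ∧
    b'.center - b'.radius • rotated A (δ + α') ∈ entryArc b' b E ∧
    (b'.center - b'.radius • rotated A (δ + α')) - (b.center + b.radius • rotated A (δ - α))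
      = gapLength b b' α α' (δ - Ω) • rotated A δ := by
  have hR := b.radius_pos
  have hR' := b'.radius_pos
  have hd0 : 0 < dist b.center b'.center := by linarith
  have hline : lineAngle b b' α α' = δ - Ω := by
    rw [lineAngle, ← h, mul_div_cancel_left₀ _ hd0.ne', Real.arcsin_sin (abs_le.1 hlam).1
      (abs_le.1 hlam).2]
  have l1 := b.neg_pi_div_two_le_lowAngle E
  have l2 := b.highAngle_le_pi_div_two E
  have l1' := b'.neg_pi_div_two_le_lowAngle E
  have l2' := b'.highAngle_le_pi_div_two E
  refine ⟨⟨exitAngle b b' α α', ⟨?_, ?_⟩, ?_⟩, ⟨entryAngle b b' α α', ⟨?_, ?_⟩, ?_⟩, ?_⟩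
  · exact exitAngle_anti hd hα.2 (l1'.trans hα'.1) l2' hα'.2
  · exact exitAngle_anti hd hα.1 l1' (hα'.2.trans l2') hα'.1
  · simp only
    rw [direction_eq, hax, rotated_rotated, exitAngle, hline]
    congr 3
    ring
  · exact entryAngle_mono hd hα'.1 l1 (hα.2.trans l2) hα.1
  · exact entryAngle_mono hd hα'.2 (l1.trans hα.1) l2 hα.2
  · simp only
    have : δ + α' = Ω + (δ - Ω + α' - π) + π := by ring
    rw [direction_eq, hax, rotated_rotated, entryAngle, hline, this, rotated_add_pi, smul_neg,
      sub_neg_eq_add]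
  · have hc : b'.center - b.center = dist b.center b'.center • rotated A Ω := by
      rw [← hax, axis, smul_smul, mul_inv_cancel₀ hd0.ne', one_smul]
    have hΩ : rotated A Ω = Real.cos (δ - Ω) • rotated A δ
        - Real.sin (δ - Ω) • rotated A (δ + π / 2) := by
      have := rotated_add A δ (-(δ - Ω))
      rwa [Real.cos_neg, Real.sin_neg, neg_smul, ← sub_eq_add_neg, ← sub_eq_add_neg,
        sub_sub_cancel] at this
    have hα1 : rotated A (δ - α) = Real.cos α • rotated A δ
        - Real.sin α • rotated A (δ + π / 2) := by
      have := rotated_add A δ (-α)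
      rwa [Real.cos_neg, Real.sin_neg, neg_smul, ← sub_eq_add_neg, ← sub_eq_add_neg] at this
    have e1 : (b'.center - b'.radius • rotated A (δ + α'))
        - (b.center + b.radius • rotated A (δ - α)) = (b'.center - b.center)
        - b'.radius • rotated A (δ + α') - b.radius • rotated A (δ - α) := by abel
    rw [e1, hc, hΩ, hα1, rotated_add A δ α', gapLength]
    have hs : dist b.center b'.center * Real.sin (δ - Ω) - b.radius * Real.sin α
        + b'.radius * Real.sin α' = 0 := by linarith
    have e2 : dist b.center b'.center • (Real.cos (δ - Ω) • rotated A δ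
          - Real.sin (δ - Ω) • rotated A (δ + π / 2))
        - b'.radius • (Real.cos α' • rotated A δ + Real.sin α' • rotated A (δ + π / 2))
        - b.radius • (Real.cos α • rotated A δ - Real.sin α • rotated A (δ + π / 2))
        = (dist b.center b'.center * Real.cos (δ - Ω) - b.radius * Real.cos α
          - b'.radius * Real.cos α') • rotated A δ
        - (dist b.center b'.center * Real.sin (δ - Ω) - b.radius * Real.sin α
          + b'.radius * Real.sin α') • rotated A (δ + π / 2) := by
      module
    rw [e2, hs, zero_smul, sub_zero]

end Bump

end MagneticBumps

/-! ### The magnetic flow with lifted direction -/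

namespace MagneticBumps

namespace Bump

lemma field_lipschitz (b : Bump) : ∃ K : ℝ≥0, LipschitzWith K b.field := by
  obtain ⟨K, hK⟩ := b.exists_lipschitzWith
  refine ⟨K, LipschitzWith.of_dist_le_mul fun p q => ?_⟩
  have h := hK.dist_le_mul ‖p - b.center‖ ‖q - b.center‖
  simp only [abs_norm] at h
  refine h.trans (mul_le_mul_of_nonneg_left ?_ K.coe_nonneg)
  rw [Real.dist_eq, dist_eq_norm]
  refine (abs_norm_sub_norm_le _ _).trans ?_
  rw [sub_sub_sub_cancel_right]

lemma field_bounded (b : Bump) : ∃ M : ℝ, ∀ q, |b.field q| ≤ M := by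
  obtain ⟨M, hM⟩ := (isCompact_Icc (a := 0) (b := b.radius)).exists_bound_of_continuousOn
    (b.continuousOn_profile.mono Icc_subset_Ici_self)
  refine ⟨M, fun q => ?_⟩
  rcases le_total ‖q - b.center‖ b.radius with h | h
  · exact hM _ ⟨norm_nonneg _, h⟩
  · rw [field, b.profile_eq_zero_of_le h, abs_zero]
    exact (abs_nonneg _).trans (hM 0 ⟨le_rfl, b.radius_pos.le⟩)

lemma field_eq_zero (b : Bump) {q : Plane} (hq : b.radius ≤ ‖q - b.center‖) : b.field q = 0 :=
  b.profile_eq_zero_of_le hq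

end Bump

variable {n : ℕ} {b : Fin n → Bump}

lemma totalField_lipschitz (b : Fin n → Bump) : ∃ K : ℝ≥0, LipschitzWith K (totalField b) := by
  choose K hK using fun k => (b k).field_lipschitz
  refine ⟨∑ k, K k, LipschitzWith.of_dist_le_mul fun p q => ?_⟩
  rw [Real.dist_eq, totalField, totalField, ← Finset.sum_sub_distrib]
  refine (Finset.abs_sum_le_sum_abs _ _).trans ?_
  rw [NNReal.coe_sum, Finset.sum_mul]
  exact Finset.sum_le_sum fun k _ => (hK k).dist_le_mul p q

lemma totalField_bounded (b : Fin n → Bump) : ∃ M : ℝ, 0 ≤ M ∧ ∀ q, |totalField b q| ≤ M := by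
  choose M hM using fun k => (b k).field_bounded
  refine ⟨∑ k, M k, Finset.sum_nonneg fun k _ => (abs_nonneg _).trans (hM k 0), fun q => ?_⟩
  exact (Finset.abs_sum_le_sum_abs _ _).trans (Finset.sum_le_sum fun k _ => hM k q)

lemma totalField_eq_of_mem_disc (hdisj : ∀ k l, k ≠ l → Disjoint (b k).disc (b l).disc)
    {k : Fin n} {q : Plane} (hq : q ∈ (b k).disc) : totalField b q = (b k).field q := by
  rw [totalField]
  refine Finset.sum_eq_single k (fun l _ hl => (b l).field_eq_zero ?_) fun h =>
    absurd (Finset.mem_univ k) h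
  have := Set.disjoint_right.1 (hdisj l k hl) hq
  rw [Bump.disc, mem_closedBall, dist_eq_norm, not_le] at this
  exact this.le

/-- The equation of motion at unit speed in the field `β`, with the direction of the velocity
(measured from `A`) as a real variable. -/
noncomputable def liftedField (A : Plane) (β : Plane → ℝ) (w : Plane × ℝ) : Plane × ℝ :=
  (rotated A w.2, -β w.1)

lemma lipschitz_liftedField {A : Plane} (hA : ‖A‖ = 1) {β : Plane → ℝ} {K : ℝ≥0}
    (hβ : LipschitzWith K β) : LipschitzWith (max 1 K) (liftedField A β) := by
  have h1 : LipschitzWith 1 fun w : Plane × ℝ => rotated A w.2 := by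
    simpa [Function.comp_def] using (lipschitz_rotated hA).comp LipschitzWith.prod_snd
  have h2 : LipschitzWith K fun w : Plane × ℝ => -β w.1 := by
    refine LipschitzWith.of_dist_le_mul fun x y => ?_
    rw [dist_neg_neg]
    exact (hβ.dist_le_mul _ _).trans
      (mul_le_mul_of_nonneg_left (le_max_left _ _) K.coe_nonneg)
  exact h1.prodMk h2

lemma exists_lifted_solution {A : Plane} (hA : ‖A‖ = 1) {β : Plane → ℝ} {K : ℝ≥0}
    (hβ : LipschitzWith K β) {M : ℝ} (hM : 0 ≤ M) (hβM : ∀ q, |β q| ≤ M) (w : Plane × ℝ) :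
    ∃ γ : ℝ → Plane × ℝ, γ 0 = w ∧ ∀ t, HasDerivAt γ (liftedField A β (γ t)) t := by
  refine exists_global_solution (L := ⟨1 + M, by positivity⟩) (lipschitz_liftedField hA hβ)
    (fun w => ?_) w
  change _ ≤ 1 + M
  refine max_le ?_ ?_
  · rw [liftedField, norm_rotated hA]
    linarith
  · rw [liftedField, norm_neg, Real.norm_eq_abs]
    linarith [hβM w.1]

/-- The position with the reduced state `z` relative to a bump of sign `σ` with center `c`, if the
velocity has the direction `δ`. -/
noncomputable def place (A c : Plane) (σ : ℝ) (z : ℂ) (δ : ℝ) : Plane :=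
  c + (z.re • rotated A δ - (σ * z.im) • rotated A (δ + π / 2))

lemma norm_place_sub {A : Plane} (hA : ‖A‖ = 1) (c : Plane) {σ : ℝ} (hσ : σ * σ = 1) (z : ℂ)
    (δ : ℝ) : ‖place A c σ z δ - c‖ = ‖z‖ := by
  refine (pow_left_inj₀ (norm_nonneg _) (norm_nonneg _) two_ne_zero).1 ?_
  rw [place, add_sub_cancel_left, norm_sq_frame hA, Complex.sq_norm, Complex.normSq_apply]
  linear_combination z.im ^ 2 * hσ

/-- Solutions of the reduced equation yield trajectories. -/
lemma hasDerivAt_place {A : Plane} (hA : ‖A‖ = 1) (c : Plane) {σ : ℝ} (hσ : σ * σ = 1)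
    {g : ℝ → ℝ} {z : ℝ → ℂ} {Δ : ℝ → ℝ} (hs : ReducedSolution g z Δ) (δ₀ : ℝ) {β : Plane → ℝ}
    {t : ℝ} (hβ : ∀ q, ‖q - c‖ = ‖z t‖ → β q = σ * g ‖z t‖) :
    HasDerivAt (fun t => (place A c σ (z t) (δ₀ + σ * Δ t), δ₀ + σ * Δ t))
      (liftedField A β (place A c σ (z t) (δ₀ + σ * Δ t), δ₀ + σ * Δ t)) t := by
  have hδ : HasDerivAt (fun t => δ₀ + σ * Δ t) (σ * -g ‖z t‖) t :=
    ((hs.hasDerivAt_angle t).const_mul σ).const_add δ₀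
  have he := (hasDerivAt_rotated A (δ₀ + σ * Δ t)).scomp t hδ
  have hn := (hasDerivAt_rotated A (δ₀ + σ * Δ t + π / 2)).scomp t (hδ.add_const (π / 2))
  refine HasDerivAt.prodMk ?_ ?_
  · refine ((((hs.hasDerivAt_re t).smul he).sub
      (((hs.hasDerivAt_im t).const_mul σ).smul hn)).const_add c).congr_deriv ?_
    have h1 : rotated A (δ₀ + σ * Δ t + π / 2 + π / 2) = -rotated A (δ₀ + σ * Δ t) := by
      rw [← rotated_add_pi]
      congr 1
      ring
    simp only [Function.comp_apply, h1]
    have h2 : ∀ (e' n' : Plane) (G u m : ℝ), u • (σ * -G) • n' + (1 + G * m) • e'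
        - ((σ * m) • (σ * -G) • (-e') + (σ * -(G * u)) • n')
        = (1 + G * m - (σ * σ) * (m * G)) • e' := by
      intro e' n' G u m
      module
    rw [h2, hσ]
    have h3 : (1 + g ‖z t‖ * (z t).im - 1 * ((z t).im * g ‖z t‖)) = 1 := by ring
    rw [h3, one_smul]
  · refine hδ.congr_deriv ?_
    rw [hβ _ (norm_place_sub hA c hσ _ _)]
    ring

lemma hasDerivAt_line {A : Plane} (p : Plane) (δ : ℝ) {β : Plane → ℝ} {t : ℝ}
    (hβ : β (p + t • rotated A δ) = 0) :
    HasDerivAt (fun t : ℝ => (p + t • rotated A δ, δ))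
      (liftedField A β (p + t • rotated A δ, δ)) t := by
  refine HasDerivAt.prodMk ?_ ?_
  · refine (((hasDerivAt_id' t).smul_const (rotated A δ)).const_add p).congr_deriv ?_
    rw [one_smul]
  · refine (hasDerivAt_const t δ).congr_deriv ?_
    simp only [hβ, neg_zero]

/-- The state in which a particle with normalised angular momentum `m` and direction `δ` enters
the disc of a bump. -/
noncomputable def entryPoint (A : Plane) (b : Bump) (E m δ : ℝ) : Plane × ℝ :=
  (place A b.center (b.sign E) (entryState b.radius m) δ, δ)

lemma entryPoint_mem_disc {A : Plane} (hA : ‖A‖ = 1) (b : Bump) {E m : ℝ} (hm : |m| ≤ b.radius)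
    (δ : ℝ) : (entryPoint A b E m δ).1 ∈ b.disc := by
  rw [Bump.disc, mem_closedBall, dist_eq_norm, entryPoint,
    norm_place_sub hA _ (b.sign_mul_self E), norm_entryState hm]

lemma place_exitState_eq {A : Plane} (b : Bump) {E m δ α : ℝ} (hcos : 0 ≤ Real.cos α)
    (hα : b.radius * Real.sin α = b.sign E * m) :
    place A b.center (b.sign E) (exitState b.radius m) δ
      = b.center + b.radius • rotated A (δ - α) ∧
    place A b.center (b.sign E) (entryState b.radius m) δ
      = b.center - b.radius • rotated A (δ + α) := by
  have h1 : √(b.radius ^ 2 - m ^ 2) = b.radius * Real.cos α := by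
    have : b.radius ^ 2 - m ^ 2 = (b.radius * Real.cos α) ^ 2 := by
      have e1 := Real.sin_sq_add_cos_sq α
      have e2 : (b.radius * Real.sin α) ^ 2 = m ^ 2 := by
        rw [hα]
        linear_combination m ^ 2 * b.sign_mul_self E
      linear_combination -b.radius ^ 2 * e1 + e2
    rw [this, Real.sqrt_sq (mul_nonneg b.radius_pos.le hcos)]
  have h2 := rotated_add A δ (-α)
  rw [Real.cos_neg, Real.sin_neg, ← sub_eq_add_neg] at h2
  have h3 := rotated_add A δ α
  constructor
  · rw [place, exitState, h1, h2, ← hα]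
    module
  · rw [place, entryState, h1, h3, ← hα]
    module

variable {E : ℝ} {A : Plane} {K K' : ℝ≥0}

/-- A particle that enters the disc of the bump `k` so that the line on which it leaves meets the
bump `l` within the corridor runs to the disc of the bump `l`. -/
lemma exists_transition (hdisj : ∀ k l, k ≠ l → Disjoint (b k).disc (b l).disc) (hE : 0 < E)
    (hgp : InGeneralPosition b E) (hA : ‖A‖ = 1) {Kβ : ℝ≥0}
    (hβ : LipschitzWith Kβ fun q => totalField b q / √(2 * E)) {k l : Fin n} (hkl : k ≠ l)
    {Ω δ₀ δ₁ m m' T : ℝ}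
    {z : ℝ → ℂ} {Δ : ℝ → ℝ} (hax : (b k).axis (b l) = rotated A Ω)
    (hK : CriticalProfile ((b k).normalProfile E) (b k).radius ((b k).outerRadius E) K)
    (hK' : CriticalProfile ((b l).normalProfile E) (b l).radius ((b l).outerRadius E) K')
    (hm : m ∈ Icc (-(b k).radius)
      (criticalValue ((b k).normalProfile E) (b k).radius ((b k).outerRadius E)))
    (hm' : m' ∈ Icc (-(b l).radius)
      (criticalValue ((b l).normalProfile E) (b l).radius ((b l).outerRadius E)))
    (hs : ReducedSolution ((b k).normalProfile E) z Δ) (hz : z 0 = entryState (b k).radius m)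
    (hΔ : Δ 0 = 0) (hT : 0 ≤ T) (hle : ∀ t ∈ Icc 0 T, ‖z t‖ ≤ (b k).radius)
    (hzT : z T = exitState (b k).radius m) (hδ₁ : δ₁ = δ₀ + (b k).sign E * Δ T)
    (hlam : |δ₁ - Ω| ≤ π / 2)
    (hmm : (b l).sign E * m' = (b k).sign E * m
      - dist (b k).center (b l).center * Real.sin (δ₁ - Ω)) :
    ∃ τ ∈ Icc 0 (dist (b k).center (b l).center), ∀ γ : ℝ → Plane × ℝ,
      (∀ t, HasDerivAt γ (liftedField A (fun q => totalField b q / √(2 * E)) (γ t)) t) →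
      γ 0 = entryPoint A (b k) E m δ₀ →
      (∀ t ∈ Icc 0 T, (γ t).1 ∈ (b k).disc) ∧
      (∀ t ∈ Icc 0 τ, γ (T + t) = ((γ T).1 + t • rotated A δ₁, δ₁)) ∧
      γ (T + τ) = entryPoint A (b l) E m' δ₁ := by
  have hv : 0 < √(2 * E) := Real.sqrt_pos.2 (by positivity)
  have hd : (b k).radius + (b l).radius < dist (b k).center (b l).center := by
    have := hdisj k l hkl
    rwa [Bump.disc, Bump.disc, disjoint_closedBall_closedBall_iff (b k).radius_pos.le
      (b l).radius_pos.le] at this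
  obtain ⟨hα, hαm⟩ := (b k).angle_mem hE hK hm.1 hm.2
  obtain ⟨hα', hαm'⟩ := (b l).angle_mem hE hK' hm'.1 hm'.2
  set α := (b k).angle E m
  set α' := (b l).angle E m'
  have hcos : 0 ≤ Real.cos α := Real.cos_nonneg_of_mem_Icc
    ⟨((b k).neg_pi_div_two_le_lowAngle E).trans hα.1, hα.2.trans ((b k).highAngle_le_pi_div_two E)⟩
  have hcos' : 0 ≤ Real.cos α' := Real.cos_nonneg_of_mem_Icc
    ⟨((b l).neg_pi_div_two_le_lowAngle E).trans hα'.1,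
      hα'.2.trans ((b l).highAngle_le_pi_div_two E)⟩
  have hsin : dist (b k).center (b l).center * Real.sin (δ₁ - Ω)
      = (b k).radius * Real.sin α - (b l).radius * Real.sin α' := by
    rw [hαm, hαm']; linarith
  obtain ⟨hexit, hentry, hdiff⟩ := Bump.corridor_points hd hax hα hα' hlam hsin
  set τ := Bump.gapLength (b k) (b l) α α' (δ₁ - Ω)
  have hτ : 0 ≤ τ := Bump.gapLength_nonneg hd hlam hsin
  have hpl := (place_exitState_eq (A := A) (b k) (δ := δ₁) hcos hαm).1
  have hpl' := (place_exitState_eq (A := A) (b l) (δ := δ₁) hcos' hαm').2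
  rw [← hpl] at hexit hdiff
  rw [← hpl'] at hentry hdiff
  set P := place A (b k).center ((b k).sign E) (exitState (b k).radius m) δ₁ with hP
  set Q := place A (b l).center ((b l).sign E) (entryState (b l).radius m') δ₁ with hQ
  have hQP : Q = P + τ • rotated A δ₁ := by rw [← hdiff]; abel
  have hlip := lipschitz_liftedField hA hβ
  -- On the segment between the discs there is no field.
  have hfree : ∀ t ∈ Icc 0 τ, totalField b (P + t • rotated A δ₁) = 0 := by
    intro t ht
    refine Finset.sum_eq_zero fun j _ => ?_
    by_cases hjk : j = k
    · subst hjk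
      refine (b j).field_eq_zero ?_
      refine (pow_le_pow_iff_left₀ (b j).radius_pos.le (norm_nonneg _) two_ne_zero).1 ?_
      have h1 : P + t • rotated A δ₁ - (b j).center
          = (√((b j).radius ^ 2 - m ^ 2) + t) • rotated A δ₁
            - ((b j).sign E * m) • rotated A (δ₁ + π / 2) := by
        rw [hP, place, exitState]
        module
      rw [h1, norm_sq_frame hA]
      have h2 : 0 ≤ (b j).radius ^ 2 - m ^ 2 := by
        have := sq_le_sq' (abs_le.1 (hK.abs_momentum_le hm.1 hm.2)).1
          (abs_le.1 (hK.abs_momentum_le hm.1 hm.2)).2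
        linarith
      have h3 := Real.sq_sqrt h2
      have h4 := Real.sqrt_nonneg ((b j).radius ^ 2 - m ^ 2)
      have h5 : ((b j).sign E * m) ^ 2 = m ^ 2 := by
        linear_combination m ^ 2 * (b j).sign_mul_self E
      rw [h5]
      nlinarith [ht.1, mul_nonneg h4 ht.1, sq_nonneg t]
    by_cases hjl : j = l
    · subst hjl
      refine (b j).field_eq_zero ?_
      refine (pow_le_pow_iff_left₀ (b j).radius_pos.le (norm_nonneg _) two_ne_zero).1 ?_
      have h1 : P + t • rotated A δ₁ - (b j).center
          = (-√((b j).radius ^ 2 - m' ^ 2) - (τ - t)) • rotated A δ₁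
            - ((b j).sign E * m') • rotated A (δ₁ + π / 2) := by
        have : P = Q - τ • rotated A δ₁ := by rw [hQP]; abel
        rw [this, hQ, place, entryState]
        module
      rw [h1, norm_sq_frame hA]
      have h2 : 0 ≤ (b j).radius ^ 2 - m' ^ 2 := by
        have := sq_le_sq' (abs_le.1 (hK'.abs_momentum_le hm'.1 hm'.2)).1
          (abs_le.1 (hK'.abs_momentum_le hm'.1 hm'.2)).2
        linarith
      have h3 := Real.sq_sqrt h2
      have h4 := Real.sqrt_nonneg ((b j).radius ^ 2 - m' ^ 2)
      have h5 : ((b j).sign E * m') ^ 2 = m' ^ 2 := by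
        linear_combination m' ^ 2 * (b j).sign_mul_self E
      have h6 : 0 ≤ τ - t := sub_nonneg.2 ht.2
      rw [h5]
      nlinarith [mul_nonneg h4 h6, sq_nonneg (τ - t)]
    have hseg : (P + t • rotated A δ₁ : Plane) ∈ convexHull ℝ
        ((b k).exitArc (b l) E ∪ (b l).entryArc (b k) E) := by
      have hsub : segment ℝ P Q ⊆ convexHull ℝ ((b k).exitArc (b l) E ∪ (b l).entryArc (b k) E) :=
        (convex_convexHull ℝ _).segment_subset (subset_convexHull ℝ _ (Or.inl hexit))
          (subset_convexHull ℝ _ (Or.inr hentry))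
      refine hsub ?_
      rw [segment_eq_image']
      rcases hτ.eq_or_lt with h0 | h0
      · refine ⟨0, ⟨le_rfl, zero_le_one⟩, ?_⟩
        have : t = 0 := le_antisymm (ht.2.trans h0.symm.le) ht.1
        simp [this]
      · refine ⟨t / τ, ⟨by have := ht.1; positivity, (div_le_one h0).2 ht.2⟩, ?_⟩
        simp only
        rw [hdiff, smul_smul, div_mul_cancel₀ _ h0.ne']
    refine image_eq_zero_of_notMem_tsupport fun hts => ?_
    have := hgp.corridor k l j hkl (Ne.symm hjk) (Ne.symm hjl)
    exact (Set.eq_empty_iff_forall_notMem.1 this) _ ⟨hseg, hts⟩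
  refine ⟨τ, ⟨hτ, Bump.gapLength_le hcos hcos'⟩, fun γ hγ hγ0 => ?_⟩
  have hσ := (b k).sign_mul_self E
  have hmodel : EqOn γ (fun t => (place A (b k).center ((b k).sign E) (z t)
      (δ₀ + (b k).sign E * Δ t), δ₀ + (b k).sign E * Δ t)) (Icc 0 T) := by
    refine eqOn_Icc_of_hasDerivAt hlip hγ (fun t ht => ?_) ?_
    · refine hasDerivAt_place hA _ hσ hs δ₀ fun q hq => ?_
      have hmem : q ∈ (b k).disc := by
        rw [Bump.disc, mem_closedBall, dist_eq_norm, hq]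
        exact hle t ht
      rw [totalField_eq_of_mem_disc hdisj hmem, Bump.field, Bump.normalProfile, abs_norm, hq,
        ← mul_div_assoc, ← mul_assoc, hσ, one_mul]
    · rw [hγ0, hz, hΔ, entryPoint, mul_zero, add_zero]
  have hγT : γ T = (P, δ₁) := by
    rw [hmodel ⟨hT, le_rfl⟩]
    simp only
    rw [hzT, ← hδ₁]
  have hline : ∀ t ∈ Icc 0 τ, γ (T + t) = (P + t • rotated A δ₁, δ₁) := by
    refine eqOn_Icc_of_hasDerivAt hlip (γ := fun t => γ (T + t)) (fun t => ?_) (fun t ht => ?_) ?_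
    · exact (hγ (T + t)).comp_const_add T t
    · exact hasDerivAt_line P δ₁ (by rw [hfree t ht, zero_div])
    · simp [hγT]
  refine ⟨fun t ht => ?_, fun t ht => ?_, ?_⟩
  · rw [hmodel ht, Bump.disc, mem_closedBall, dist_eq_norm, norm_place_sub hA _ hσ]
    exact hle t ht
  · rw [hline t ht, hγT]
  · rw [hline τ ⟨hτ, le_rfl⟩, ← hQP, entryPoint]

end MagneticBumps

/-! ### Stretching along paths of lines -/

section Stretching

/-- A path of lines that meet a bump with all angular momenta between `x` and `y` contains, after
the visit to this bump, a subpath of lines that meet the next bump with all angular momenta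
between `x'` and `y'`. The odd number `w` selects how often the velocity turns around during the
visit: the path of outgoing lines rotates by more than two full turns, so that it sweeps over the
next bump for both `w = 1` and `w = 3`. -/
lemma exists_stretched_subpath {S δ m δ' m' : ℝ → ℝ} {σ σ' x y x' y' R R' d w Ω a b : ℝ}
    (hσ : σ * σ = 1) (hσ' : σ' * σ' = 1) (hS : ContinuousOn S (uIcc x y)) (hSx : S x = 0)
    (hSy : S y = -(4 * π)) (hx : |x| ≤ R) (hy : |y| ≤ R) (hx' : |x'| ≤ R') (hy' : |y'| ≤ R')
    (hd : R + R' < d) (hw : w ∈ Icc 1 3) (hδ : ContinuousOn δ (uIcc a b))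
    (hm : ContinuousOn m (uIcc a b)) (hma : m a = x) (hmb : m b = y)
    (hmem : ∀ s ∈ uIcc a b, m s ∈ uIcc x y) (hΩ : ∀ s ∈ uIcc a b, |δ s - Ω| < π / 2)
    (hδ' : ∀ s, δ' s = δ s + σ * S (m s))
    (hm' : ∀ s, m' s = σ' * (σ * m s - d * Real.sin (δ' s - (Ω - σ * w * π)))) :
    ∃ a' ∈ uIcc a b, ∃ b' ∈ uIcc a b, m' a' = x' ∧ m' b' = y' ∧
      ContinuousOn δ' (uIcc a' b') ∧ ContinuousOn m' (uIcc a' b') ∧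
      ∀ s ∈ uIcc a' b', m' s ∈ uIcc x' y' ∧ |δ' s - (Ω - σ * w * π)| < π / 2 := by
  have hπ := Real.pi_pos
  have hcδ' : ContinuousOn δ' (uIcc a b) := by
    have : δ' = fun s => δ s + σ * S (m s) := funext hδ'
    rw [this]
    exact hδ.add (continuousOn_const.mul (hS.comp hm hmem))
  have hcm' : ContinuousOn m' (uIcc a b) := by
    have : m' = fun s => σ' * (σ * m s - d * Real.sin (δ' s - (Ω - σ * w * π))) := funext hm'
    rw [this]
    exact continuousOn_const.mul ((continuousOn_const.mul hm).sub
      (continuousOn_const.mul (Real.continuous_sin.comp_continuousOn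
        (hcδ'.sub continuousOn_const))))
  have hσabs : |σ| = 1 := by
    rw [← pow_left_inj₀ (abs_nonneg σ) zero_le_one two_ne_zero, sq_abs]; linarith
  have hσabs' : |σ'| = 1 := by
    rw [← pow_left_inj₀ (abs_nonneg σ') zero_le_one two_ne_zero, sq_abs]; linarith
  have habs : ∀ r : ℝ, |σ * r| = |r| := fun r => by rw [abs_mul, hσabs, one_mul]
  have hmR : ∀ s ∈ uIcc a b, |m s| ≤ R := fun s hs => by
    have := uIcc_subset_Icc (abs_le.1 hx) (abs_le.1 hy) (hmem s hs)
    exact abs_le.2 this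
  -- The direction of the outgoing line relative to the axis, normalised to be decreasing overall.
  set φ : ℝ → ℝ := fun s => σ * (δ' s - (Ω - σ * w * π)) with hφ
  have hcφ : ContinuousOn φ (uIcc a b) :=
    continuousOn_const.mul (hcδ'.sub continuousOn_const)
  have hφeq : ∀ s, φ s = σ * (δ s - Ω) + S (m s) + w * π := fun s => by
    simp only [hφ, hδ']
    linear_combination (S (m s) + w * π) * hσ
  have hbd : ∀ s ∈ uIcc a b, |σ * (δ s - Ω)| ≤ π / 2 := fun s hs => by
    rw [habs]; exact (hΩ s hs).le
  have hφa : π / 2 ≤ φ a := by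
    rw [hφeq, hma, hSx]
    have := (abs_le.1 (hbd a left_mem_uIcc)).1
    nlinarith [hw.1]
  have hφb : φ b ≤ -(π / 2) := by
    rw [hφeq, hmb, hSy]
    have := (abs_le.1 (hbd b right_mem_uIcc)).2
    nlinarith [hw.2]
  have hφab : φ b ≤ φ a := by linarith
  obtain ⟨a₁, ha₁, b₁, hb₁, hφa₁, hφb₁, hφ₁⟩ := exists_crossing (x := π / 2) (y := -(π / 2)) hcφ
    (by rw [uIcc_of_ge hφab]; exact ⟨by linarith, hφa⟩)
    (by rw [uIcc_of_ge hφab]; exact ⟨hφb, by linarith⟩)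
  have hsub₁ : uIcc a₁ b₁ ⊆ uIcc a b := uIcc_subset_uIcc ha₁ hb₁
  have hm'φ : ∀ s, m' s = σ' * σ * (m s - d * Real.sin (φ s)) := fun s => by
    rw [hm' s]
    have : Real.sin (δ' s - (Ω - σ * w * π)) = σ * Real.sin (φ s) := by
      have h1 : δ' s - (Ω - σ * w * π) = σ * φ s := by
        simp only [hφ]
        linear_combination -(δ' s - (Ω - σ * w * π)) * hσ
      rw [h1]
      rcases mul_self_eq_one_iff.1 hσ with h | h <;> rw [h] <;> simp
    rw [this]
    ring
  have hR' : 0 ≤ R' := (abs_nonneg x').trans hx'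
  have hσσ : |σ' * σ| = 1 := by rw [abs_mul, hσabs, hσabs', one_mul]
  have hlo : m a₁ - d * Real.sin (φ a₁) ≤ -R' := by
    rw [hφa₁, Real.sin_pi_div_two]
    linarith [(abs_le.1 (hmR a₁ ha₁)).2]
  have hhi : R' ≤ m b₁ - d * Real.sin (φ b₁) := by
    rw [hφb₁, Real.sin_neg, Real.sin_pi_div_two]
    linarith [(abs_le.1 (hmR b₁ hb₁)).1]
  have hcover : ∀ r, |r| ≤ R' → r ∈ uIcc (m' a₁) (m' b₁) := by
    intro r hr
    have hr' := abs_le.1 hr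
    rw [hm'φ a₁, hm'φ b₁, mem_uIcc]
    rcases abs_eq zero_le_one |>.1 hσσ with h | h <;> rw [h]
    · left; constructor <;> linarith
    · right; constructor <;> linarith
  obtain ⟨a', ha', b', hb', hma', hmb', hm₂⟩ := exists_crossing (hcm'.mono hsub₁)
    (hcover x' hx') (hcover y' hy')
  have hsub₂ : uIcc a' b' ⊆ uIcc a₁ b₁ := uIcc_subset_uIcc ha' hb'
  refine ⟨a', hsub₁ ha', b', hsub₁ hb', hma', hmb', hcδ'.mono (hsub₂.trans hsub₁),
    hcm'.mono (hsub₂.trans hsub₁), fun s hs => ⟨hm₂ s hs, ?_⟩⟩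
  have h1 : |φ s| ≤ π / 2 := by
    have := hφ₁ s (hsub₂ hs)
    rw [uIcc_of_ge (by linarith)] at this
    exact abs_le.2 this
  have h2 : |m' s| ≤ R' :=
    abs_le.2 (uIcc_subset_Icc (abs_le.1 hx') (abs_le.1 hy') (hm₂ s hs))
  rw [← habs]
  change |φ s| < π / 2
  refine lt_of_le_of_ne h1 fun h => ?_
  -- In the extreme directions the line misses the next disc.
  have h3 : |Real.sin (φ s)| = 1 := by
    rcases abs_eq (by linarith) |>.1 h with h | h <;> rw [h] <;> simp
  rw [hm'φ s, abs_mul, hσσ, one_mul] at h2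
  have h4 : |d * Real.sin (φ s)| = d := by
    rw [abs_mul, h3, mul_one, abs_of_nonneg]
    linarith [(abs_nonneg x).trans hx]
  have h5 := abs_sub_abs_le_abs_sub (d * Real.sin (φ s)) (m s)
  rw [abs_sub_comm] at h5
  linarith [hmR s (hsub₁ (hsub₂ hs))]

/-- The direction, with the number of turns taken into account, of the axis along which the `j`-th
disc on the way is approached, if the velocity turns by about `-σ i * w i * π` at the `i`-th. -/
noncomputable def axisAngle (σ w : ℕ → ℝ) (j : ℕ) : ℝ := π - ∑ i ∈ Finset.range j, σ i * w i * π

lemma axisAngle_succ (σ w : ℕ → ℝ) (j : ℕ) :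
    axisAngle σ w (j + 1) = axisAngle σ w j - σ j * w j * π := by
  rw [axisAngle, axisAngle, Finset.sum_range_succ]; ring

/-- Every finite sequence `w` of turning numbers is realised by a sequence of lines: the `j`-th
line has the direction `δ j` and the normalised angular momentum `m j` with respect to the `j`-th
bump. -/
lemma exists_itinerary {σ x y R d w : ℕ → ℝ} {S : ℕ → ℝ → ℝ} (hσ : ∀ j, σ j * σ j = 1)
    (hS : ∀ j, ContinuousOn (S j) (uIcc (x j) (y j))) (hSx : ∀ j, S j (x j) = 0)
    (hSy : ∀ j, S j (y j) = -(4 * π)) (hx : ∀ j, |x j| ≤ R j) (hy : ∀ j, |y j| ≤ R j)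
    (hd : ∀ j, R j + R (j + 1) < d j) (hw : ∀ j, w j ∈ Icc (1 : ℝ) 3) (N : ℕ) :
    ∃ δ m : ℕ → ℝ, δ 0 = π ∧ (∀ j ≤ N, m j ∈ uIcc (x j) (y j)) ∧
      (∀ j ≤ N, |δ j - axisAngle σ w j| < π / 2) ∧
      ∀ j < N, δ (j + 1) = δ j + σ j * S j (m j) ∧
        σ (j + 1) * m (j + 1) = σ j * m j - d j * Real.sin (δ (j + 1) - axisAngle σ w (j + 1)) := by
  have hπ := Real.pi_pos
  suffices h : ∃ (a b : ℝ) (δN mN : ℝ → ℝ), ContinuousOn δN (uIcc a b) ∧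
      ContinuousOn mN (uIcc a b) ∧ mN a = x N ∧ mN b = y N ∧
      ∀ s ∈ uIcc a b, ∃ δ m : ℕ → ℝ, δ N = δN s ∧ m N = mN s ∧
        δ 0 = π ∧ (∀ j ≤ N, m j ∈ uIcc (x j) (y j)) ∧
        (∀ j ≤ N, |δ j - axisAngle σ w j| < π / 2) ∧
        ∀ j < N, δ (j + 1) = δ j + σ j * S j (m j) ∧ σ (j + 1) * m (j + 1)
          = σ j * m j - d j * Real.sin (δ (j + 1) - axisAngle σ w (j + 1)) by
    obtain ⟨a, b, δN, mN, -, -, -, -, h⟩ := h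
    obtain ⟨δ, m, -, -, h'⟩ := h a left_mem_uIcc
    exact ⟨δ, m, h'⟩
  induction N with
  | zero =>
    refine ⟨x 0, y 0, fun _ => π, fun s => s, continuousOn_const, continuousOn_id, rfl, rfl,
      fun s hs => ⟨fun _ => π, fun _ => s, rfl, rfl, rfl, fun j hj => ?_, fun j hj => ?_,
        fun j hj => absurd hj (Nat.not_lt_zero j)⟩⟩
    · rw [Nat.le_zero.1 hj]; exact hs
    · rw [Nat.le_zero.1 hj]
      simp [axisAngle, hπ]
  | succ N ih =>
    obtain ⟨a, b, δN, mN, hδ, hm, hma, hmb, hseq⟩ := ih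
    have hmem : ∀ s ∈ uIcc a b, mN s ∈ uIcc (x N) (y N) := fun s hs => by
      obtain ⟨δ, m, -, h2, -, h4, -, -⟩ := hseq s hs
      exact h2 ▸ h4 N le_rfl
    have hΩ : ∀ s ∈ uIcc a b, |δN s - axisAngle σ w N| < π / 2 := fun s hs => by
      obtain ⟨δ, m, h1, -, -, -, h5, -⟩ := hseq s hs
      exact h1 ▸ h5 N le_rfl
    set δ' : ℝ → ℝ := fun s => δN s + σ N * S N (mN s) with hδ'
    set m' : ℝ → ℝ := fun s => σ (N + 1) * (σ N * mN s - d N * Real.sin (δ' s -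
      (axisAngle σ w N - σ N * w N * π))) with hm'
    obtain ⟨a', ha', b', hb', hma', hmb', hcδ', hcm', h'⟩ := exists_stretched_subpath (hσ N)
      (hσ (N + 1)) (hS N) (hSx N) (hSy N) (hx N) (hy N) (hx (N + 1)) (hy (N + 1)) (hd N) (hw N)
      hδ hm hma hmb hmem hΩ (fun s => rfl : ∀ s, δ' s = _) (fun s => rfl : ∀ s, m' s = _)
    refine ⟨a', b', δ', m', hcδ', hcm', hma', hmb', fun s hs => ?_⟩
    have hs' : s ∈ uIcc a b := uIcc_subset_uIcc ha' hb' hs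
    obtain ⟨δ, m, h1, h2, h3, h4, h5, h6⟩ := hseq s hs'
    have hN : ∀ f : ℕ → ℝ, ∀ v, ∀ j ≤ N, Function.update f (N + 1) v j = f j := fun f v j hj =>
      Function.update_of_ne (by omega) _ _
    refine ⟨Function.update δ (N + 1) (δ' s), Function.update m (N + 1) (m' s),
      Function.update_self _ _ _, Function.update_self _ _ _, ?_, fun j hj => ?_, fun j hj => ?_,
      fun j hj => ?_⟩
    · rw [hN _ _ 0 (Nat.zero_le N), h3]
    · rcases Nat.le_succ_iff.1 hj with h | h
      · rw [hN _ _ j h]; exact h4 j h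
      · rw [h, Function.update_self]; exact (h' s hs).1
    · rcases Nat.le_succ_iff.1 hj with h | h
      · rw [hN _ _ j h]; exact h5 j h
      · rw [h, Function.update_self, axisAngle_succ]; exact (h' s hs).2
    · rcases Nat.lt_succ_iff_lt_or_eq.1 hj with h | h
      · rw [hN _ _ j h.le, hN _ _ j h.le, hN _ _ (j + 1) h, hN _ _ (j + 1) h]
        exact h6 j h
      · subst h
        rw [hN _ _ j le_rfl, hN _ _ j le_rfl, Function.update_self, Function.update_self, h1, h2,
          axisAngle_succ]
        refine ⟨rfl, ?_⟩
        simp only [hm']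
        rw [← mul_assoc, hσ (j + 1), one_mul]

end Stretching

/-! ### Distinguishing itineraries -/

section Separation

/-- The chronology of a motion that commutes `N` times between two regions: `h` is at most `-η` in
the first region and at least `η` in the second one, the time `u j` is the beginning and `c j` the
end of the `j`-th visit, and in between `h` is monotone and the direction has the constant value
`D (j + 1)`. -/
structure Commutes (N : ℕ) (η : ℝ) (h δ : ℝ → ℝ) (u c D : ℕ → ℝ) : Prop where
  start : u 0 = 0
  le_leave : ∀ j < N, u j ≤ c j
  leave_le : ∀ j < N, c j ≤ u (j + 1)
  visit : ∀ j < N, ∀ t ∈ Icc (u j) (c j), (-1) ^ j * h t ≤ -η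
  arrive : ∀ j < N, η ≤ (-1) ^ j * h (u (j + 1))
  mono : ∀ j < N, MonotoneOn (fun t => (-1) ^ j * h t) (Icc (c j) (u (j + 1)))
  direction : ∀ j < N, ∀ t ∈ Icc (c j) (u (j + 1)), δ t = D (j + 1)

variable {N : ℕ} {η ε : ℝ} {h δ h' δ' : ℝ → ℝ} {u c D u' c' D' : ℕ → ℝ}

namespace Commutes

lemma le_succ (hc : Commutes N η h δ u c D) {j : ℕ} (hj : j < N) : u j ≤ u (j + 1) :=
  (hc.le_leave j hj).trans (hc.leave_le j hj)

lemma nonneg (hc : Commutes N η h δ u c D) {j : ℕ} (hj : j ≤ N) : 0 ≤ u j := by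
  induction j with
  | zero => exact hc.start.ge
  | succ j ih => exact (ih (by omega)).trans (hc.le_succ (by omega))

lemma le_last (hc : Commutes N η h δ u c D) {j : ℕ} (hj : j ≤ N) : u j ≤ u N := by
  induction hj using Nat.decreasingInduction with
  | self => exact le_rfl
  | of_succ k hk ih => exact (hc.le_succ hk).trans ih

/-- If the first motion arrives at a region while the second one is still underway to it, then
the second one has already left the other region. -/
lemma leave_le_arrive (hc : Commutes N η h δ u c D) (hc' : Commutes N η h' δ' u' c' D')
    {i : ℕ} (hi : i < N) (hε : ε < η) (hclose : |h (u (i + 1)) - h' (u (i + 1))| ≤ ε)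
    (h1 : u' i ≤ u (i + 1)) :
    c' i ≤ u (i + 1) ∧ 0 < (-1) ^ i * h' (u (i + 1)) := by
  have hpos : 0 < (-1) ^ i * h' (u (i + 1)) := by
    have h2 := hc.arrive i hi
    have h3 : |(-1) ^ i * h (u (i + 1)) - (-1) ^ i * h' (u (i + 1))| ≤ ε := by
      rw [← mul_sub, abs_mul, abs_pow, abs_neg, abs_one, one_pow, one_mul]
      exact hclose
    linarith [(abs_le.1 h3).2]
  refine ⟨?_, hpos⟩
  by_contra hlt
  have := hc'.visit i hi _ ⟨h1, (not_le.1 hlt).le⟩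
  linarith [abs_nonneg (h (u (i + 1)) - h' (u (i + 1)))]

/-- Two motions that stay close to each other visit the regions alternately in step. -/
lemma interlace (hc : Commutes N η h δ u c D) (hc' : Commutes N η h' δ' u' c' D') (hε : ε < η)
    {Tmax : ℝ} (hu : u N ≤ Tmax) (hu' : u' N ≤ Tmax)
    (hclose : ∀ t ∈ Icc 0 Tmax, |h t - h' t| ≤ ε) {i : ℕ} (hi : i < N) :
    u' i ≤ u (i + 1) ∧ u i ≤ u' (i + 1) := by
  induction i with
  | zero =>
    rw [hc.start, hc'.start]
    exact ⟨hc.nonneg hi, hc'.nonneg hi⟩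
  | succ i ih =>
    have hi' : i < N := by omega
    obtain ⟨ih1, ih2⟩ := ih hi'
    -- Otherwise the first motion would be back before the second one has arrived.
    have key : ∀ {h δ h' δ' : ℝ → ℝ} {u c D u' c' D' : ℕ → ℝ}, Commutes N η h δ u c D →
        Commutes N η h' δ' u' c' D' → u N ≤ Tmax → (∀ t ∈ Icc 0 Tmax, |h t - h' t| ≤ ε) →
        u' i ≤ u (i + 1) → u' (i + 1) ≤ u (i + 1 + 1) := by
      intro h δ h' δ' u c D u' c' D' hc hc' hu hclose h1
      by_contra hlt
      rw [not_le] at hlt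
      have hmem : ∀ j ≤ N, u j ∈ Icc 0 Tmax := fun j hj =>
        ⟨hc.nonneg hj, (hc.le_last hj).trans hu⟩
      have hstep := hc.le_succ hi
      obtain ⟨h2, h3⟩ := hc.leave_le_arrive hc' hi' hε (hclose _ (hmem _ hi.le)) h1
      have h4 := hc'.mono i hi' ⟨h2, hstep.trans hlt.le⟩ ⟨h2.trans hstep, hlt.le⟩ hstep
      have h5 := hc.arrive (i + 1) hi
      have h6 : |(-1) ^ i * h (u (i + 1 + 1)) - (-1) ^ i * h' (u (i + 1 + 1))| ≤ ε := by
        rw [← mul_sub, abs_mul, abs_pow, abs_neg, abs_one, one_pow, one_mul]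
        exact hclose _ (hmem _ hi)
      rw [pow_succ] at h5
      simp only at h4
      linarith [(abs_le.1 h6).1, abs_nonneg (h (u (i + 1 + 1)) - h' (u (i + 1 + 1)))]
    refine ⟨key hc hc' hu hclose ih1, key hc' hc hu' (fun t ht => ?_) ih2⟩
    rw [abs_sub_comm]
    exact hclose t ht

/-- Two motions that stay close to each other travel in the same directions. -/
lemma abs_direction_sub_lt (hc : Commutes N η h δ u c D) (hc' : Commutes N η h' δ' u' c' D')
    (hε : ε < η) {Tmax : ℝ} (hu : u N ≤ Tmax) (hu' : u' N ≤ Tmax)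
    (hclose : ∀ t ∈ Icc 0 Tmax, |h t - h' t| ≤ ε) {κ : ℝ}
    (hδ : ∀ t ∈ Icc 0 Tmax, |δ t - δ' t| < κ) {i : ℕ} (hi : i < N) :
    |D (i + 1) - D' (i + 1)| < κ := by
  wlog hle : u (i + 1) ≤ u' (i + 1) generalizing h δ h' δ' u c D u' c' D'
  · rw [abs_sub_comm]
    refine this hc' hc hu' hu (fun t ht => ?_) (fun t ht => ?_) (not_le.1 hle).le <;>
      rw [abs_sub_comm]
    · exact hclose t ht
    · exact hδ t ht
  have hmem : u (i + 1) ∈ Icc 0 Tmax := ⟨hc.nonneg hi, (hc.le_last hi).trans hu⟩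
  have h1 := (hc.interlace hc' hε hu hu' hclose hi).1
  have h2 := (hc.leave_le_arrive hc' hi hε (hclose _ hmem) h1).1
  rw [← hc.direction i hi _ ⟨hc.leave_le i hi, le_rfl⟩, ← hc'.direction i hi _ ⟨h2, hle⟩]
  exact hδ _ hmem

end Commutes

end Separation

/-! ### Entropy from separated itineraries -/

/-- If the words of length `N` over two letters can be coded by points of a compact set whose
orbits are `ε`-separated before the time `N * P`, then the entropy is positive. -/
lemma le_bowenEntropy_of_separated {X : Type*} [PseudoMetricSpace X] {T : X → X} {F Q : Set X}
    (hQ : IsCompact Q) (hQF : Q ⊆ F) {ε P : ℝ} (hε : 0 < ε) (hP : 0 < P)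
    (h : ∀ N : ℕ, ∃ f : (Fin N → Bool) → X, (∀ w, f w ∈ Q) ∧ ∀ w w', w ≠ w' →
      ∃ k : ℕ, (k : ℝ) ≤ N * P ∧ ε ≤ dist (T^[k] (f w)) (T^[k] (f w'))) :
    ((Real.log 2 / (2 * P) : ℝ) : EReal) ≤ MagneticBumps.bowenEntropy T F := by
  classical
  set U : Set (X × X) := {p | dist p.1 p.2 < ε / 2} with hU
  have hUu : U ∈ uniformity X := dist_mem_uniformity (half_pos hε)
  refine le_trans ?_ (le_iSup₂_of_le Q hQ (le_iSup_of_le hQF le_rfl))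
  refine le_trans ?_ (Dynamics.netEntropyEntourage_le_coverEntropy T Q hUu)
  refine Frequently.le_expGrowthSup ?_
  rw [Filter.frequently_atTop]
  intro n₀
  obtain ⟨N, hN⟩ := exists_nat_ge (max ((n₀ : ℝ) / P) (1 / P))
  have hN1 : (n₀ : ℝ) ≤ N * P := (div_le_iff₀ hP).1 ((le_max_left _ _).trans hN)
  have hN2 : 1 ≤ N * P := (div_le_iff₀ hP).1 ((le_max_right _ _).trans hN)
  set n := ⌊N * P⌋₊ + 1 with hn
  have hNP : 0 ≤ N * P := zero_le_one.trans hN2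
  refine ⟨n, (Nat.le_floor hN1).trans (Nat.le_succ _), ?_⟩
  obtain ⟨f, hfQ, hf⟩ := h N
  have hinj : Function.Injective f := by
    intro w w' hww
    by_contra hne
    obtain ⟨k, -, hk⟩ := hf w w' hne
    rw [hww, dist_self] at hk
    exact hk.not_gt hε
  have hnet : Dynamics.IsDynNetIn T Q U n (Finset.univ.image f : Finset X) := by
    refine ⟨fun x hx => ?_, fun x hx y hy hxy => ?_⟩
    · rw [Finset.mem_coe, Finset.mem_image] at hx
      obtain ⟨w, -, rfl⟩ := hx
      exact hfQ w
    · rw [Finset.mem_coe, Finset.mem_image] at hx hy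
      obtain ⟨w, -, rfl⟩ := hx
      obtain ⟨w', -, rfl⟩ := hy
      rw [Function.onFun, Set.disjoint_left]
      intro p hp hp'
      obtain ⟨k, hk, hdist⟩ := hf w w' fun h => hxy (h ▸ rfl)
      have hkn : k < n := Nat.lt_succ_of_le (Nat.le_floor hk)
      have h1 : dist (T^[k] (f w)) (T^[k] p) < ε / 2 := Dynamics.mem_dynEntourage.1 hp k hkn
      have h2 : dist (T^[k] (f w')) (T^[k] p) < ε / 2 := Dynamics.mem_dynEntourage.1 hp' k hkn
      have := dist_triangle_right (T^[k] (f w)) (T^[k] (f w')) (T^[k] p)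
      linarith
  have hcard := hnet.card_le_netMaxcard
  rw [Finset.card_image_of_injective _ hinj, Finset.card_univ, Fintype.card_fun, Fintype.card_bool,
    Fintype.card_fin] at hcard
  have hexp : EReal.exp (((Real.log 2 / (2 * P) : ℝ) : EReal) * n)
      ≤ ((2 ^ N : ℕ) : ENNReal) := by
    have h1 : ((Real.log 2 / (2 * P) : ℝ) : EReal) * (n : EReal)
        = ((Real.log 2 / (2 * P) * n : ℝ) : EReal) := by
      rw [EReal.coe_mul]; rfl
    rw [h1, EReal.exp_coe]
    refine ENNReal.ofReal_le_of_le_toReal ?_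
    rw [ENNReal.toReal_natCast]
    have h2 : ((2 ^ N : ℕ) : ℝ) = Real.exp (N * Real.log 2) := by
      rw [mul_comm, Real.exp_mul, Real.exp_log two_pos]
      push_cast
      rw [Real.rpow_natCast]
    rw [h2, Real.exp_le_exp, div_mul_eq_mul_div, div_le_iff₀ (by positivity)]
    have h3 : (n : ℝ) ≤ 2 * (N * P) := by
      rw [hn]
      push_cast
      linarith [Nat.floor_le hNP]
    have := mul_le_mul_of_nonneg_left h3 (Real.log_nonneg one_le_two)
    linarith
  refine hexp.trans ?_
  have := ENat.toENNReal_mono hcard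
  simpa using this

/-! ### The magnetic flow on the energy surface -/

namespace MagneticBumps

lemma J_smul (a : ℝ) (p : Plane) : J (a • p) = a • J p := by
  apply plane_ext <;> simp [J]

lemma J_sub (p q : Plane) : J (p - q) = J p - J q := by
  apply plane_ext <;> simp [J]
  ring

lemma norm_J (p : Plane) : ‖J p‖ = ‖p‖ := by
  refine (pow_left_inj₀ (norm_nonneg _) (norm_nonneg _) two_ne_zero).1 ?_
  rw [norm_sq_plane, norm_sq_plane]
  simp [J]
  ring

lemma inner_J_self (p : Plane) : inner ℝ p (J p) = 0 := by
  simp [PiLp.inner_apply, Fin.sum_univ_two, J]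
  ring

variable {B : Plane → ℝ} {γ γ' : ℝ → Phase}

lemma IsTrajectory.shift (h : IsTrajectory B γ) (s : ℝ) : IsTrajectory B fun t => γ (s + t) :=
  fun t => (h (s + t)).comp_const_add s t

/-- Conservation of energy. -/
lemma IsTrajectory.norm_snd (h : IsTrajectory B γ) (t : ℝ) : ‖(γ t).2‖ = ‖(γ 0).2‖ := by
  have hd : ∀ t, HasDerivAt (fun t => ‖(γ t).2‖ ^ 2) 0 t := fun t => by
    have h1 : HasDerivAt (fun t => (γ t).2) (B (γ t).1 • J (γ t).2) t := (h t).snd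
    refine h1.norm_sq.congr_deriv ?_
    rw [inner_smul_right, inner_J_self, mul_zero, mul_zero]
  have := is_const_of_deriv_eq_zero (fun t => (hd t).differentiableAt) (fun t => (hd t).deriv) t 0
  exact (pow_left_inj₀ (norm_nonneg _) (norm_nonneg _) two_ne_zero).1 this

lemma lipschitzOnWith_magneticVectorField {K : ℝ≥0} (hB : LipschitzWith K B) {M : ℝ≥0}
    (hM : ∀ q, |B q| ≤ M) (v : ℝ≥0) :
    LipschitzOnWith (1 + M + K * v) (magneticVectorField B) {x | ‖x.2‖ ≤ v} := by
  refine LipschitzOnWith.of_dist_le_mul fun x hx y hy => ?_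
  rw [dist_eq_norm, dist_eq_norm]
  push_cast
  have h1 : ‖x.1 - y.1‖ ≤ ‖x - y‖ := norm_fst_le (x - y)
  have h2 : ‖x.2 - y.2‖ ≤ ‖x - y‖ := norm_snd_le (x - y)
  have h0 := norm_nonneg (x - y)
  have hM0 := M.coe_nonneg
  have hKv : (0 : ℝ) ≤ K * v := by positivity
  have hM1 := mul_nonneg hM0 h0
  have hK1 := mul_nonneg hKv h0
  refine max_le ?_ ?_
  · change ‖x.2 - y.2‖ ≤ _
    linarith
  · change ‖B x.1 • J x.2 - B y.1 • J y.2‖ ≤ _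
    have h3 : B x.1 • J x.2 - B y.1 • J y.2
        = B x.1 • J (x.2 - y.2) + (B x.1 - B y.1) • J y.2 := by
      rw [J_sub]; module
    rw [h3]
    refine (norm_add_le _ _).trans ?_
    rw [norm_smul, norm_smul, norm_J, norm_J, Real.norm_eq_abs, Real.norm_eq_abs]
    have h4 : |B x.1| * ‖x.2 - y.2‖ ≤ M * ‖x - y‖ :=
      mul_le_mul (hM _) h2 (norm_nonneg _) hM0
    have h5 : |B x.1 - B y.1| ≤ K * ‖x - y‖ := by
      have := hB.dist_le_mul x.1 y.1
      rw [Real.dist_eq, dist_eq_norm] at this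
      exact this.trans (mul_le_mul_of_nonneg_left h1 K.coe_nonneg)
    have h6 : |B x.1 - B y.1| * ‖y.2‖ ≤ K * ‖x - y‖ * v :=
      mul_le_mul h5 hy (norm_nonneg _) (by positivity)
    linarith

/-- Trajectories are determined by their initial points. -/
lemma IsTrajectory.eq_of_eq {K : ℝ≥0} (hB : LipschitzWith K B) {M : ℝ≥0} (hM : ∀ q, |B q| ≤ M)
    (h : IsTrajectory B γ) (h' : IsTrajectory B γ') (h0 : γ 0 = γ' 0) : γ = γ' := by
  refine ODE_solution_unique_univ (v := fun _ => magneticVectorField B)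
    (s := fun _ => {x | ‖x.2‖ ≤ ‖(γ 0).2‖₊}) (t₀ := 0)
    (fun _ => lipschitzOnWith_magneticVectorField hB hM _)
    (fun t => ⟨h t, (h.norm_snd t).le⟩) (fun t => ⟨h' t, ?_⟩) h0
  rw [mem_ofPred_eq, h'.norm_snd, h0]
  exact le_rfl

lemma IsTrajectory.magneticFlow_eq {K : ℝ≥0} (hB : LipschitzWith K B) {M : ℝ≥0}
    (hM : ∀ q, |B q| ≤ M) (h : IsTrajectory B γ) (t : ℝ) : magneticFlow B t (γ 0) = γ t := by
  have hex : ∃ γ' : ℝ → Phase, IsTrajectory B γ' ∧ γ' 0 = γ 0 := ⟨γ, h, rfl⟩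
  rw [magneticFlow, dif_pos hex]
  exact congrFun (IsTrajectory.eq_of_eq hB hM hex.choose_spec.1 h hex.choose_spec.2) t

lemma IsTrajectory.iterate_eq {K : ℝ≥0} (hB : LipschitzWith K B) {M : ℝ≥0}
    (hM : ∀ q, |B q| ≤ M) (h : IsTrajectory B γ) (k : ℕ) :
    (magneticFlow B 1)^[k] (γ 0) = γ k := by
  induction k with
  | zero => simp
  | succ k ih =>
    rw [Function.iterate_succ_apply', ih]
    have := (h.shift k).magneticFlow_eq hB hM 1
    rw [add_zero] at this
    rw [this, Nat.cast_succ]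

/-- Trajectories of equal speed do not separate by more than a constant factor in a unit of
time. -/
lemma IsTrajectory.dist_le {K : ℝ≥0} (hB : LipschitzWith K B) {M : ℝ≥0} (hM : ∀ q, |B q| ≤ M)
    (h : IsTrajectory B γ) (h' : IsTrajectory B γ') {v : ℝ≥0} (hv : ‖(γ 0).2‖ = v)
    (hv' : ‖(γ' 0).2‖ = v) (k : ℕ) {s : ℝ} (hs : s ∈ Icc (0 : ℝ) 1) :
    dist (γ (k + s)) (γ' (k + s)) ≤ dist (γ k) (γ' k) * Real.exp (1 + M + K * v) := by
  have hc : ∀ {η : ℝ → Phase}, IsTrajectory B η → Continuous η := fun hη =>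
    continuous_iff_continuousAt.2 fun t => (hη t).continuousAt
  have h1 := dist_le_of_trajectories_ODE_of_mem (v := fun _ => magneticVectorField B)
    (s := fun _ => {x | ‖x.2‖ ≤ v}) (a := 0) (b := 1)
    (fun _ _ => lipschitzOnWith_magneticVectorField hB hM v)
    (hc (h.shift k)).continuousOn (fun t _ => (h.shift k t).hasDerivWithinAt)
    (fun t _ => ((h.norm_snd _).trans hv).le)
    (hc (h'.shift k)).continuousOn (fun t _ => (h'.shift k t).hasDerivWithinAt)
    (fun t _ => ((h'.norm_snd _).trans hv').le) le_rfl s hs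
  rw [add_zero, sub_zero] at h1
  refine h1.trans (mul_le_mul_of_nonneg_left (Real.exp_le_exp.2 ?_) dist_nonneg)
  push_cast
  exact mul_le_of_le_one_right (by positivity) hs.2

/-- A motion at unit speed with lifted direction, run through at speed `v`, is a trajectory. -/
lemma isTrajectory_of_lifted {A : Plane} {v : ℝ} (hv : v ≠ 0) {γ : ℝ → Plane × ℝ}
    (hγ : ∀ t, HasDerivAt γ (liftedField A (fun q => B q / v) (γ t)) t) :
    IsTrajectory B fun t => ((γ (v * t)).1, v • rotated A (γ (v * t)).2) := by
  intro t
  have ht : HasDerivAt (fun t : ℝ => v * t) v t := by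
    simpa using (hasDerivAt_id' t).const_mul v
  have h1 := (hγ (v * t)).scomp t ht
  have h2 : HasDerivAt (fun t => (γ (v * t)).1) (v • rotated A (γ (v * t)).2) t := h1.fst
  have h3 : HasDerivAt (fun t => (γ (v * t)).2) (v • -(B (γ (v * t)).1 / v)) t := h1.snd
  have h4 := ((hasDerivAt_rotated A (γ (v * t)).2).scomp t h3).const_smul v
  refine h2.prodMk (h4.congr_deriv ?_)
  rw [J_smul, J_rotated, smul_eq_mul, mul_neg, mul_div_cancel₀ _ hv]
  module

end MagneticBumps

/-! ### Motions between two bumps -/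

/-- The turning numbers that code a word: `1` and `3` half turns. -/
def turning {N : ℕ} (W : Fin N → Bool) (j : ℕ) : ℝ :=
  if h : j < N then (if W ⟨j, h⟩ then 3 else 1) else 1

lemma turning_eq {N : ℕ} (W : Fin N → Bool) (j : ℕ) : turning W j = 1 ∨ turning W j = 3 := by
  unfold turning
  split_ifs <;> simp

/-- The axis direction is reversed by each odd number of half turns. -/
lemma cos_sin_axisAngle {σ w : ℕ → ℝ} (hσ : ∀ j, σ j * σ j = 1) (hw : ∀ j, w j = 1 ∨ w j = 3)
    (j : ℕ) : Real.cos (axisAngle σ w j) = -(-1) ^ j ∧ Real.sin (axisAngle σ w j) = 0 := by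
  induction j with
  | zero => simp [axisAngle]
  | succ j ih =>
    have h3 : Real.cos (3 * π) = -1 := by
      have := Real.cos_nat_mul_pi 3
      push_cast at this
      rw [this]; norm_num
    have h3' : Real.sin (3 * π) = 0 := by
      have := Real.sin_nat_mul_pi 3
      push_cast at this
      exact this
    have key : Real.cos (σ j * w j * π) = -1 ∧ Real.sin (σ j * w j * π) = 0 := by
      rcases mul_self_eq_one_iff.1 (hσ j) with h | h <;> rcases hw j with h' | h' <;>
        simp [h, h', h3, h3']
    rw [axisAngle_succ, Real.cos_sub, Real.sin_sub, key.1, key.2, ih.1, ih.2, pow_succ]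
    constructor <;> ring

/-- If two words first differ at the letter `i`, the axis directions after it differ by a full
turn. -/
lemma turning_injective {N : ℕ} {σ : ℕ → ℝ} (hσ : ∀ j, σ j * σ j = 1) {W W' : Fin N → Bool}
    (h : ∀ i < N, |axisAngle σ (turning W) (i + 1) - axisAngle σ (turning W') (i + 1)| < 2 * π) :
    W = W' := by
  have key : ∀ i < N, turning W i = turning W' i := by
    intro i
    induction i using Nat.strong_induction_on with
    | _ i ih =>
      intro hi
      have hprev : axisAngle σ (turning W) i = axisAngle σ (turning W') i := by
        rw [axisAngle, axisAngle, Finset.sum_congr rfl fun j hj => ?_]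
        rw [Finset.mem_range] at hj
        rw [ih j hj (hj.trans hi)]
      have h1 := h i hi
      rw [axisAngle_succ, axisAngle_succ, hprev] at h1
      have h2 : axisAngle σ (turning W') i - σ i * turning W i * π
          - (axisAngle σ (turning W') i - σ i * turning W' i * π)
          = σ i * ((turning W' i - turning W i) * π) := by ring
      have habs : |σ i| = 1 := by
        rcases mul_self_eq_one_iff.1 (hσ i) with h | h <;> simp [h]
      rw [h2, abs_mul, habs, one_mul, abs_mul, abs_of_pos Real.pi_pos] at h1
      have h3 := lt_of_mul_lt_mul_right h1 Real.pi_pos.le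
      rcases turning_eq W i with e | e <;> rcases turning_eq W' i with e' | e' <;>
        rw [e, e'] at h3 <;> rw [e, e'] <;> norm_num at h3
  funext i
  have := key i i.2
  rw [turning, turning, dif_pos i.2, dif_pos i.2] at this
  cases hW : W i <;> cases hW' : W' i <;> simp_all

namespace MagneticBumps

/-- Directions that start equal and never become opposite differ by less than a half turn. -/
lemma abs_sub_lt_pi {A : Plane} (hA : ‖A‖ = 1) {δ δ' : ℝ → ℝ} (hδ : Continuous δ)
    (hδ' : Continuous δ') (h0 : δ 0 = δ' 0) {T : ℝ}
    (h : ∀ t ∈ Icc 0 T, ‖rotated A (δ t) - rotated A (δ' t)‖ < 2) {t : ℝ} (ht : t ∈ Icc 0 T) :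
    |δ t - δ' t| < π := by
  by_contra hcon
  obtain ⟨s, hs, hsπ⟩ := intermediate_value_Icc ht.1
    (f := fun t => |δ t - δ' t|) (by fun_prop) ⟨by simpa [h0] using Real.pi_pos.le, not_lt.1 hcon⟩
  have hs' := h s ⟨hs.1, hs.2.trans ht.2⟩
  have hopp : rotated A (δ s) = -rotated A (δ' s) := by
    rcases (abs_eq Real.pi_pos.le).1 hsπ with e | e
    · rw [← rotated_add_pi]
      congr 1; linarith
    · have : δ' s = δ s + π := by linarith
      rw [this, rotated_add_pi, neg_neg]
  rw [hopp, ← neg_add', norm_neg, ← two_smul ℝ, norm_smul, norm_rotated hA] at hs'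
  norm_num at hs'

lemma inner_rotated {A : Plane} (hA : ‖A‖ = 1) (φ : ℝ) :
    inner ℝ A (rotated A φ) = Real.cos φ := by
  rw [rotated, inner_sub_right, inner_smul_right, inner_smul_right, inner_J_self,
    real_inner_self_eq_norm_sq, hA]
  ring

namespace Bump

/-- Scattering at the bump `b` at the energy `E`: to each normalised angular momentum between `x`
and `y` belongs a passage through the disc that takes at most the time `C` (at unit speed) and
turns the direction by `S`, an angle between `0` and `-4π`. -/
structure Scatters (b : Bump) (E C : ℝ) (S : ℝ → ℝ) (x y : ℝ) : Prop where
  critical : ∃ K, CriticalProfile (b.normalProfile E) b.radius (b.outerRadius E) K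
  left_mem : x ∈ Icc (-b.radius) (criticalValue (b.normalProfile E) b.radius (b.outerRadius E))
  right_mem : y ∈ Icc (-b.radius) (criticalValue (b.normalProfile E) b.radius (b.outerRadius E))
  continuousOn : ContinuousOn S (uIcc x y)
  left_eq : S x = 0
  right_eq : S y = -(4 * π)
  passage : ∀ i ∈ uIcc x y, ∃ T ∈ Icc 0 C, ∃ z Δ, ReducedSolution (b.normalProfile E) z Δ ∧
    z 0 = entryState b.radius i ∧ Δ 0 = 0 ∧ (∀ t ∈ Icc 0 T, ‖z t‖ ≤ b.radius) ∧
    z T = exitState b.radius i ∧ Δ T = S i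

/-- The duration of the passages is bounded uniformly in the energy, since the outermost circular
orbits do not shrink to the center. -/
lemma exists_scatters (b : Bump) : ∃ C, 0 ≤ C ∧ ∀ E ∈ Ioc 0 b.maxEnergy, ∃ S x y,
    b.Scatters E C S x y := by
  obtain ⟨r₀, hr₀, h⟩ := b.exists_le_outerRadius
  have hR := b.radius_pos
  refine ⟨b.radius * (2 * π + b.radius ^ 3 / (2 * r₀ ^ 3) + 4 * π), by positivity,
    fun E hE => ?_⟩
  obtain ⟨hle, hgr⟩ := h E hE
  obtain ⟨K, hK⟩ := b.exists_criticalProfile hE.1 hgr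
  obtain ⟨S, x, y, hx, hy, hS, hSx, hSy, hpass⟩ :=
    hK.exists_scattering (A := 4 * π) (by positivity)
  refine ⟨S, x, y, ⟨K, hK⟩, Ico_subset_Icc_self hx, Ico_subset_Icc_self hy, hS, hSx, hSy,
    fun i hi => ?_⟩
  obtain ⟨T, hT, hz⟩ := hpass i hi
  refine ⟨T, ⟨hT.1, hT.2.trans ?_⟩, hz⟩
  gcongr

lemma Scatters.mem_of_uIcc {b : Bump} {E C x y i : ℝ} {S : ℝ → ℝ} (h : b.Scatters E C S x y)
    (hi : i ∈ uIcc x y) :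
    i ∈ Icc (-b.radius) (criticalValue (b.normalProfile E) b.radius (b.outerRadius E)) :=
  uIcc_subset_Icc h.left_mem h.right_mem hi

lemma Scatters.abs_le {b : Bump} {E C x y i : ℝ} {S : ℝ → ℝ} (h : b.Scatters E C S x y)
    (hi : i ∈ uIcc x y) : |i| ≤ b.radius := by
  obtain ⟨K, hK⟩ := h.critical
  exact hK.abs_momentum_le (h.mem_of_uIcc hi).1 (h.mem_of_uIcc hi).2

/-- The signed position along the axis from `b` to `b'`, measured from the middle of the gap
between the two discs. -/
noncomputable def gapCoord (b b' : Bump) (q : Plane) : ℝ :=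
  inner ℝ (axis b b') (q - b.center) - (b.radius + dist b.center b'.center - b'.radius) / 2

/-- Half the width of the gap between the discs of `b` and `b'`. -/
noncomputable def halfGap (b b' : Bump) : ℝ :=
  (dist b.center b'.center - b.radius - b'.radius) / 2

variable {b b' : Bump}

lemma norm_axis (hd : 0 < dist b.center b'.center) : ‖axis b b'‖ = 1 := by
  rw [axis, norm_smul, ← dist_eq_norm', norm_inv, Real.norm_eq_abs, abs_of_pos hd,
    inv_mul_cancel₀ hd.ne']

lemma axis_comm (b b' : Bump) : axis b' b = -axis b b' := by
  rw [axis, axis, dist_comm, ← smul_neg, neg_sub]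

lemma abs_gapCoord_sub_le (hd : 0 < dist b.center b'.center) (p q : Plane) :
    |gapCoord b b' p - gapCoord b b' q| ≤ dist p q := by
  rw [gapCoord, gapCoord, sub_sub_sub_cancel_right, ← inner_sub_right, sub_sub_sub_cancel_right,
    dist_eq_norm]
  refine (abs_real_inner_le_norm _ _).trans ?_
  rw [norm_axis hd, one_mul]

lemma gapCoord_le_of_mem_disc (hd : 0 < dist b.center b'.center) {q : Plane} (hq : q ∈ b.disc) :
    gapCoord b b' q ≤ -halfGap b b' := by
  rw [disc, mem_closedBall, dist_eq_norm] at hq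
  have h1 := (le_abs_self _).trans (abs_real_inner_le_norm (axis b b') (q - b.center))
  rw [norm_axis hd, one_mul] at h1
  rw [gapCoord, halfGap]
  linarith

lemma le_gapCoord_of_mem_disc (hd : 0 < dist b.center b'.center) {q : Plane} (hq : q ∈ b'.disc) :
    halfGap b b' ≤ gapCoord b b' q := by
  rw [disc, mem_closedBall, dist_eq_norm] at hq
  have h1 := (neg_le_abs _).trans (abs_real_inner_le_norm (axis b b') (q - b'.center))
  rw [norm_axis hd, one_mul] at h1
  have h2 : q - b.center = (q - b'.center) + dist b.center b'.center • axis b b' := by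
    rw [axis, smul_inv_smul₀ hd.ne']
    abel
  rw [gapCoord, halfGap, h2, inner_add_right, inner_smul_right, real_inner_self_eq_norm_sq,
    norm_axis hd]
  linarith

end Bump

end MagneticBumps

/-! ### Coded motions -/

namespace MagneticBumps

/-- The alternating sequence `k, l, k, l, …`. -/
def alternate {n : ℕ} (k l : Fin n) (j : ℕ) : Fin n := if Even j then k else l

lemma alternate_zero {n : ℕ} (k l : Fin n) : alternate k l 0 = k := by simp [alternate]

lemma alternate_cases {n : ℕ} (k l : Fin n) (j : ℕ) :
    ((-1 : ℝ) ^ j = 1 ∧ alternate k l j = k ∧ alternate k l (j + 1) = l) ∨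
    ((-1 : ℝ) ^ j = -1 ∧ alternate k l j = l ∧ alternate k l (j + 1) = k) := by
  rcases Nat.even_or_odd j with h | h
  · exact Or.inl ⟨h.neg_one_pow, by simp [alternate, h], by simp [alternate, h, Nat.even_add_one]⟩
  · have h' := Nat.not_even_iff_odd.2 h
    exact Or.inr ⟨h.neg_one_pow, by simp [alternate, h'],
      by simp [alternate, h', Nat.even_add_one]⟩

variable {n : ℕ} {b : Fin n → Bump} {E : ℝ} {k l : Fin n}

lemma gapCoord_le_of_mem_alternate (hd : 0 < dist (b k).center (b l).center) {j : ℕ} {q : Plane}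
    (hq : q ∈ (b (alternate k l j)).disc) :
    (-1) ^ j * (b k).gapCoord (b l) q ≤ -(b k).halfGap (b l) := by
  rcases alternate_cases k l j with ⟨h1, h2, -⟩ | ⟨h1, h2, -⟩ <;> rw [h2] at hq <;> rw [h1]
  · rw [one_mul]
    exact Bump.gapCoord_le_of_mem_disc hd hq
  · rw [neg_one_mul, neg_le_neg_iff]
    exact Bump.le_gapCoord_of_mem_disc hd hq

lemma axis_alternate {σ w : ℕ → ℝ} (hσ : ∀ j, σ j * σ j = 1) (hw : ∀ j, w j = 1 ∨ w j = 3)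
    (j : ℕ) : (b (alternate k l j)).axis (b (alternate k l (j + 1)))
      = rotated ((b k).axis (b l)) (axisAngle σ w (j + 1)) := by
  obtain ⟨h1, h2⟩ := cos_sin_axisAngle hσ hw (j + 1)
  rw [rotated, h1, h2, zero_smul, sub_zero, pow_succ]
  rcases alternate_cases k l j with ⟨h, h', h''⟩ | ⟨h, h', h''⟩ <;> rw [h, h', h'']
  · simp
  · rw [Bump.axis_comm]
    simp

/-- The signs of the bumps along the alternating sequence. -/
noncomputable def alternateSign (b : Fin n → Bump) (E : ℝ) (k l : Fin n) (j : ℕ) : ℝ :=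
  (b (alternate k l j)).sign E

/-- A motion at unit speed that starts at the disc of the bump `k` in the direction opposite to the
axis from `k` to `l` and commutes between the two bumps. The sequence `D` lists the directions of
the passages from one disc to the next one, which follow the turning numbers given by the
word `W`. -/
structure CodedMotion (b : Fin n → Bump) (E : ℝ) (k l : Fin n) (P : ℝ) {N : ℕ} (W : Fin N → Bool)
    (γ : ℝ → Plane × ℝ) (u c D : ℕ → ℝ) : Prop where
  hasDerivAt : ∀ t, HasDerivAt γ
    (liftedField ((b k).axis (b l)) (fun q => totalField b q / √(2 * E)) (γ t)) t
  start_mem : (γ 0).1 ∈ (b k).disc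
  start_direction : (γ 0).2 = π
  commutes : Commutes N ((b k).halfGap (b l)) (fun t => (b k).gapCoord (b l) (γ t).1)
    (fun t => (γ t).2) u c D
  duration : u N ≤ N * P
  direction : ∀ j ≤ N, |D j - axisAngle (alternateSign b E k l) (turning W) j| < π / 2

/-- Every word is realised by a motion. -/
lemma exists_codedMotion (hdisj : ∀ k l, k ≠ l → Disjoint (b k).disc (b l).disc) (hE : 0 < E)
    (hgp : InGeneralPosition b E) (hkl : k ≠ l) {C : Fin n → ℝ} {S : Fin n → ℝ → ℝ}
    {x y : Fin n → ℝ} (hC : ∀ k, 0 ≤ C k) (hS : ∀ k, (b k).Scatters E (C k) (S k) (x k) (y k))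
    {N : ℕ} (W : Fin N → Bool) : ∃ γ u c D, CodedMotion b E k l
      (C k + C l + dist (b k).center (b l).center) W γ u c D := by
  have hgap : ∀ k l, k ≠ l → (b k).radius + (b l).radius < dist (b k).center (b l).center := by
    intro k l hkl
    have := hdisj k l hkl
    rwa [Bump.disc, Bump.disc, disjoint_closedBall_closedBall_iff (b k).radius_pos.le
      (b l).radius_pos.le] at this
  have hd : 0 < dist (b k).center (b l).center := by
    linarith [hgap k l hkl, (b k).radius_pos, (b l).radius_pos]
  have hA : ‖(b k).axis (b l)‖ = 1 := Bump.norm_axis hd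
  set A := (b k).axis (b l)
  set a := alternate k l with ha
  have hne : ∀ j, a j ≠ a (j + 1) := fun j => by
    rcases alternate_cases k l j with ⟨-, h, h'⟩ | ⟨-, h, h'⟩ <;> rw [ha, h, h']
    · exact hkl
    · exact hkl.symm
  have hdist : ∀ j, dist (b (a j)).center (b (a (j + 1))).center
      = dist (b k).center (b l).center := fun j => by
    rcases alternate_cases k l j with ⟨-, h, h'⟩ | ⟨-, h, h'⟩ <;> rw [ha, h, h']
    exact dist_comm _ _
  have hCa : ∀ j, C (a j) ≤ C k + C l := fun j => by
    rcases alternate_cases k l j with ⟨-, h, h'⟩ | ⟨-, h, h'⟩ <;> rw [ha, h] <;>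
      linarith [hC k, hC l]
  set σ := alternateSign b E k l with hσdef
  have hσ : ∀ j, σ j * σ j = 1 := fun j => (b (a j)).sign_mul_self E
  have hw := turning_eq W
  obtain ⟨D, m, hD0, hm, hDΩ, hDm⟩ := exists_itinerary (σ := σ) (x := fun j => x (a j))
    (y := fun j => y (a j)) (R := fun j => (b (a j)).radius) (w := turning W)
    (d := fun j => dist (b (a j)).center (b (a (j + 1))).center) (S := fun j => S (a j)) hσ
    (fun j => (hS (a j)).continuousOn) (fun j => (hS (a j)).left_eq)
    (fun j => (hS (a j)).right_eq) (fun j => (hS (a j)).abs_le left_mem_uIcc)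
    (fun j => (hS (a j)).abs_le right_mem_uIcc) (fun j => hgap _ _ (hne j))
    (fun j => by rcases hw j with h | h <;> rw [h] <;> norm_num) N
  obtain ⟨K₀, hK₀⟩ := totalField_lipschitz b
  obtain ⟨M, hM0, hM⟩ := totalField_bounded b
  have hv : 0 < √(2 * E) := Real.sqrt_pos.2 (by positivity)
  have hβ : LipschitzWith (K₀ / (√(2 * E)).toNNReal) fun q => totalField b q / √(2 * E) := by
    refine LipschitzWith.of_dist_le_mul fun p q => ?_
    rw [Real.dist_eq, ← sub_div, abs_div, abs_of_pos hv, div_le_iff₀ hv]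
    refine (hK₀.dist_le_mul p q).trans (le_of_eq ?_)
    rw [NNReal.coe_div, Real.coe_toNNReal _ hv.le]
    field_simp
  obtain ⟨γ, hγ0, hγ⟩ := exists_lifted_solution hA hβ (M := M / √(2 * E)) (by positivity)
    (fun q => by
      rw [abs_div, abs_of_pos hv]
      exact div_le_div_of_nonneg_right (hM q) hv.le)
    (entryPoint A (b (a 0)) E (m 0) π)
  -- The passage through the `j`-th disc and the flight to the next one.
  have hstep : ∀ j, ∃ T τ : ℝ, j < N → (T ∈ Icc 0 (C (a j)) ∧
      τ ∈ Icc 0 (dist (b k).center (b l).center) ∧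
      ∀ γ : ℝ → Plane × ℝ,
      (∀ t, HasDerivAt γ (liftedField A (fun q => totalField b q / √(2 * E)) (γ t)) t) →
      γ 0 = entryPoint A (b (a j)) E (m j) (D j) →
      (∀ t ∈ Icc 0 T, (γ t).1 ∈ (b (a j)).disc) ∧
      (∀ t ∈ Icc 0 τ, γ (T + t) = ((γ T).1 + t • rotated A (D (j + 1)), D (j + 1))) ∧
      γ (T + τ) = entryPoint A (b (a (j + 1))) E (m (j + 1)) (D (j + 1))) := by
    intro j
    by_cases hj : j < N
    · obtain ⟨T, hT, z, Δ, hz, hz0, hΔ0, hle, hzT, hΔT⟩ := (hS (a j)).passage (m j) (hm j hj.le)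
      obtain ⟨K, hK⟩ := (hS (a j)).critical
      obtain ⟨K', hK'⟩ := (hS (a (j + 1))).critical
      obtain ⟨τ, hτ, hτγ⟩ := exists_transition hdisj hE hgp hA hβ (hne j)
        (axis_alternate hσ hw j) hK hK' ((hS (a j)).mem_of_uIcc (hm j hj.le))
        ((hS (a (j + 1))).mem_of_uIcc (hm (j + 1) hj)) hz hz0 hΔ0 hT.1 hle hzT
        (δ₀ := D j) (by rw [hΔT]; exact (hDm j hj).1) (hDΩ (j + 1) hj).le (hDm j hj).2
      rw [hdist] at hτ
      exact ⟨T, τ, fun _ => ⟨hT, hτ, hτγ⟩⟩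
    · exact ⟨0, 0, fun h => absurd h hj⟩
  choose T τ hstep using hstep
  set u : ℕ → ℝ := fun j => ∑ i ∈ Finset.range j, (T i + τ i) with hu
  have hu_succ : ∀ j, u (j + 1) = u j + T j + τ j := fun j => by
    simp only [hu, Finset.sum_range_succ]; ring
  have hentry : ∀ j ≤ N, γ (u j) = entryPoint A (b (a j)) E (m j) (D j) := by
    intro j
    induction j with
    | zero => intro _; rw [hD0, ← hγ0]; simp [hu]
    | succ j ih =>
      intro hj
      obtain ⟨-, -, h⟩ := hstep j hj
      have := (h (fun t => γ (u j + t)) (fun t => (hγ (u j + t)).comp_const_add (u j) t)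
        (by rw [add_zero]; exact ih (by omega))).2.2
      rw [← this, hu_succ, add_assoc]
  have hmove : ∀ j < N, (∀ t ∈ Icc 0 (T j), (γ (u j + t)).1 ∈ (b (a j)).disc) ∧
      ∀ t ∈ Icc 0 (τ j), γ (u j + (T j + t))
        = ((γ (u j + T j)).1 + t • rotated A (D (j + 1)), D (j + 1)) := fun j hj => by
    obtain ⟨-, -, h⟩ := hstep j hj
    obtain ⟨h1, h2, -⟩ := h (fun t => γ (u j + t))
      (fun t => (hγ (u j + t)).comp_const_add (u j) t) (by rw [add_zero]; exact hentry j hj.le)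
    exact ⟨h1, h2⟩
  have hmdisc : ∀ j ≤ N, (γ (u j)).1 ∈ (b (a j)).disc := fun j hj => by
    rw [hentry j hj]
    exact entryPoint_mem_disc hA _ ((hS (a j)).abs_le (hm j hj)) _
  have hu0 : u 0 = 0 := by simp [hu]
  refine ⟨γ, u, fun j => u j + T j, D, hγ, ?_, ?_, ⟨hu0, ?_, ?_, ?_, ?_, ?_, ?_⟩, ?_, hDΩ⟩
  · have := hmdisc 0 (Nat.zero_le N)
    rwa [hu0, ha, alternate_zero] at this
  · rw [hγ0, entryPoint]
  · intro j hj
    linarith [(hstep j hj).1.1]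
  · intro j hj
    rw [hu_succ]
    linarith [(hstep j hj).2.1.1]
  · intro j hj t ht
    refine gapCoord_le_of_mem_alternate hd ?_
    have := (hmove j hj).1 (t - u j) ⟨by linarith [ht.1], by linarith [ht.2]⟩
    rwa [add_sub_cancel] at this
  · intro j hj
    have := gapCoord_le_of_mem_alternate hd (hmdisc (j + 1) hj)
    rw [pow_succ] at this
    linarith
  · intro j hj
    have hcos : 0 ≤ (-1) ^ j * Real.cos (D (j + 1)) := by
      obtain ⟨h1, h2⟩ := cos_sin_axisAngle hσ hw (j + 1)
      have h3 := Real.cos_nonneg_of_mem_Icc (abs_le.1 (hDΩ (j + 1) hj).le)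
      rw [Real.cos_sub, h1, h2, pow_succ] at h3
      linarith
    intro t ht t' ht' htt
    rw [hu_succ] at ht ht'
    have hγt : ∀ t ∈ Icc (u j + T j) (u j + T j + τ j), γ t
        = ((γ (u j + T j)).1 + (t - (u j + T j)) • rotated A (D (j + 1)), D (j + 1)) := by
      intro t ht
      have := (hmove j hj).2 (t - (u j + T j)) ⟨by linarith [ht.1], by linarith [ht.2]⟩
      rwa [← add_assoc, add_sub_cancel] at this
    have hval : ∀ t ∈ Icc (u j + T j) (u j + T j + τ j), (b k).gapCoord (b l) (γ t).1
        = (b k).gapCoord (b l) (γ (u j + T j)).1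
          + (t - (u j + T j)) * Real.cos (D (j + 1)) := by
      intro t ht
      rw [hγt t ht, Bump.gapCoord, Bump.gapCoord, add_sub_right_comm, inner_add_right,
        inner_smul_right, inner_rotated hA]
      ring
    simp only
    rw [hval t ht, hval t' ht']
    have := mul_le_mul_of_nonneg_right htt hcos
    linarith
  · intro j hj t ht
    rw [hu_succ] at ht
    have := (hmove j hj).2 (t - (u j + T j)) ⟨by linarith [ht.1], by linarith [ht.2]⟩
    rw [← add_assoc, add_sub_cancel] at this
    simp only [this]
  · have : u N ≤ ∑ i ∈ Finset.range N, (C k + C l + dist (b k).center (b l).center) := by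
      refine Finset.sum_le_sum fun i hi => ?_
      obtain ⟨h1, h2, -⟩ := hstep i (Finset.mem_range.1 hi)
      exact add_le_add (h1.2.trans (hCa i)) h2.2
    rwa [Finset.sum_const, Finset.card_range, nsmul_eq_mul] at this

/-- Motions that stay close to each other have the same code. -/
lemma CodedMotion.word_eq {P : ℝ} {N : ℕ} {W W' : Fin N → Bool} {γ γ' : ℝ → Plane × ℝ}
    {u c D u' c' D' : ℕ → ℝ} (hd : 0 < dist (b k).center (b l).center)
    (h : CodedMotion b E k l P W γ u c D) (h' : CodedMotion b E k l P W' γ' u' c' D')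
    {ε : ℝ} (hε : ε < (b k).halfGap (b l))
    (hpos : ∀ t ∈ Icc 0 (N * P), dist (γ t).1 (γ' t).1 ≤ ε)
    (hdir : ∀ t ∈ Icc 0 (N * P),
      ‖rotated ((b k).axis (b l)) (γ t).2 - rotated ((b k).axis (b l)) (γ' t).2‖ < 2) :
    W = W' := by
  have hcont : ∀ {W : Fin N → Bool} {γ u c D}, CodedMotion b E k l P W γ u c D →
      Continuous fun t => (γ t).2 := fun h =>
    continuous_snd.comp (continuous_iff_continuousAt.2 fun t => (h.hasDerivAt t).continuousAt)
  have hσ : ∀ j, alternateSign b E k l j * alternateSign b E k l j = 1 := fun j =>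
    (b (alternate k l j)).sign_mul_self E
  refine turning_injective hσ fun i hi => ?_
  have h1 := h.commutes.abs_direction_sub_lt h'.commutes hε h.duration h'.duration
    (fun t ht => (Bump.abs_gapCoord_sub_le hd _ _).trans (hpos t ht))
    (fun t ht => abs_sub_lt_pi (Bump.norm_axis hd) (hcont h) (hcont h')
      (by rw [h.start_direction, h'.start_direction]) hdir ht) hi
  have h2 := abs_lt.1 (h.direction (i + 1) hi)
  have h3 := abs_lt.1 (h'.direction (i + 1) hi)
  have h4 := abs_lt.1 h1
  rw [abs_lt]
  constructor <;> linarith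

end MagneticBumps

/-! ### The entropy bound -/

theorem mainTheorem2 (n : ℕ) (hn : 2 ≤ n) (b : Fin n → MagneticBumps.Bump)
    (hdisj : ∀ k l, k ≠ l → Disjoint (b k).disc (b l).disc) :
    ∃ c : ℝ, 0 < c ∧ ∀ E ∈ Set.Ioc 0 (MagneticBumps.maxEnergy b),
      MagneticBumps.InGeneralPosition b E →
        ((c * √E : ℝ) : EReal) ≤
          MagneticBumps.flowEntropy (MagneticBumps.magneticFlow (MagneticBumps.totalField b))
            (MagneticBumps.energySurface E) := by
  obtain ⟨k, l, hkl⟩ : ∃ k l : Fin n, k ≠ l :=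
    ⟨⟨0, by omega⟩, ⟨1, by omega⟩, by simp [Fin.ext_iff]⟩
  choose C hC hS using fun k => (b k).exists_scatters
  have hgap : (b k).radius + (b l).radius < dist (b k).center (b l).center := by
    have := hdisj k l hkl
    rwa [MagneticBumps.Bump.disc, MagneticBumps.Bump.disc, disjoint_closedBall_closedBall_iff
      (b k).radius_pos.le (b l).radius_pos.le] at this
  have hd : 0 < dist (b k).center (b l).center := by
    linarith [(b k).radius_pos, (b l).radius_pos]
  have hη : 0 < (b k).halfGap (b l) := by
    rw [MagneticBumps.Bump.halfGap]; linarith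
  set A := (b k).axis (b l) with hAdef
  have hA : ‖A‖ = 1 := MagneticBumps.Bump.norm_axis hd
  set P := C k + C l + dist (b k).center (b l).center with hPdef
  have hP : 0 < P := by linarith [hC k, hC l]
  refine ⟨Real.log 2 * √2 / (2 * P), by
    have := Real.log_pos one_lt_two
    positivity, fun E hE hgp => ?_⟩
  have hmax : ∀ k, E ∈ Ioc 0 (b k).maxEnergy := fun k =>
    ⟨hE.1, hE.2.trans (ciInf_le (Set.finite_range _).bddBelow k)⟩
  choose S x y hS using fun k => hS k E (hmax k)
  set v := √(2 * E) with hv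
  have hv0 : 0 < v := Real.sqrt_pos.2 (by linarith [hE.1])
  obtain ⟨K, hK⟩ := MagneticBumps.totalField_lipschitz b
  obtain ⟨M, hM0, hM⟩ := MagneticBumps.totalField_bounded b
  have hc : Real.log 2 * √2 / (2 * P) * √E = Real.log 2 / (2 * (P / v)) := by
    rw [hv, Real.sqrt_mul zero_le_two]
    have : √E ≠ 0 := (Real.sqrt_pos.2 hE.1).ne'
    have : √2 ≠ 0 := (Real.sqrt_pos.2 two_pos).ne'
    field_simp
  rw [hc, MagneticBumps.flowEntropy]
  -- Points that are `r / L` close at an integer time are `r` close up to the next one; then the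
  -- positions and the unit velocities are close enough to recover the word.
  set r := min ((b k).halfGap (b l) / 2) v with hr
  have hr0 : 0 < r := lt_min (by positivity) hv0
  set L := Real.exp (1 + M + K * v) with hL
  refine le_bowenEntropy_of_separated (X := MagneticBumps.Phase)
    (Q := (b k).disc ×ˢ sphere 0 v) (ε := r / L)
    ((isCompact_closedBall _ _).prod (isCompact_sphere _ _)) ?_
    (div_pos hr0 (Real.exp_pos _)) (div_pos hP hv0) fun N => ?_
  · rintro ⟨q, p⟩ ⟨-, hp⟩
    rw [mem_sphere_zero_iff_norm] at hp
    change ‖p‖ ^ 2 / 2 = E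
    rw [hp, hv, Real.sq_sqrt (by linarith [hE.1])]
    ring
  choose γ u c D hγ using fun W : Fin N → Bool =>
    MagneticBumps.exists_codedMotion hdisj hE.1 hgp hkl hC hS W
  set X : (Fin N → Bool) → ℝ → MagneticBumps.Phase := fun W t =>
    ((γ W (v * t)).1, v • MagneticBumps.rotated A (γ W (v * t)).2) with hX
  have htraj : ∀ W, MagneticBumps.IsTrajectory (MagneticBumps.totalField b) (X W) := fun W =>
    MagneticBumps.isTrajectory_of_lifted hv0.ne' (hγ W).hasDerivAt
  have hspeed : ∀ W, ‖(X W 0).2‖ = v := fun W => by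
    rw [hX]
    simp only
    rw [norm_smul, MagneticBumps.norm_rotated hA, Real.norm_eq_abs, abs_of_pos hv0, mul_one]
  refine ⟨fun W => X W 0, fun W => ⟨?_, ?_⟩, fun W W' hne => ?_⟩
  · have := (hγ W).start_mem
    simpa [hX] using this
  · rw [mem_sphere_zero_iff_norm]
    exact hspeed W
  by_contra! hcon
  have hclose : ∀ t ∈ Icc 0 (N * P), dist (X W (t / v)) (X W' (t / v)) < r := by
    intro t ht
    have ht0 : 0 ≤ t / v := div_nonneg ht.1 hv0.le
    have hfl : (⌊t / v⌋₊ : ℝ) ≤ N * (P / v) := by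
      refine (Nat.floor_le ht0).trans ?_
      rw [← mul_div_assoc]
      exact div_le_div_of_nonneg_right ht.2 hv0.le
    have h1 := hcon _ hfl
    rw [(htraj W).iterate_eq hK (M := ⟨M, hM0⟩) hM,
      (htraj W').iterate_eq hK (M := ⟨M, hM0⟩) hM] at h1
    have h2 := (htraj W).dist_le hK (M := ⟨M, hM0⟩) hM (htraj W') (v := ⟨v, hv0.le⟩) (hspeed W)
      (hspeed W') ⌊t / v⌋₊ (s := t / v - ⌊t / v⌋₊)
      ⟨sub_nonneg.2 (Nat.floor_le ht0), by linarith [Nat.lt_floor_add_one (t / v)]⟩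
    rw [add_sub_cancel] at h2
    exact h2.trans_lt ((lt_div_iff₀ (Real.exp_pos _)).1 h1)
  have hvt : ∀ t, v * (t / v) = t := fun t => mul_div_cancel₀ t hv0.ne'
  refine hne ((hγ W).word_eq hd (hγ W') (half_lt_self hη) (fun t ht => ?_) fun t ht => ?_)
  · have h1 : dist (X W (t / v)).1 (X W' (t / v)).1 ≤ _ :=
      (le_max_left _ _).trans (hclose t ht).le
    simp only [hX, hvt] at h1
    exact h1.trans (min_le_left _ _)
  · have h1 : dist (X W (t / v)).2 (X W' (t / v)).2 < _ :=
      (le_max_right _ _).trans_lt (hclose t ht)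
    simp only [hX, hvt] at h1
    rw [dist_eq_norm, ← smul_sub, norm_smul, Real.norm_eq_abs, abs_of_pos hv0] at h1
    have h2 := h1.trans_le (min_le_right _ _)
    have h3 := lt_of_mul_lt_mul_left (h2.trans_eq (mul_one v).symm) hv0.le
    linarith
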